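/- **Setting.** Let $\Lambda=\mathbb Z^2\subset\mathbb C$, let $\mathcal V$ be a Hilbert space (possibly infinite-dimensional), and put a copy $\mathcal V_j$ of $\mathcal V$ at each $j\in\Lambda$. For finite $X\subset\Lambda$ let $\mathscr A_X=\bigotimes_{j\in X}\mathcal B(\mathcal V_j)=\mathcal B\big(\bigotimes_{j\in X}\mathcal V_j\big)$, with the inclusions $A\mapsto A\otimes 1$; let $\mathscr A_\ell=\bigcup_X\mathscr A_X$ be the algebra of local observables and $\mathscr A$ its norm completion (the quasi-local algebra). An observable has support in $S\subset\Lambda$ if it lies in $\mathscr A_X$ for some finite $X\subset S$. Let $D_r$ be the set of sites in the disk of radius $r$ with center $0$. States of $\mathscr A$ are assumed to be locally normal: their restriction to each $\mathscr A_X$, $X$ finite, is given by a density matrix $\rho_X$; for disjoint $S,T\subset\Lambda$, $\omega|_S\otimes\omega|_T$ is the product state, given by $\rho_X\otimes\rho_Y$ on $\mathscr A_{X\cup Y}$ for finite $X\subset S$, $Y\subset T$. **Statement.** For all $C\ge 1$ and $\alpha>0$ there is a function $f:\mathbb R\to\mathbb R$, depending only on $C$ and $\alpha$, with $\lim_{r\to\infty}r^nf(r)=0$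 for every $n\in\mathbb N$, such that the following holds. Let $\psi,\psi'$ be unitarily equivalent pure states of $\mathscr A$, represented by cyclic unit vectors $|\psi\rangle,|\psi'\rangle$ of the same GNS representation of $\mathscr A$ on a Hilbert space $\mathcal H$. Suppose that 1. for all $R>r>0$, every local observable $\mathcal O$ with support in $D_r\cup(\Lambda\setminus D_R)$, and both $\omega=\psi$ and $\omega=\psi'$, $$\big|\langle\mathcal O\rangle_\omega-\langle\mathcal O\rangle_{\omega|_{D_r}\otimes\,\omega|_{\Lambda\setminus D_R}}\big|\le C e^{-\alpha(R-r)}\|\mathcal O\|;$$ 2. for all $r>0$ and every local observable $\mathcal O$ with support in $\Lambda\setminus D_r$, $$|\langle\mathcal O\rangle_\psi-\langle\mathcal O\rangle_{\psi'}|\le C e^{-\alpha r}\|\mathcal O\|.$$ Then: 1. there is a unitary $\mathcal U\in\mathscr A$ with $|\psi'\rangle=\mathcal U|\psi\rangle$ such that for every $r>0$ there is an observable $\mathcal U_r$ with support in $D_r$ and $\|\mathcal U-\mathcal U_r\|\le f(r)$; 2. there is a self-adjoint $\mathcal K\in\mathscr A$ such that $|\psi'\rangle-\mathcal K|\psi\rangle$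 is a scalar multiple of $|\psi\rangle$, and for every $r>0$ there is an observable $\mathcal K_r$ with support in $D_r$ and $\|\mathcal K-\mathcal K_r\|\le f(r)$. -/

import Mathlib

open scoped ENNReal InnerProductSpace

namespace SpinLattice

/-! ### Hilbert spaces with a distinguished orthonormal basis and `A ↦ A ⊗ 1` -/

/-- The Hilbert space `ℓ²(α)` with orthonormal basis indexed by `α`. -/
noncomputable abbrev L2 (α : Type*) := lp (fun _ : α => ℂ) 2

theorem L2.summable_sq {α : Type*} (v : L2 α) : Summable fun a => ‖v a‖ ^ 2 := by
  simpa using (lp.memℓp v).summable (by norm_num)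

theorem L2.norm_sq {α : Type*} (v : L2 α) : ‖v‖ ^ 2 = ∑' a, ‖v a‖ ^ 2 := by
  simpa using lp.norm_rpow_eq_tsum (p := 2) (by norm_num) v

theorem L2.mem {α : Type*} {f : α → ℂ} (h : Summable fun a => ‖f a‖ ^ 2) :
    Memℓp (E := fun _ : α => ℂ) f 2 := by
  apply memℓp_gen
  simpa using h

section Amplification

variable {α β γ : Type*} (e : γ ≃ α × β)

/-- For `ℓ²(γ) ≅ ℓ²(α) ⊗ ℓ²(β)`, the `b`-th component in `ℓ²(α)` of a vector of `ℓ²(γ)`. -/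
noncomputable def slice (b : β) (v : L2 γ) : L2 α :=
  ⟨fun a => v (e.symm (a, b)), L2.mem <| (L2.summable_sq v).comp_injective
    (i := fun a => e.symm (a, b)) fun a a' h => by simpa using h⟩

theorem slice_apply (b : β) (v : L2 γ) (a : α) : slice e b v a = v (e.symm (a, b)) := rfl

theorem slice_add (b : β) (v w : L2 γ) : slice e b (v + w) = slice e b v + slice e b w := by
  ext a; simp [slice_apply]

theorem slice_smul (b : β) (c : ℂ) (v : L2 γ) : slice e b (c • v) = c • slice e b v := by
  ext a; simp [slice_apply]

theorem summable_prod_sq (v : L2 γ) : Summable fun p : α × β => ‖v (e.symm p)‖ ^ 2 :=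
  (L2.summable_sq v).comp_injective e.symm.injective

theorem hasSum_slice (v : L2 γ) : HasSum (fun b => ‖slice e b v‖ ^ 2) (‖v‖ ^ 2) := by
  have h := summable_prod_sq e v
  have h' : Summable fun p : β × α => ‖v (e.symm p.swap)‖ ^ 2 :=
    h.comp_injective Prod.swap_injective
  have h1 : HasSum (fun p : β × α => ‖v (e.symm p.swap)‖ ^ 2) (‖v‖ ^ 2) := by
    rw [L2.norm_sq, ← ((Equiv.prodComm β α).trans e.symm).tsum_eq fun a => ‖v a‖ ^ 2]
    exact h'.hasSum
  refine h1.prod_fiberwise fun b => ?_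
  rw [L2.norm_sq]
  exact (L2.summable_sq (slice e b v)).hasSum

theorem ampFun_summable (A : L2 α →L[ℂ] L2 α) (v : L2 γ) :
    Summable fun p : β × α => ‖A (slice e p.1 v) p.2‖ ^ 2 := by
  rw [summable_prod_of_nonneg fun p => sq_nonneg _]
  refine ⟨fun b => L2.summable_sq (A (slice e b v)), ?_⟩
  refine Summable.of_nonneg_of_le (fun b => by positivity) (fun b => ?_)
    ((hasSum_slice e v).summable.mul_left (‖A‖ ^ 2))
  refine (L2.norm_sq (A (slice e b v))).symm.trans_le ?_
  rw [← mul_pow]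
  exact pow_le_pow_left₀ (norm_nonneg _) (A.le_opNorm _) 2

/-- The vector `(A ⊗ 1) v`. -/
noncomputable def ampFun (A : L2 α →L[ℂ] L2 α) (v : L2 γ) : L2 γ :=
  ⟨fun c => A (slice e (e c).2 v) (e c).1, L2.mem <| (ampFun_summable e A v).comp_injective
    (i := fun c => (e c).swap) (Prod.swap_injective.comp e.injective)⟩

theorem ampFun_apply (A : L2 α →L[ℂ] L2 α) (v : L2 γ) (c : γ) :
    ampFun e A v c = A (slice e (e c).2 v) (e c).1 := rfl

theorem slice_ampFun (A : L2 α →L[ℂ] L2 α) (b : β) (v : L2 γ) :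
    slice e b (ampFun e A v) = A (slice e b v) := by
  ext a; simp [slice_apply, ampFun_apply]

theorem norm_ampFun_le (A : L2 α →L[ℂ] L2 α) (v : L2 γ) : ‖ampFun e A v‖ ≤ ‖A‖ * ‖v‖ := by
  refine (sq_le_sq₀ (norm_nonneg _) (by positivity)).1 ?_
  rw [mul_pow]
  refine hasSum_le (fun b => ?_) (hasSum_slice e (ampFun e A v))
    ((hasSum_slice e v).mul_left (‖A‖ ^ 2))
  rw [slice_ampFun, ← mul_pow]
  exact pow_le_pow_left₀ (norm_nonneg _) (A.le_opNorm _) 2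

/-- The operator `A ⊗ 1` on `ℓ²(γ) ≅ ℓ²(α) ⊗ ℓ²(β)`. -/
noncomputable def amp (A : L2 α →L[ℂ] L2 α) : L2 γ →L[ℂ] L2 γ :=
  LinearMap.mkContinuous
    { toFun := ampFun e A
      map_add' := fun v w => by ext c; simp [ampFun_apply, slice_add]
      map_smul' := fun k v => by ext c; simp [ampFun_apply, slice_smul] }
    ‖A‖ (norm_ampFun_le e A)

theorem amp_apply (A : L2 α →L[ℂ] L2 α) (v : L2 γ) (c : γ) :
    amp e A v c = A (slice e (e c).2 v) (e c).1 := rfl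

theorem slice_amp (A : L2 α →L[ℂ] L2 α) (b : β) (v : L2 γ) :
    slice e b (amp e A v) = A (slice e b v) := slice_ampFun e A b v

theorem inner_eq_tsum_slice (v w : L2 γ) :
    ⟪v, w⟫_ℂ = ∑' b, ⟪slice e b v, slice e b w⟫_ℂ := by
  have h : Summable fun p : β × α => ⟪v (e.symm p.swap), w (e.symm p.swap)⟫_ℂ :=
    Summable.comp_injective (f := fun c => ⟪v c, w c⟫_ℂ) (i := fun p : β × α => e.symm p.swap)
      (lp.summable_inner v w) (e.symm.injective.comp Prod.swap_injective)
  rw [lp.inner_eq_tsum, ← ((Equiv.prodComm β α).trans e.symm).tsum_eq fun c => ⟪v c, w c⟫_ℂ]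
  refine (h.tsum_prod).trans ?_
  refine tsum_congr fun b => ?_
  rw [lp.inner_eq_tsum]
  rfl

/-- The ⋆-homomorphism `A ↦ A ⊗ 1` from bounded operators on `ℓ²(α)` to bounded operators on
`ℓ²(γ) ≅ ℓ²(α) ⊗ ℓ²(β)`. -/
noncomputable def ampHom : (L2 α →L[ℂ] L2 α) →⋆ₐ[ℂ] (L2 γ →L[ℂ] L2 γ) where
  toFun := amp e
  map_one' := by ext v c; simp [amp_apply, slice_apply]
  map_mul' A B := by
    ext v c
    simp [amp_apply, slice_amp]
  map_zero' := by ext v c; simp [amp_apply]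
  map_add' A B := by ext v c; simp [amp_apply]
  commutes' k := by ext v c; simp [amp_apply, slice_apply, Algebra.algebraMap_eq_smul_one]
  map_star' A := by
    rw [ContinuousLinearMap.star_eq_adjoint, ContinuousLinearMap.star_eq_adjoint,
      ContinuousLinearMap.eq_adjoint_iff]
    intro v w
    rw [inner_eq_tsum_slice e, inner_eq_tsum_slice e v]
    simp [slice_amp, ContinuousLinearMap.adjoint_inner_left]

end Amplification

/-! ### The quasi-local algebra of a spin system on the square lattice -/

/-- The lattice `ℤ²`. -/
abbrev Site := ℤ × ℤ

/-- The set of sites in the disk of radius `r` with center `0`, with `ℤ² ⊆ ℂ`. -/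
def disk (r : ℝ) : Set Site := {j | ‖(⟨j.1, j.2⟩ : ℂ)‖ ≤ r}

/-- The Hilbert space `⨂_{j ∈ X} V_j` of a finite set `X` of sites, where each `V_j` is a copy of the
Hilbert space `V = ℓ²(ι)`: it has the orthonormal basis `⨂_j e_{s j}`, indexed by `s : X → ι`. -/
noncomputable abbrev LocalSpace (ι : Type*) (X : Finset Site) := L2 (X → ι)

/-- The algebra `⨂_{j ∈ X} B(V_j) = B(⨂_{j ∈ X} V_j)` of observables of a finite set of sites. -/
noncomputable abbrev LocalOp (ι : Type*) (X : Finset Site) := LocalSpace ι X →L[ℂ] LocalSpace ι X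

/-- A Hilbert space with an orthonormal basis indexed by all configurations on the lattice. All the
algebras `B(⨂_{j ∈ X} V_j)` act on it faithfully and compatibly, which is used only to form their
union and its norm completion. -/
noncomputable abbrev BigSpace (ι : Type*) := L2 (Site → ι)

/-- Bounded operators on the space of all configurations. -/
noncomputable abbrev BigOp (ι : Type*) := BigSpace ι →L[ℂ] BigSpace ι

/-- Split a configuration into its parts inside and outside `X`. -/
def splitConfig (ι : Type*) (X : Finset Site) :
    (Site → ι) ≃ (X → ι) × ({j : Site // j ∉ X} → ι) :=
  Equiv.piEquivPiSubtypeProd (fun j => j ∈ X) fun _ => ι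

/-- The embedding `A ↦ A ⊗ 1` of the observables on `X`. -/
noncomputable def embed (ι : Type*) (X : Finset Site) : LocalOp ι X →⋆ₐ[ℂ] BigOp ι :=
  ampHom (splitConfig ι X)

/-- The ⋆-algebra of local observables: the union of the algebras of observables of all finite sets
of sites (the supremum of a directed family). -/
noncomputable def localAlgebra (ι : Type*) : StarSubalgebra ℂ (BigOp ι) :=
  ⨆ X : Finset Site, (embed ι X).range

/-- The C⋆-algebra of quasi-local observables: the norm completion of the local ones. -/
noncomputable def quasiLocal (ι : Type*) : StarSubalgebra ℂ (BigOp ι) :=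
  (localAlgebra ι).topologicalClosure

variable {ι : Type*}

theorem embed_mem_quasiLocal (X : Finset Site) (A : LocalOp ι X) : embed ι X A ∈ quasiLocal ι :=
  StarSubalgebra.le_topologicalClosure _
    (le_iSup (fun X : Finset Site => (embed ι X).range) X ⟨A, rfl⟩)

/-- The inclusion of the observables of a finite set of sites into the quasi-local algebra. -/
noncomputable def incl (X : Finset Site) : LocalOp ι X →⋆ₐ[ℂ] quasiLocal ι :=
  (embed ι X).codRestrict (quasiLocal ι) (embed_mem_quasiLocal X)

/-- `O` is a local observable with support in the set `S` of sites. -/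
def IsLocalOn (S : Set Site) (O : quasiLocal ι) : Prop :=
  ∃ X : Finset Site, (X : Set Site) ⊆ S ∧ ∃ A : LocalOp ι X, O = incl X A

/-! ### States -/

/-- A state: a positive normalized linear functional. -/
def IsState (ω : quasiLocal ι →ₗ[ℂ] ℂ) : Prop :=
  ω 1 = 1 ∧ ∀ a, 0 ≤ (ω (star a * a)).re ∧ (ω (star a * a)).im = 0

/-- A pure state: an extreme point of the set of states. -/
def IsPureState (ω : quasiLocal ι →ₗ[ℂ] ℂ) : Prop :=
  ω ∈ Set.extremePoints ℝ {φ : quasiLocal ι →ₗ[ℂ] ℂ | IsState φ}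

/-- The restriction of `ω` to the observables of `X` is given by the density matrix
`ρ_X = ∑ₙ |v n⟩⟨v n|`. -/
def HasDensity (ω : quasiLocal ι →ₗ[ℂ] ℂ) (X : Finset Site) (v : ℕ → LocalSpace ι X) : Prop :=
  ∀ A : LocalOp ι X, HasSum (fun n => ⟪v n, A (v n)⟫_ℂ) (ω (incl X A))

/-- The restriction of `ω` to every finite set of sites is given by a density matrix. -/
def IsLocallyNormal (ω : quasiLocal ι →ₗ[ℂ] ℂ) : Prop :=
  ∀ X : Finset Site, ∃ v : ℕ → LocalSpace ι X, HasDensity ω X v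

/-- Restriction of a configuration on `X ∪ Y` to the pair of its restrictions to `X` and `Y`. -/
def restrictPair (X Y : Finset Site) (s : ((X ∪ Y : Finset Site) → ι)) : (X → ι) × (Y → ι) :=
  (fun j => s ⟨j, Finset.mem_union_left Y j.2⟩, fun j => s ⟨j, Finset.mem_union_right X j.2⟩)

theorem restrictPair_injective (X Y : Finset Site) :
    Function.Injective (restrictPair (ι := ι) X Y) := by
  intro s t h
  funext ⟨j, hj⟩
  rcases Finset.mem_union.1 hj with hX | hY
  · exact congrFun (congrArg Prod.fst h) ⟨j, hX⟩
  · exact congrFun (congrArg Prod.snd h) ⟨j, hY⟩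

/-- The vector `v ⊗ w` of `⨂_{j ∈ X ∪ Y} V_j`, for disjoint `X` and `Y`. -/
noncomputable def tensorVec {X Y : Finset Site} (v : LocalSpace ι X) (w : LocalSpace ι Y) :
    LocalSpace ι (X ∪ Y) :=
  ⟨fun s => v (restrictPair X Y s).1 * w (restrictPair X Y s).2, L2.mem <| by
    have h := (L2.summable_sq v).mul_of_nonneg (L2.summable_sq w)
      (fun _ => by positivity) (fun _ => by positivity)
    simpa [mul_pow] using! h.comp_injective (restrictPair_injective X Y)⟩

/-- The expectation `Tr ((ρ_X ⊗ ρ_Y) O)` of an observable `O` on `X ∪ Y` (`X`, `Y` disjoint), where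
`ρ_X = ∑ₙ |v n⟩⟨v n|` and `ρ_Y = ∑ₘ |w m⟩⟨w m|`. -/
noncomputable def prodExpectation {X Y : Finset Site} (v : ℕ → LocalSpace ι X)
    (w : ℕ → LocalSpace ι Y) (O : LocalOp ι (X ∪ Y)) : ℂ :=
  ∑' p : ℕ × ℕ, ⟪tensorVec (v p.1) (w p.2), O (tensorVec (v p.1) (w p.2))⟫_ℂ

/-- Exponential decay of correlations across annuli: for `0 < r < R`, the expectation of a local
observable `O` with support outside the ring `D_R \ D_r` differs from its expectation in
`ω|_{D_r} ⊗ ω|_{D_Rᶜ}` by at most `C exp (-α (R - r)) ‖O‖`. The support of `O` is contained in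
`X ∪ Y` for finite `X ⊆ D_r` and `Y ⊆ D_Rᶜ`. -/
def DecayAcrossAnnuli (C α : ℝ) (ω : quasiLocal ι →ₗ[ℂ] ℂ) : Prop :=
  ∀ r R : ℝ, 0 < r → r < R →
    ∀ X Y : Finset Site, (X : Set Site) ⊆ disk r → (Y : Set Site) ⊆ (disk R)ᶜ →
      ∀ (v : ℕ → LocalSpace ι X) (w : ℕ → LocalSpace ι Y), HasDensity ω X v → HasDensity ω Y w →
        ∀ O : LocalOp ι (X ∪ Y),
          ‖ω (incl (X ∪ Y) O) - prodExpectation v w O‖ ≤ C * Real.exp (-(α * (R - r))) * ‖O‖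

/-- Two states agree exponentially well far from the origin. -/
def AgreeAtInfinity (C α : ℝ) (ω ω' : quasiLocal ι →ₗ[ℂ] ℂ) : Prop :=
  ∀ r : ℝ, 0 < r → ∀ O : quasiLocal ι, IsLocalOn (disk r)ᶜ O →
    ‖ω O - ω' O‖ ≤ C * Real.exp (-(α * r)) * ‖O‖

/-- `(H, π, ψ)` is a GNS triple of the state `ω`: `ψ` is a cyclic vector representing `ω`. -/
def IsGNSTriple {H : Type*} [NormedAddCommGroup H] [InnerProductSpace ℂ H] [CompleteSpace H]
    (π : quasiLocal ι →⋆ₐ[ℂ] (H →L[ℂ] H)) (ψ : H) (ω : quasiLocal ι →ₗ[ℂ] ℂ) : Prop :=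
  Dense (Set.range fun a => π a ψ) ∧ ∀ a, ω a = ⟪ψ, π a ψ⟫_ℂ

/-- The observable `A` can be approximated in norm, for every `r > 0`, by a local observable with
support in the disk `D_r` with an error at most `f r`. -/
def IsLocalizedWith (f : ℝ → ℝ) (A : quasiLocal ι) : Prop :=
  ∀ r : ℝ, 0 < r → ∃ B : quasiLocal ι, IsLocalOn (disk r) B ∧ ‖A - B‖ ≤ f r

end SpinLattice

/-!
Two pure states that agree near infinity are related by a localized observable.

The state vectors `ψ`, `ψ'` live in one irreducible representation `π`, which is locally normal, so
that the observables of a finite set `X` of sites act as a type I factor and every operator that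
commutes with all observables outside `X` is an observable of `X`
(`exists_localRep_eq_of_commute`). Approximate statements about states are turned into operators by
a version of Uhlmann's theorem (`uhlmann`): if two vector states agree on a ⋆-algebra up to `ε`,
then a contraction in the commutant maps one vector close to the other. It is used twice.

* Since `ψ` and `ψ'` agree outside the disk of radius `r`, there is an observable `u` of this disk
  with `‖u‖ ≤ 1` and `u ψ ≈ ψ'`, up to an exponentially small error (`exists_local_transport`).
* For `r < R`, the state of `ψ` and the product of its restrictions to the disk of radius `r` and to
  the exterior of the disk of radius `R` nearly agree on the observables supported in these two
  regions. The product state is the vector state of a purification of `ψ` in a multiple of the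
  representation (`purify`). Uhlmann's theorem gives an observable `g` of the larger disk that acts
  like the projection `|ψ⟩⟨ψ|` next to observables `a` of the smaller one: `g ψ ≈ ψ`,
  `‖a g‖ ≤ ‖a ψ‖` and `g⋆ a ψ ≈ ⟨a⟩ ψ` (`exists_local_projector`).

Given vectors `θ`, `η` with `⟪η, θ⟫` real that are approximated by `T ψ`, `S ψ` for observables
`T`, `S` of disks, the operators `g` allow one to localize the self-adjoint finite-rank operator
that maps `θ` to `η`. An approximation `s` with error vector `e = η - s θ` is corrected by
`(a g g⋆ T⋆ + T g g⋆ a⋆) / m - (ρ / m²) T g g⋆ T⋆`, where `a = S - s T`, `m = ‖θ‖²`, `ρ = ⟪e, θ⟫`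
(`exists_correction`). The essential point is the estimate `‖a g‖ ≤ ‖a ψ‖`, by which the norm of the
correction is controlled by the size of `e` and not by that of `a`. With disks of radius `2 ^ n` the
norms of the approximations grow at most exponentially in `n`, while the errors are of the order
`exp (-c 2 ^ n)`; so the iteration converges to a self-adjoint `K` with `K θ = η`, which is
approximated on the disk of radius `r` faster than any power of `r`
(`exists_selfAdjoint_apply_eq`, `superpolynomialDecay_localizationError`).

For the self-adjoint observable, `θ = ψ` and `η` is the component of `ψ'` orthogonal to `ψ`. For the
unitary, after a change of phase that makes `⟪ψ, ψ'⟫` nonnegative, `θ = (ψ + ψ') / 2` and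
`η = (ψ' - ψ) / (2 i)`; then the Cayley transform of `K` maps `ψ` to `ψ'`, and it is localized since
Cayley transforms of local observables are local and depend Lipschitz continuously on the
observable.
-/

namespace SpinLattice

open Filter Topology

/-! ### Diagonal operators on Hilbert sums of copies of a Hilbert space -/

section Diagonal

variable {E : Type*} [NormedAddCommGroup E]

/-- The Hilbert sum of copies of `E` indexed by `τ`. -/
abbrev HSum (τ : Type*) (E : Type*) [NormedAddCommGroup E] := lp (fun _ : τ => E) 2

theorem HSum.summable_sq {τ : Type*} (v : HSum τ E) : Summable fun i => ‖v i‖ ^ 2 := by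
  simpa using (lp.memℓp v).summable (by norm_num)

theorem HSum.norm_sq {τ : Type*} (v : HSum τ E) : ‖v‖ ^ 2 = ∑' i, ‖v i‖ ^ 2 := by
  simpa using lp.norm_rpow_eq_tsum (p := 2) (by norm_num) v

theorem HSum.mem {τ : Type*} {f : τ → E} (h : Summable fun i => ‖f i‖ ^ 2) :
    Memℓp (E := fun _ : τ => E) f 2 := by
  apply memℓp_gen
  simpa using h

variable [InnerProductSpace ℂ E]

theorem summable_sq_clm (b : E →L[ℂ] E) {τ : Type*} (v : HSum τ E) :
    Summable fun i => ‖b (v i)‖ ^ 2 := by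
  refine Summable.of_nonneg_of_le (fun i => by positivity) (fun i => ?_)
    ((HSum.summable_sq v).mul_left (‖b‖ ^ 2))
  rw [← mul_pow]
  exact pow_le_pow_left₀ (norm_nonneg _) (b.le_opNorm _) 2

/-- The operator that acts as `b` on every summand of a Hilbert sum of copies of `E`. -/
noncomputable def diag (τ : Type*) (b : E →L[ℂ] E) : HSum τ E →L[ℂ] HSum τ E :=
  LinearMap.mkContinuous
    { toFun := fun v => ⟨fun i => b (v i), HSum.mem (summable_sq_clm b v)⟩
      map_add' := fun v w => by ext i; exact map_add b (v i) (w i)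
      map_smul' := fun k v => by ext i; exact map_smul b k (v i) }
    ‖b‖ (fun v => by
      refine (sq_le_sq₀ (norm_nonneg _) (by positivity)).1 ?_
      rw [mul_pow, HSum.norm_sq, HSum.norm_sq, ← tsum_mul_left]
      refine Summable.tsum_le_tsum (fun i => ?_) (summable_sq_clm b v)
        ((HSum.summable_sq v).mul_left _)
      rw [← mul_pow]
      exact pow_le_pow_left₀ (norm_nonneg _) (b.le_opNorm _) 2)

@[simp] theorem diag_apply (τ : Type*) (b : E →L[ℂ] E) (v : HSum τ E) (i : τ) :
    diag τ b v i = b (v i) := rfl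

/-- `diag` as a ⋆-homomorphism. -/
noncomputable def diagHom (τ : Type*) [CompleteSpace E] :
    (E →L[ℂ] E) →⋆ₐ[ℂ] (HSum τ E →L[ℂ] HSum τ E) where
  toFun := diag τ
  map_one' := by ext v i; simp
  map_mul' A B := by ext v i; simp
  map_zero' := by ext v i; simp
  map_add' A B := by ext v i; simp
  commutes' k := by ext v i; simp [Algebra.algebraMap_eq_smul_one]
  map_star' A := by
    rw [ContinuousLinearMap.star_eq_adjoint, ContinuousLinearMap.star_eq_adjoint,
      ContinuousLinearMap.eq_adjoint_iff]
    intro v w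
    rw [lp.inner_eq_tsum, lp.inner_eq_tsum]
    simp [ContinuousLinearMap.adjoint_inner_left]

@[simp] theorem diagHom_apply (τ : Type*) [CompleteSpace E] (b : E →L[ℂ] E) :
    (diagHom τ : (E →L[ℂ] E) →⋆ₐ[ℂ] _) b = diag τ b := rfl

theorem diag_single (τ : Type*) [DecidableEq τ] (b : E →L[ℂ] E) (j : τ) (u : E) :
    diag τ b (lp.single 2 j u) = lp.single 2 j (b u) := by
  ext i
  by_cases h : i = j
  · subst h; simp
  · simp [lp.single_apply, Pi.single_eq_of_ne h]

theorem norm_le_norm_diag (τ : Type*) (i : τ) (b : E →L[ℂ] E) : ‖b‖ ≤ ‖diag τ b‖ := by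
  classical
  refine b.opNorm_le_bound (diag τ b).opNorm_nonneg fun u => ?_
  have h := (diag τ b).le_opNorm (lp.single 2 i u)
  rw [diag_single] at h
  rw [lp.norm_single (by norm_num), lp.norm_single (by norm_num)] at h
  exact h

/-- The matrix entry `(i, j)` of an operator on a Hilbert sum of copies of `E`. -/
noncomputable def entry {τ : Type*} [DecidableEq τ] (P : HSum τ E →L[ℂ] HSum τ E) (i j : τ) :
    E →L[ℂ] E :=
  (lp.evalCLM ℂ (fun _ : τ => E) 2 i) ∘L P ∘L (lp.singleContinuousLinearMap ℂ (fun _ : τ => E) 2 j)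

theorem entry_apply {τ : Type*} [DecidableEq τ] (P : HSum τ E →L[ℂ] HSum τ E) (i j : τ) (u : E) :
    entry P i j u = P (lp.single 2 j u) i := rfl

theorem entry_commute {τ : Type*} [DecidableEq τ] {P : HSum τ E →L[ℂ] HSum τ E} {b : E →L[ℂ] E}
    (h : diag τ b * P = P * diag τ b) (i j : τ) : b * entry P i j = entry P i j * b := by
  ext u
  have h1 := congrArg (fun Q : HSum τ E →L[ℂ] HSum τ E => Q (lp.single 2 j u) i) h
  simpa [diag_single, entry_apply] using h1

theorem diag_commute_of_entry {τ : Type*} [DecidableEq τ] {P : HSum τ E →L[ℂ] HSum τ E}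
    {b : E →L[ℂ] E} (h : ∀ i j, b * entry P i j = entry P i j * b) :
    diag τ b * P = P * diag τ b := by
  refine lp.ext_continuousLinearMap (by norm_num) fun j => ?_
  ext u i
  have h1 := congrArg (fun Q : E →L[ℂ] E => Q u) (h i j)
  simpa [diag_single, entry_apply] using h1

end Diagonal

/-! ### Commutants and the density theorems -/

section Commutant

variable {E : Type*} [NormedAddCommGroup E] [InnerProductSpace ℂ E] [CompleteSpace E]

/-- The commutant of a ⋆-algebra of bounded operators. -/
noncomputable abbrev commutant (N : StarSubalgebra ℂ (E →L[ℂ] E)) :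
    StarSubalgebra ℂ (E →L[ℂ] E) :=
  StarSubalgebra.centralizer ℂ (N : Set (E →L[ℂ] E))

theorem mem_commutant {N : StarSubalgebra ℂ (E →L[ℂ] E)} {x : E →L[ℂ] E} :
    x ∈ commutant N ↔ ∀ n ∈ N, n * x = x * n := by
  rw [StarSubalgebra.mem_centralizer_iff]
  exact ⟨fun h n hn => (h n hn).1, fun h n hn => ⟨h n hn, h _ (star_mem hn)⟩⟩

theorem mul_starProjection_comm {K : Submodule ℂ E} [K.HasOrthogonalProjection] {A : E →L[ℂ] E}
    (h1 : ∀ v ∈ K, A v ∈ K) (h2 : ∀ v ∈ K, star A v ∈ K) :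
    A * K.starProjection = K.starProjection * A := by
  ext v
  refine (Submodule.eq_starProjection_of_mem_of_inner_eq_zero
    (h1 _ (K.starProjection_apply_mem v)) fun w hw => ?_).symm
  change ⟪A v - A (K.starProjection v), w⟫_ℂ = 0
  rw [← map_sub, ← ContinuousLinearMap.adjoint_inner_right, ← ContinuousLinearMap.star_eq_adjoint]
  exact Submodule.starProjection_inner_eq_zero v _ (h2 w hw)

/-- The closure of the orbit `σ(N) ξ` of a vector under a ⋆-algebra `N` that acts through a
⋆-homomorphism `σ`. -/
noncomputable def orbit {F : Type*} [NormedAddCommGroup F] [InnerProductSpace ℂ F] [CompleteSpace F]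
    (N : StarSubalgebra ℂ (E →L[ℂ] E)) (σ : (E →L[ℂ] E) →⋆ₐ[ℂ] (F →L[ℂ] F)) (ξ : F) :
    Submodule ℂ F :=
  (Submodule.map ((ContinuousLinearMap.apply ℂ F ξ).toLinearMap ∘ₗ σ.toAlgHom.toLinearMap)
    (Subalgebra.toSubmodule N.toSubalgebra)).topologicalClosure

section orbit

variable {F : Type*} [NormedAddCommGroup F] [InnerProductSpace ℂ F] [CompleteSpace F]
  (N : StarSubalgebra ℂ (E →L[ℂ] E)) (σ : (E →L[ℂ] E) →⋆ₐ[ℂ] (F →L[ℂ] F)) (ξ : F)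

instance : (orbit N σ ξ).HasOrthogonalProjection :=
  haveI : CompleteSpace (orbit N σ ξ) :=
    (Submodule.isClosed_topologicalClosure _).completeSpace_coe
  inferInstance

theorem apply_mem_orbit {n : E →L[ℂ] E} (hn : n ∈ N) : σ n ξ ∈ orbit N σ ξ :=
  Submodule.le_topologicalClosure _ ⟨n, hn, rfl⟩

theorem self_mem_orbit : ξ ∈ orbit N σ ξ := by
  simpa using apply_mem_orbit N σ ξ (one_mem N)

theorem mem_orbit_iff {v : F} :
    v ∈ orbit N σ ξ ↔ ∀ ε > 0, ∃ n ∈ N, ‖v - σ n ξ‖ < ε := by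
  rw [orbit, ← SetLike.mem_coe, Submodule.topologicalClosure_coe, Metric.mem_closure_iff]
  constructor
  · intro h ε hε
    obtain ⟨_, ⟨n, hn, rfl⟩, h⟩ := h ε hε
    exact ⟨n, hn, by simpa [dist_eq_norm] using h⟩
  · intro h ε hε
    obtain ⟨n, hn, h⟩ := h ε hε
    exact ⟨_, ⟨n, hn, rfl⟩, by simpa [dist_eq_norm] using h⟩

theorem orbit_invariant {n : E →L[ℂ] E} (hn : n ∈ N) {v : F} (hv : v ∈ orbit N σ ξ) :
    σ n v ∈ orbit N σ ξ := by
  rw [mem_orbit_iff] at hv ⊢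
  intro ε hε
  obtain ⟨m, hm, h⟩ := hv (ε / (‖σ n‖ + 1)) (by positivity)
  refine ⟨n * m, mul_mem hn hm, ?_⟩
  have : σ n v - σ (n * m) ξ = σ n (v - σ m ξ) := by simp
  rw [this]
  refine ((σ n).le_opNorm _).trans_lt ?_
  rw [lt_div_iff₀ (by positivity)] at h
  nlinarith [norm_nonneg (v - σ m ξ)]

theorem starProjection_orbit_comm {n : E →L[ℂ] E} (hn : n ∈ N) :
    σ n * (orbit N σ ξ).starProjection = (orbit N σ ξ).starProjection * σ n :=
  mul_starProjection_comm (fun _ hv => orbit_invariant N σ ξ hn hv) fun _ hv => by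
    rw [← map_star]; exact orbit_invariant N σ ξ (star_mem hn) hv

end orbit

/-- Von Neumann's density theorem: an operator in the double commutant of `N` is approximated by
elements of `N` on finitely many vectors. -/
theorem exists_approx_of_mem_bicommutant {N : StarSubalgebra ℂ (E →L[ℂ] E)} {T : E →L[ℂ] E}
    (hT : T ∈ commutant (commutant N)) {τ : Type*} [Finite τ] (ξ : τ → E) {ε : ℝ} (hε : 0 < ε) :
    ∃ n ∈ N, ∀ i, ‖T (ξ i) - n (ξ i)‖ < ε := by
  classical
  have := Fintype.ofFinite τ
  -- in a sum of copies of `E`, the projection onto the closed orbit of `(ξ i)` has entries in the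
  -- commutant of `N`, so `T` leaves the closed orbit invariant
  let ξ' : HSum τ E := ⟨ξ, HSum.mem ((hasSum_fintype _).summable)⟩
  have hP : ∀ i j, entry (orbit N (diagHom τ) ξ').starProjection i j ∈ commutant N := fun i j =>
    mem_commutant.2 fun n hn => entry_commute (starProjection_orbit_comm N (diagHom τ) ξ' hn) i j
  have hc : diag τ T * (orbit N (diagHom τ) ξ').starProjection =
      (orbit N (diagHom τ) ξ').starProjection * diag τ T :=
    diag_commute_of_entry fun i j => (mem_commutant.1 hT _ (hP i j)).symm
  have hm : diag τ T ξ' ∈ orbit N (diagHom τ) ξ' := by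
    have h1 := congrArg (fun Q : HSum τ E →L[ℂ] HSum τ E => Q ξ') hc
    simp only [mul_apply_eq_comp] at h1
    rw [(Submodule.starProjection_eq_self_iff).2 (self_mem_orbit N (diagHom τ) ξ')] at h1
    rw [h1]
    simp
  obtain ⟨n, hn, h⟩ := (mem_orbit_iff N (diagHom τ) ξ').1 hm ε hε
  exact ⟨n, hn, fun i => (lp.norm_apply_le_norm (by norm_num) _ i).trans_lt h⟩

end Commutant

/-! ### Kaplansky's density theorem for self-adjoint contractions -/

section Kaplansky

variable {E : Type*} [NormedAddCommGroup E] [InnerProductSpace ℂ E] [CompleteSpace E]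

theorem inner_apply_of_selfAdjoint {T : E →L[ℂ] E} (hT : IsSelfAdjoint T) (u v : E) :
    ⟪T u, v⟫_ℂ = ⟪u, T v⟫_ℂ := by
  conv_lhs => rw [← hT.star_eq, ContinuousLinearMap.star_eq_adjoint,
    ContinuousLinearMap.adjoint_inner_left]

theorem inner_star_left (T : E →L[ℂ] E) (u v : E) : ⟪star T u, v⟫_ℂ = ⟪u, T v⟫_ℂ := by
  rw [ContinuousLinearMap.star_eq_adjoint, ContinuousLinearMap.adjoint_inner_left]

theorem inner_star_right (T : E →L[ℂ] E) (u v : E) : ⟪u, star T v⟫_ℂ = ⟪T u, v⟫_ℂ := by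
  rw [ContinuousLinearMap.star_eq_adjoint, ContinuousLinearMap.adjoint_inner_right]

/-- The self-adjoint part of the density theorem. The vectors `(n ξ i)` with `n ∈ N` self-adjoint
form a real subspace, and a vector that is real-orthogonal to it is real-orthogonal to `(T ξ i)`,
since `(n + n⋆) / 2` tends weakly to `T` when `n` does. -/
theorem exists_selfAdjoint_approx {N : StarSubalgebra ℂ (E →L[ℂ] E)} {T : E →L[ℂ] E}
    (hT : T ∈ commutant (commutant N)) (hsa : IsSelfAdjoint T) {τ : Type*} [Fintype τ]
    (ξ : τ → E) {ε : ℝ} (hε : 0 < ε) :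
    ∃ n ∈ N, IsSelfAdjoint n ∧ ∀ i, ‖T (ξ i) - n (ξ i)‖ < ε := by
  let _ : InnerProductSpace ℝ E := InnerProductSpace.complexToReal
  let S : Submodule ℝ (PiLp 2 fun _ : τ => E) :=
    { carrier := {v | ∃ n ∈ N, IsSelfAdjoint n ∧ v = WithLp.toLp 2 fun i => n (ξ i)}
      add_mem' := by
        rintro _ _ ⟨n, hn, hs, rfl⟩ ⟨m, hm, hs', rfl⟩
        exact ⟨n + m, add_mem hn hm, hs.add hs', by ext i; simp⟩
      zero_mem' := ⟨0, zero_mem _, IsSelfAdjoint.zero _, by ext i; simp⟩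
      smul_mem' := by
        rintro c _ ⟨n, hn, hs, rfl⟩
        refine ⟨(c : ℂ) • n, N.smul_mem hn _, ?_, by ext i; simp⟩
        rw [isSelfAdjoint_iff, star_smul, hs.star_eq]
        simp }
  have key : WithLp.toLp 2 (fun i => T (ξ i)) ∈ S.topologicalClosure := by
    rw [← Submodule.orthogonal_orthogonal_eq_closure, Submodule.mem_orthogonal]
    intro η hη
    rw [Submodule.mem_orthogonal] at hη
    have hre : ∀ B : E →L[ℂ] E, inner ℝ η (WithLp.toLp 2 (fun i => B (ξ i))) =
        ∑ i, (⟪η i, B (ξ i)⟫_ℂ).re := fun B => PiLp.inner_apply _ _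
    rw [hre]
    -- the bound obtained from the density theorem on the vectors `ξ i` and `η i`
    have hbd : ∀ δ > 0, |∑ i, (⟪η i, T (ξ i)⟫_ℂ).re| ≤ δ * ∑ i, (‖η i‖ + ‖ξ i‖) := by
      intro δ hδ
      obtain ⟨m, hm, happ⟩ := exists_approx_of_mem_bicommutant hT (Sum.elim ξ η) hδ
      have h0 := hη _ ⟨m + star m, add_mem hm (star_mem hm), IsSelfAdjoint.add_star_self m, rfl⟩
      rw [real_inner_comm, hre] at h0
      have e1 : ∀ i, (⟪η i, (m + star m) (ξ i)⟫_ℂ).re =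
          (⟪η i, m (ξ i)⟫_ℂ).re + (⟪m (η i), ξ i⟫_ℂ).re := by
        intro i
        rw [add_apply, inner_add_right, inner_star_right, Complex.add_re]
      have e2 : ∀ i, 2 * (⟪η i, T (ξ i)⟫_ℂ).re - (⟪η i, (m + star m) (ξ i)⟫_ℂ).re =
          (⟪η i, T (ξ i) - m (ξ i)⟫_ℂ).re + (⟪T (η i) - m (η i), ξ i⟫_ℂ).re := by
        intro i
        rw [e1, inner_sub_right, inner_sub_left, inner_apply_of_selfAdjoint hsa]
        simp only [Complex.sub_re]
        ring
      have e3 : 2 * ∑ i, (⟪η i, T (ξ i)⟫_ℂ).re =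
          ∑ i, ((⟪η i, T (ξ i) - m (ξ i)⟫_ℂ).re + (⟪T (η i) - m (η i), ξ i⟫_ℂ).re) := by
        rw [← Finset.sum_congr rfl fun i _ => e2 i, Finset.sum_sub_distrib, h0, Finset.mul_sum,
          sub_zero]
      have e4 : |2 * ∑ i, (⟪η i, T (ξ i)⟫_ℂ).re| ≤ δ * ∑ i, (‖η i‖ + ‖ξ i‖) := by
        rw [e3, Finset.mul_sum]
        refine (Finset.abs_sum_le_sum_abs _ _).trans (Finset.sum_le_sum fun i _ => ?_)
        refine (abs_add_le _ _).trans ?_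
        rw [mul_add]
        have a1 : ‖T (ξ i) - m (ξ i)‖ ≤ δ := (happ (Sum.inl i)).le
        have a2 : ‖T (η i) - m (η i)‖ ≤ δ := (happ (Sum.inr i)).le
        refine add_le_add ?_ ?_
        · refine (Complex.abs_re_le_norm _).trans ((norm_inner_le_norm _ _).trans ?_)
          rw [mul_comm]
          exact mul_le_mul_of_nonneg_right a1 (norm_nonneg _)
        · refine (Complex.abs_re_le_norm _).trans ((norm_inner_le_norm _ _).trans ?_)
          exact mul_le_mul_of_nonneg_right a2 (norm_nonneg _)
      rw [abs_mul, abs_two] at e4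
      linarith [abs_nonneg (∑ i, (⟪η i, T (ξ i)⟫_ℂ).re)]
    by_contra hne
    have hpos : 0 < |∑ i, (⟪η i, T (ξ i)⟫_ℂ).re| := abs_pos.2 hne
    set Sm := ∑ i, (‖η i‖ + ‖ξ i‖) with hSm
    have hS0 : 0 ≤ Sm := Finset.sum_nonneg fun i _ => by positivity
    have := hbd (|∑ i, (⟪η i, T (ξ i)⟫_ℂ).re| / (2 * (Sm + 1))) (by positivity)
    rw [div_mul_eq_mul_div, le_div_iff₀ (by positivity)] at this
    nlinarith
  rw [← SetLike.mem_coe, Submodule.topologicalClosure_coe, Metric.mem_closure_iff] at key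
  obtain ⟨_, ⟨n, hn, hs, rfl⟩, h⟩ := key ε hε
  refine ⟨n, hn, hs, fun i => lt_of_le_of_lt ?_ h⟩
  rw [dist_eq_norm]
  exact PiLp.norm_apply_le (WithLp.toLp 2 (fun i => T (ξ i)) - WithLp.toLp 2 fun i => n (ξ i)) i

/-- Norm bounds for `(1 + n²)⁻¹` and `n (1 + n²)⁻¹` when `n` is self-adjoint. -/
theorem norm_resolvent_le {n R : E →L[ℂ] E} (hn : IsSelfAdjoint n) (h : (1 + n * n) * R = 1) :
    ‖R‖ ≤ 1 ∧ ‖(2 : ℂ) • (n * R)‖ ≤ 1 := by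
  have hv : ∀ u, R u + n (n (R u)) = u := fun u => by
    simpa using congrArg (fun Q : E →L[ℂ] E => Q u) h
  have hsq : ∀ u, ‖u‖ ^ 2 = ‖R u‖ ^ 2 + 2 * ‖n (R u)‖ ^ 2 + ‖n (n (R u))‖ ^ 2 := by
    intro u
    have h1 : ‖R u + n (n (R u))‖ ^ 2 = _ := norm_add_sq (𝕜 := ℂ) (R u) (n (n (R u)))
    rw [hv] at h1
    rw [h1, ← inner_apply_of_selfAdjoint hn, inner_self_eq_norm_sq]
  refine ⟨R.opNorm_le_bound zero_le_one fun u => ?_,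
    ContinuousLinearMap.opNorm_le_bound _ zero_le_one fun u => ?_⟩
  · rw [one_mul]
    refine (sq_le_sq₀ (norm_nonneg _) (norm_nonneg _)).1 ?_
    nlinarith [hsq u, sq_nonneg ‖n (R u)‖, sq_nonneg ‖n (n (R u))‖]
  · rw [one_mul]
    refine (sq_le_sq₀ (norm_nonneg _) (norm_nonneg _)).1 ?_
    have h2 : ‖n (R u)‖ ^ 2 ≤ ‖R u‖ * ‖n (n (R u))‖ := by
      rw [← inner_self_eq_norm_sq (𝕜 := ℂ), inner_apply_of_selfAdjoint hn]
      exact (RCLike.re_le_norm _).trans (norm_inner_le_norm _ _)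
    have h3 : ‖((2 : ℂ) • (n * R)) u‖ = 2 * ‖n (R u)‖ := by
      simp [norm_smul]
    rw [h3, hsq u]
    nlinarith [sq_nonneg (‖R u‖ - ‖n (n (R u))‖)]

/-- In a C⋆-algebra, `1 + a²` is invertible for self-adjoint `a`. -/
theorem exists_resolvent {A : Type*} [CStarAlgebra A] {a : A} (ha : IsSelfAdjoint a) :
    ∃ R : A, IsSelfAdjoint R ∧ (1 + a * a) * R = 1 := by
  have hc : Continuous fun t : ℝ => (1 + t * t)⁻¹ :=
    Continuous.inv₀ (by fun_prop) fun t => (by nlinarith [mul_self_nonneg t] : 0 < 1 + t * t).ne'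
  refine ⟨cfc (fun t : ℝ => (1 + t * t)⁻¹) a, cfc_predicate _ a, ?_⟩
  have h1 : cfc (fun t : ℝ => 1 + t * t) a = 1 + a * a := by
    rw [cfc_add (a := a) (fun _ => 1) (fun b => b * b) (by fun_prop) (by fun_prop),
      cfc_mul (fun b => b) (fun b => b) a (by fun_prop) (by fun_prop), cfc_const_one ℝ a,
      cfc_id' ℝ a]
  rw [← h1, ← cfc_mul _ _ a (by fun_prop) hc.continuousOn, ← cfc_const_one ℝ a]
  refine cfc_congr fun t _ => ?_
  exact mul_inv_cancel₀ (by nlinarith [mul_self_nonneg t] : 0 < 1 + t * t).ne'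

/-- Every self-adjoint contraction is `2 T (1 + T²)⁻¹` for a self-adjoint `T`, by functional
calculus. -/
theorem exists_eq_cayley {B : E →L[ℂ] E} (hB : IsSelfAdjoint B) (hB1 : ‖B‖ ≤ 1) :
    ∃ T : E →L[ℂ] E, IsSelfAdjoint T ∧ (∀ x, x * B = B * x → x * T = T * x) ∧
      (2 : ℂ) • T = B * (1 + T * T) := by
  rcases subsingleton_or_nontrivial E with hE | hE
  · exact ⟨0, IsSelfAdjoint.zero _, fun x _ => by simp, by ext u; exact Subsingleton.elim _ _⟩
  let g : ℝ → ℝ := fun b => b / (1 + Real.sqrt (1 - b ^ 2))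
  have hpos : ∀ b : ℝ, 0 < 1 + Real.sqrt (1 - b ^ 2) := fun b => by positivity
  have hg : Continuous g := by
    refine continuous_id.div (by fun_prop) fun b => (hpos b).ne'
  refine ⟨cfc g B, cfc_predicate g B, fun x hx => ?_, ?_⟩
  · exact (Commute.cfc_real (show Commute B x from hx.symm) g).symm
  · have h1 : cfc (fun b => 2 * g b) B = (2 : ℂ) • cfc g B := by
      rw [cfc_const_mul 2 g B hg.continuousOn, ← Complex.coe_smul]
      simp
    have h2 : cfc (fun b : ℝ => b * (1 + g b * g b)) B = B * (1 + cfc g B * cfc g B) := by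
      rw [cfc_mul (fun b => b) (fun b => 1 + g b * g b) B (by fun_prop) (by fun_prop),
        cfc_id' ℝ B, cfc_add (a := B) (fun _ => 1) (fun b => g b * g b) (by fun_prop) (by fun_prop),
        cfc_mul g g B, cfc_const_one ℝ B]
    rw [← h1, ← h2]
    refine cfc_congr fun b hb => ?_
    have hb1 : |b| ≤ 1 := by
      have := spectrum.norm_le_norm_of_mem hb
      rw [Real.norm_eq_abs] at this
      exact this.trans hB1
    have hs : Real.sqrt (1 - b ^ 2) ^ 2 = 1 - b ^ 2 :=
      Real.sq_sqrt (by nlinarith [abs_le.1 hb1, sq_abs b])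
    have hp := hpos b
    set q := Real.sqrt (1 - b ^ 2)
    change 2 * (b / (1 + q)) = b * (1 + b / (1 + q) * (b / (1 + q)))
    field_simp
    linear_combination -b * hs

/-- Kaplansky's density theorem, for self-adjoint contractions, and for a ⋆-algebra in which
`1 + n²` is invertible for self-adjoint `n`. The contraction is `2 T (1 + T²)⁻¹` for a self-adjoint
`T` in the double commutant, and `T ↦ 2 T (1 + T²)⁻¹` is strongly continuous. -/
theorem kaplansky {N : StarSubalgebra ℂ (E →L[ℂ] E)}
    (hN : ∀ n ∈ N, IsSelfAdjoint n → ∃ m ∈ N, (1 + n * n) * m = 1) {B : E →L[ℂ] E}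
    (hB : B ∈ commutant (commutant N)) (hsa : IsSelfAdjoint B) (hB1 : ‖B‖ ≤ 1)
    {τ : Type*} [Fintype τ] (ξ : τ → E) {ε : ℝ} (hε : 0 < ε) :
    ∃ n ∈ N, ‖n‖ ≤ 1 ∧ ∀ i, ‖B (ξ i) - n (ξ i)‖ ≤ ε := by
  obtain ⟨T, hTsa, hTc, hTB⟩ := exists_eq_cayley hsa hB1
  have hT : T ∈ commutant (commutant N) := by
    rw [mem_commutant] at hB ⊢
    exact fun x hx => hTc x (hB x hx)
  have hTT : IsSelfAdjoint (T * T) := by rw [isSelfAdjoint_iff, star_mul, hTsa.star_eq]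
  obtain ⟨RT, -, hRT1⟩ := exists_resolvent hTsa
  have hBT : B = (2 : ℂ) • (T * RT) := by
    rw [← smul_mul_assoc, hTB, mul_assoc, hRT1, mul_one]
  obtain ⟨n, hn, hns, happ⟩ := exists_selfAdjoint_approx hT hTsa
    (Sum.elim (fun i => RT (ξ i)) fun i => T (RT (ξ i))) (ε := ε / 4) (by positivity)
  obtain ⟨R, hR, hR1⟩ := hN n hn hns
  have hR2 : star R * (1 + n * n) = 1 := by
    have := congrArg star hR1
    simpa [hns.star_eq] using this
  have hRs : star R = R := left_inv_eq_right_inv hR2 hR1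
  rw [hRs] at hR2
  have hcomm : R * n = n * R := by
    calc R * n = R * n * ((1 + n * n) * R) := by rw [hR1, mul_one]
      _ = R * (1 + n * n) * n * R := by noncomm_ring
      _ = n * R := by rw [hR2, one_mul]
  have hRn := norm_resolvent_le hns hR1
  refine ⟨(2 : ℂ) • (n * R), N.smul_mem (mul_mem hn hR) _, hRn.2, fun i => ?_⟩
  have hid : T * RT - n * R = R * ((T - n) * RT) - (n * R) * ((T - n) * (T * RT)) := by
    have e : T * RT - n * R =
        R * ((1 + n * n) * T) * RT - R * n * ((1 + T * T) * RT) := by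
      rw [hRT1, mul_one, ← hcomm, ← mul_assoc R, hR2, one_mul]
    rw [e, hcomm]
    have : R * ((1 + n * n) * T) * RT = R * (T * RT) + R * n * (n * (T * RT)) := by noncomm_ring
    rw [this, hcomm]
    have : R * ((T - n) * RT) = R * (T * RT) - R * n * RT := by noncomm_ring
    rw [this, hcomm]
    noncomm_ring
  have hv : B (ξ i) - ((2 : ℂ) • (n * R)) (ξ i) =
      (2 : ℂ) • R (T (RT (ξ i)) - n (RT (ξ i))) -
        ((2 : ℂ) • (n * R)) (T (T (RT (ξ i))) - n (T (RT (ξ i)))) := by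
    have := congrArg (fun Q : E →L[ℂ] E => ((2 : ℂ) • Q) (ξ i)) hid
    simpa [hBT, smul_sub, mul_apply_eq_comp] using this
  rw [hv]
  refine (norm_sub_le _ _).trans ?_
  have a1 : ‖T (RT (ξ i)) - n (RT (ξ i))‖ ≤ ε / 4 := (happ (Sum.inl i)).le
  have a2 : ‖T (T (RT (ξ i))) - n (T (RT (ξ i)))‖ ≤ ε / 4 := (happ (Sum.inr i)).le
  have b1 := R.le_of_opNorm_le hRn.1 (T (RT (ξ i)) - n (RT (ξ i)))
  have b2 := ContinuousLinearMap.le_of_opNorm_le _ hRn.2 (T (T (RT (ξ i))) - n (T (RT (ξ i))))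
  rw [norm_smul, Complex.norm_ofNat]
  linarith

end Kaplansky

/-! ### Uhlmann's theorem relative to a ⋆-algebra of operators -/

section Uhlmann

variable {E : Type*} [NormedAddCommGroup E] [InnerProductSpace ℂ E] [CompleteSpace E]

/-- Weak compactness of the unit ball of operators, along the hyperfilter. -/
theorem exists_weak_limit {x : ℕ → E →L[ℂ] E} (hx : ∀ k, ‖x k‖ ≤ 1) :
    ∃ x₀ : E →L[ℂ] E, ‖x₀‖ ≤ 1 ∧
      ∀ u v, Tendsto (fun k => ⟪u, x k v⟫_ℂ) (hyperfilter ℕ : Filter ℕ) (𝓝 ⟪u, x₀ v⟫_ℂ) := by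
  have hb : ∀ u v k, ‖⟪x k u, v⟫_ℂ‖ ≤ ‖u‖ * ‖v‖ := fun u v k => by
    refine (norm_inner_le_norm _ _).trans (mul_le_mul_of_nonneg_right ?_ (norm_nonneg _))
    simpa using (x k).le_of_opNorm_le (hx k) u
  have hl : ∀ u v, ∃ l : ℂ, ‖l‖ ≤ ‖u‖ * ‖v‖ ∧
      Tendsto (fun k => ⟪x k u, v⟫_ℂ) (hyperfilter ℕ : Filter ℕ) (𝓝 l) := fun u v => by
    obtain ⟨l, hl, h⟩ := (isCompact_closedBall (0 : ℂ) (‖u‖ * ‖v‖)).ultrafilter_le_nhds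
      ((hyperfilter ℕ).map fun k => ⟪x k u, v⟫_ℂ) (by
        rw [le_principal_iff]
        exact Filter.mem_map.2 (univ_mem' fun k => by simpa using hb u v k))
    exact ⟨l, by simpa using hl, h⟩
  choose l hl1 hl2 using hl
  have uniq : ∀ {a b : ℂ} {f : ℕ → ℂ}, Tendsto f (hyperfilter ℕ : Filter ℕ) (𝓝 a) →
      Tendsto f (hyperfilter ℕ : Filter ℕ) (𝓝 b) → a = b := fun h1 h2 => tendsto_nhds_unique h1 h2
  let B : E →L⋆[ℂ] E →L[ℂ] ℂ := LinearMap.mkContinuous₂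
    (LinearMap.mk₂'ₛₗ (starRingEnd ℂ) (RingHom.id ℂ) l
      (fun u u' v => uniq (hl2 _ _) (by
        simpa [inner_add_left] using (hl2 u v).add (hl2 u' v)))
      (fun c u v => uniq (hl2 _ _) (by
        simpa [inner_smul_left, mul_comm] using (hl2 u v).const_mul (starRingEnd ℂ c)))
      (fun u v v' => uniq (hl2 _ _) (by
        simpa [inner_add_right] using (hl2 u v).add (hl2 u v')))
      (fun c u v => uniq (hl2 _ _) (by
        simpa [inner_smul_right] using (hl2 u v).const_mul c)))
    1 (fun u v => by simpa using hl1 u v)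
  have hB : ∀ u v, B u v = l u v := fun u v => rfl
  refine ⟨InnerProductSpace.continuousLinearMapOfBilin B,
    ContinuousLinearMap.opNorm_le_bound _ zero_le_one fun u => ?_, fun u v => ?_⟩
  · rw [one_mul]
    set w := InnerProductSpace.continuousLinearMapOfBilin B u with hw
    have h1 : ⟪w, w⟫_ℂ = l u w := by
      rw [hw, InnerProductSpace.continuousLinearMapOfBilin_apply, hB]
    have h2 : ‖w‖ ^ 2 ≤ ‖u‖ * ‖w‖ := by
      rw [← inner_self_eq_norm_sq (𝕜 := ℂ), h1]
      exact (RCLike.re_le_norm _).trans (hl1 _ _)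
    by_contra hlt
    push Not at hlt
    nlinarith [norm_nonneg u]
  · have h1 := (Complex.continuous_conj.tendsto _).comp (hl2 v u)
    rw [← hB, ← InnerProductSpace.continuousLinearMapOfBilin_apply, inner_conj_symm] at h1
    refine h1.congr fun k => ?_
    simp

/-- The maximum of `Re ⟪ψ', x ψ⟫` over the unit ball of a commutant is attained. -/
theorem exists_maximizer (N : StarSubalgebra ℂ (E →L[ℂ] E)) (ψ ψ' : E) :
    ∃ x₀ ∈ commutant N, ‖x₀‖ ≤ 1 ∧
      ∀ x ∈ commutant N, ‖x‖ ≤ 1 → (⟪ψ', x ψ⟫_ℂ).re ≤ (⟪ψ', x₀ ψ⟫_ℂ).re := by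
  let S : Set ℝ := {t | ∃ x ∈ commutant N, ‖x‖ ≤ 1 ∧ t = (⟪ψ', x ψ⟫_ℂ).re}
  have hne : S.Nonempty := ⟨_, 0, zero_mem _, by simp, rfl⟩
  have hbd : BddAbove S := by
    refine ⟨‖ψ'‖ * ‖ψ‖, ?_⟩
    rintro _ ⟨x, -, hx, rfl⟩
    refine (Complex.re_le_norm _).trans ((norm_inner_le_norm _ _).trans ?_)
    exact mul_le_mul_of_nonneg_left (by simpa using x.le_of_opNorm_le hx ψ) (norm_nonneg _)
  obtain ⟨t, -, ht, hS⟩ := exists_seq_tendsto_sSup hne hbd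
  choose x hxN hx1 hxt using hS
  obtain ⟨x₀, h1, hlim⟩ := exists_weak_limit hx1
  refine ⟨x₀, mem_commutant.2 fun n hn => ?_, h1, fun y hy hy1 => ?_⟩
  · ext v
    refine ext_inner_left ℂ fun u => ?_
    have e1 := hlim (star n u) v
    have e2 := hlim u (n v)
    simp only [inner_star_left] at e1
    refine tendsto_nhds_unique e1 (e2.congr fun k => ?_)
    have := congrArg (fun Q : E →L[ℂ] E => Q v) (mem_commutant.1 (hxN k) n hn)
    simp only [mul_apply_eq_comp] at this
    rw [this]
  · have e1 := (Complex.continuous_re.tendsto _).comp (hlim ψ' ψ)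
    have e2 : Tendsto t (hyperfilter ℕ : Filter ℕ) (𝓝 (sSup S)) :=
      ht.mono_left (by simpa using Nat.hyperfilter_le_atTop)
    have : (⟪ψ', x₀ ψ⟫_ℂ).re = sSup S :=
      tendsto_nhds_unique e1 (e2.congr fun k => hxt k)
    rw [this]
    exact le_csSup hbd ⟨y, hy, hy1, rfl⟩

/-- A vector `δ` whose orbit is dominated by that of `φ` is the image of `φ` under a contraction in
the commutant. -/
theorem exists_commutant_map {M : StarSubalgebra ℂ (E →L[ℂ] E)} {φ δ : E}
    (h : ∀ x ∈ M, ‖x δ‖ ≤ ‖x φ‖) :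
    ∃ D ∈ commutant M, ‖D‖ ≤ 1 ∧ (∀ x ∈ M, D (x φ) = x δ) ∧
      ∀ v, D v = D ((orbit M (StarAlgHom.id ℂ _) φ).starProjection v) := by
  let K := orbit M (StarAlgHom.id ℂ (E →L[ℂ] E)) φ
  let f : M →ₗ[ℂ] E := (ContinuousLinearMap.apply ℂ E δ).toLinearMap ∘ₗ M.subtype.toLinearMap
  let e : M →ₗ[ℂ] K := LinearMap.codRestrict K
    ((ContinuousLinearMap.apply ℂ E φ).toLinearMap ∘ₗ M.subtype.toLinearMap)
    fun x => apply_mem_orbit M (StarAlgHom.id ℂ _) φ x.2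
  have hd : DenseRange e := by
    intro w
    rw [Metric.mem_closure_iff]
    intro ε hε
    obtain ⟨n, hn, hlt⟩ := (mem_orbit_iff M (StarAlgHom.id ℂ _) φ).1 w.2 ε hε
    exact ⟨_, ⟨⟨n, hn⟩, rfl⟩, by rw [dist_eq_norm]; exact hlt⟩
  have hn : ∀ x : M, ‖f x‖ ≤ 1 * ‖e x‖ := fun x => by rw [one_mul]; exact h x.1 x.2
  let D₀ : K →L[ℂ] E := f.extendOfNorm e
  let D : E →L[ℂ] E := D₀ ∘L K.orthogonalProjectionOnto
  have hDK : ∀ v (hv : v ∈ K), D v = D₀ ⟨v, hv⟩ := fun v hv => by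
    change D₀ (K.orthogonalProjectionOnto v) = _
    congr 1
    exact Submodule.orthogonalProjectionOnto_mem_subspace_eq_self ⟨v, hv⟩
  have hDP : ∀ v, D v = D (K.starProjection v) := fun v => by
    rw [hDK _ (Submodule.starProjection_apply_mem K v)]
    rfl
  have hDx : ∀ x ∈ M, D (x φ) = x δ := fun x hx => by
    refine (hDK _ (apply_mem_orbit M (StarAlgHom.id ℂ _) φ hx)).trans ?_
    exact LinearMap.extendOfNorm_eq (f := f) hd ⟨1, hn⟩ ⟨x, hx⟩
  refine ⟨D, mem_commutant.2 fun m hm => ?_, ?_, hDx, hDP⟩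
  · have hK : K ≤ LinearMap.eqLocus (m * D).toLinearMap (D * m).toLinearMap := by
      refine Submodule.topologicalClosure_minimal _ ?_
        (isClosed_eq (m * D).continuous (D * m).continuous)
      rintro _ ⟨x, hx, rfl⟩
      change m (D (x φ)) = D (m (x φ))
      rw [hDx x hx]
      exact (hDx (m * x) (mul_mem hm hx)).symm
    ext v
    have e1 : m (D (K.starProjection v)) = D (m (K.starProjection v)) :=
      hK (Submodule.starProjection_apply_mem K v)
    have e2 : m (K.starProjection v) = K.starProjection (m v) :=
      congrArg (fun Q : E →L[ℂ] E => Q v)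
        (starProjection_orbit_comm M (StarAlgHom.id ℂ _) φ hm)
    change m (D v) = D (m v)
    rw [hDP v, e1, e2, ← hDP]
  · refine D.opNorm_le_bound zero_le_one fun v => ?_
    refine (LinearMap.norm_extendOfNorm_apply_le hd 1 hn _).trans ?_
    rw [one_mul, one_mul]
    exact Submodule.norm_orthogonalProjectionOnto_apply_le K v

end Uhlmann

section Uhlmann

variable {E : Type*} [NormedAddCommGroup E] [InnerProductSpace ℂ E] [CompleteSpace E]

theorem eq_ofReal_of_norm_le_re {z : ℂ} (h : ‖z‖ ≤ z.re) : z = (z.re : ℂ) := by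
  have h1 : z.re = ‖z‖ := le_antisymm (Complex.re_le_norm z) h
  have h2 := Complex.sq_norm z
  rw [Complex.normSq_apply, ← h1] at h2
  have h3 : z.im = 0 := by
    have : z.im * z.im = 0 := by nlinarith
    simpa using this
  apply Complex.ext <;> simp [h3]

/-- A functional `x ↦ ⟪u, x v⟫` on a ⋆-algebra whose real part is at most `F` on the unit ball is
bounded by `F`. -/
theorem norm_inner_apply_le {M : StarSubalgebra ℂ (E →L[ℂ] E)} {u v : E} {F : ℝ}
    (h : ∀ x ∈ M, ‖x‖ ≤ 1 → (⟪u, x v⟫_ℂ).re ≤ F) {x : E →L[ℂ] E} (hx : x ∈ M) :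
    ‖⟪u, x v⟫_ℂ‖ ≤ F * ‖x‖ := by
  rcases eq_or_ne ⟪u, x v⟫_ℂ 0 with h0 | h0
  · rw [h0, norm_zero]
    have : 0 ≤ F := by simpa using h 0 (zero_mem _) (by simp)
    positivity
  have hx0 : 0 < ‖x‖ := norm_pos_iff.2 fun hx0 => h0 (by simp [hx0])
  set z := ⟪u, x v⟫_ℂ with hz
  have hz0 : 0 < ‖z‖ := norm_pos_iff.2 h0
  -- rotate the value to the positive axis
  let c : ℂ := (starRingEnd ℂ z) / (‖z‖ * ‖x‖)
  have hc : ‖c‖ = ‖x‖⁻¹ := by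
    simp only [c, norm_div, RCLike.norm_conj, norm_mul, Complex.norm_real, norm_norm]
    field_simp
  have h1 := h (c • x) (M.smul_mem hx c) (by
    rw [norm_smul, hc, inv_mul_cancel₀ hx0.ne'])
  have h2 : ⟪u, (c • x) v⟫_ℂ = ((‖z‖ / ‖x‖ : ℝ) : ℂ) := by
    rw [smul_apply, inner_smul_right, ← hz]
    simp only [c]
    rw [div_mul_eq_mul_div, mul_comm, Complex.mul_conj, Complex.normSq_eq_norm_sq]
    push_cast
    have : (‖z‖ : ℂ) ≠ 0 := by exact_mod_cast hz0.ne'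
    have : (‖x‖ : ℂ) ≠ 0 := by exact_mod_cast hx0.ne'
    field_simp
  rw [h2, Complex.ofReal_re, div_le_iff₀ hx0] at h1
  exact h1

/-- A functional that attains its norm at `1` is real on self-adjoint elements. -/
theorem im_eq_zero_of_norm_attained {M : StarSubalgebra ℂ (E →L[ℂ] E)} {u v : E} {F : ℝ}
    (h : ∀ x ∈ M, ‖⟪u, x v⟫_ℂ‖ ≤ F * ‖x‖) (h1 : ⟪u, v⟫_ℂ = (F : ℂ)) {z : E →L[ℂ] E} (hz : z ∈ M)
    (hs : IsSelfAdjoint z) : (⟪u, z v⟫_ℂ).im = 0 := by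
  have hF : 0 ≤ F := by
    rcases subsingleton_or_nontrivial E with hE | hE
    · have : F = 0 := by
        have : u = 0 := Subsingleton.elim _ _
        simp only [this, inner_zero_left] at h1
        exact_mod_cast h1.symm
      exact this.ge
    · have := h 1 (one_mem _)
      rw [norm_one, mul_one] at this
      exact (norm_nonneg _).trans this
  set c := (⟪u, z v⟫_ℂ).im with hc
  set Z := ‖z‖ ^ 2 with hZ
  -- test on `1 + i t z`, whose norm is `1 + O(t²)`
  have key : ∀ t : ℝ, (F - t * c) ^ 2 ≤ F ^ 2 * (1 + t ^ 2 * Z) := by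
    intro t
    let w : E →L[ℂ] E := 1 + (t * Complex.I) • z
    have hw : w ∈ M := add_mem (one_mem _) (M.smul_mem hz _)
    have hw2 : ‖w‖ ^ 2 ≤ 1 + t ^ 2 * Z := by
      rw [sq, ← CStarRing.norm_star_mul_self]
      have : star w * w = 1 + ((t ^ 2 : ℝ) : ℂ) • (z * z) := by
        simp only [w, star_add, star_one, star_smul, hs.star_eq, RCLike.star_def, map_mul,
          Complex.conj_ofReal, Complex.conj_I, add_mul, mul_add, one_mul, mul_one, smul_mul_assoc,
          mul_smul_comm, smul_add]
        rw [smul_smul, show (t : ℂ) * Complex.I * (t * -Complex.I) = ((t ^ 2 : ℝ) : ℂ) by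
          push_cast; linear_combination -(t : ℂ) ^ 2 * Complex.I_sq]
        module
      rw [this]
      refine (norm_add_le _ _).trans (add_le_add ?_ ?_)
      · exact ContinuousLinearMap.norm_id_le
      · rw [norm_smul, Complex.norm_real, Real.norm_of_nonneg (sq_nonneg t), hZ, sq ‖z‖]
        exact mul_le_mul_of_nonneg_left (norm_mul_le _ _) (sq_nonneg t)
    have h2 := h w hw
    have h3 : (⟪u, w v⟫_ℂ).re = F - t * c := by
      simp only [w, add_apply, one_apply_eq_self, smul_apply, inner_add_right, inner_smul_right, h1]
      simp [hc, sub_eq_add_neg]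
    have h4 : (F - t * c) ^ 2 ≤ ‖⟪u, w v⟫_ℂ‖ ^ 2 := by
      rw [← h3, ← sq_abs]
      exact pow_le_pow_left₀ (abs_nonneg _) (Complex.abs_re_le_norm _) 2
    have h5 : ‖⟪u, w v⟫_ℂ‖ ^ 2 ≤ F ^ 2 * ‖w‖ ^ 2 := by
      rw [← mul_pow]; exact pow_le_pow_left₀ (norm_nonneg _) h2 2
    nlinarith [sq_nonneg F]
  by_contra hc0
  have hcpos : 0 < c ^ 2 := by positivity
  rcases hF.eq_or_lt with hF0 | hF0
  · have := key 1
    rw [← hF0] at this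
    nlinarith
  have hZ0 : 0 ≤ Z := by positivity
  -- a value of `t` of the sign that violates the inequality
  have := key (-(c / (F * Z + 1)))
  have hp : 0 < F * Z + 1 := by positivity
  have e : (F - -(c / (F * Z + 1)) * c) ^ 2 - F ^ 2 * (1 + (-(c / (F * Z + 1))) ^ 2 * Z) =
      c ^ 2 * (2 * F * (F * Z + 1) + c ^ 2 - F ^ 2 * Z) / (F * Z + 1) ^ 2 := by
    field_simp
    ring
  have : 0 < c ^ 2 * (2 * F * (F * Z + 1) + c ^ 2 - F ^ 2 * Z) / (F * Z + 1) ^ 2 := by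
    have : 0 < 2 * F * (F * Z + 1) + c ^ 2 - F ^ 2 * Z := by
      nlinarith [mul_nonneg hF hZ0, mul_nonneg hF (mul_nonneg hF hZ0)]
    positivity
  linarith

/-- A functional that attains its norm at `1` is positive. -/
theorem re_nonneg_of_norm_attained {M : StarSubalgebra ℂ (E →L[ℂ] E)} {u v : E} {F : ℝ}
    (h : ∀ x ∈ M, ‖⟪u, x v⟫_ℂ‖ ≤ F * ‖x‖) (h1 : ⟪u, v⟫_ℂ = (F : ℂ)) {x : E →L[ℂ] E} (hx : x ∈ M) :
    0 ≤ (⟪u, (star x * x) v⟫_ℂ).re := by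
  rcases eq_or_ne x 0 with rfl | hx0
  · simp
  have hxp : 0 < ‖x‖ := norm_pos_iff.2 hx0
  have hF : 0 ≤ F := by
    have := (norm_nonneg _).trans (h x hx)
    exact nonneg_of_mul_nonneg_left this hxp
  set c : ℝ := (‖x‖ ^ 2)⁻¹ with hc
  have hc0 : 0 < c := by positivity
  have hcx : c * ‖x‖ ^ 2 = 1 := inv_mul_cancel₀ (by positivity)
  let w : E →L[ℂ] E := 1 - (c : ℂ) • (star x * x)
  have hw : w ∈ M := sub_mem (one_mem _) (M.smul_mem (mul_mem (star_mem hx) hx) _)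
  have hw1 : ‖w‖ ≤ 1 := by
    refine w.opNorm_le_bound zero_le_one fun y => ?_
    rw [one_mul]
    refine (sq_le_sq₀ (norm_nonneg _) (norm_nonneg _)).1 ?_
    have e1 : w y = y - (c : ℂ) • star x (x y) := by simp [w]
    have e2 : ‖y - (c : ℂ) • star x (x y)‖ ^ 2 = _ := norm_sub_sq (𝕜 := ℂ) y _
    rw [e1, e2, inner_smul_right, inner_star_right, norm_smul, Complex.norm_real,
      Real.norm_of_nonneg hc0.le, inner_self_eq_norm_sq_to_K, mul_pow]
    have e3 : ‖star x (x y)‖ ^ 2 ≤ ‖x‖ ^ 2 * ‖x y‖ ^ 2 := by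
      rw [← mul_pow, ← norm_star x]
      exact pow_le_pow_left₀ (norm_nonneg _) ((star x).le_opNorm _) 2
    have e4 : RCLike.re ((c : ℂ) * ((‖x y‖ : ℂ)) ^ 2) = c * ‖x y‖ ^ 2 := by
      norm_cast
    erw [e4]
    nlinarith [mul_le_mul_of_nonneg_left e3 (sq_nonneg c), mul_nonneg hc0.le (sq_nonneg ‖x y‖)]
  have h2 := h w hw
  have h3 : (⟪u, w v⟫_ℂ).re = F - c * (⟪u, (star x * x) v⟫_ℂ).re := by
    simp only [w, sub_apply, one_apply_eq_self, smul_apply, inner_sub_right, inner_smul_right, h1]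
    simp
  have h4 := Complex.re_le_norm ⟪u, w v⟫_ℂ
  rw [h3] at h4
  have : F * ‖w‖ ≤ F := mul_le_of_le_one_right hF hw1
  nlinarith

end Uhlmann

section Uhlmann

variable {E : Type*} [NormedAddCommGroup E] [InnerProductSpace ℂ E] [CompleteSpace E]

/-- By Kaplansky's theorem, a bound on the difference of two vector states on `N` extends to
self-adjoint elements of the double commutant. -/
theorem norm_sub_le_of_bicommutant {N : StarSubalgebra ℂ (E →L[ℂ] E)}
    (hN : ∀ n ∈ N, IsSelfAdjoint n → ∃ m ∈ N, (1 + n * n) * m = 1) {ψ ψ' : E} {ε : ℝ} (hε : 0 ≤ ε)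
    (h : ∀ n ∈ N, ‖⟪ψ, n ψ⟫_ℂ - ⟪ψ', n ψ'⟫_ℂ‖ ≤ ε * ‖n‖) {B : E →L[ℂ] E}
    (hB : B ∈ commutant (commutant N)) (hs : IsSelfAdjoint B) {b : ℝ} (hb : ‖B‖ ≤ b)
    (hb0 : 0 < b) :
    ‖⟪ψ, B ψ⟫_ℂ - ⟪ψ', B ψ'⟫_ℂ‖ ≤ ε * b := by
  have h1 : ∀ B ∈ commutant (commutant N), IsSelfAdjoint B → ‖B‖ ≤ 1 →
      ‖⟪ψ, B ψ⟫_ℂ - ⟪ψ', B ψ'⟫_ℂ‖ ≤ ε := by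
    intro B hB hs hb
    refine le_of_forall_pos_le_add fun δ hδ => ?_
    obtain ⟨n, hn, hn1, happ⟩ := kaplansky hN hB hs hb
      (Sum.elim (fun _ : Unit => ψ) fun _ : Unit => ψ') (ε := δ / (‖ψ‖ + ‖ψ'‖ + 1)) (by positivity)
    have a1 : ‖B ψ - n ψ‖ ≤ _ := happ (Sum.inl ())
    have a2 : ‖B ψ' - n ψ'‖ ≤ _ := happ (Sum.inr ())
    have e : ⟪ψ, B ψ⟫_ℂ - ⟪ψ', B ψ'⟫_ℂ =
        (⟪ψ, n ψ⟫_ℂ - ⟪ψ', n ψ'⟫_ℂ) + (⟪ψ, B ψ - n ψ⟫_ℂ - ⟪ψ', B ψ' - n ψ'⟫_ℂ) := by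
      rw [inner_sub_right, inner_sub_right]; ring
    rw [e]
    refine (norm_add_le _ _).trans (add_le_add ((h n hn).trans (mul_le_of_le_one_right hε hn1)) ?_)
    refine (norm_sub_le _ _).trans ?_
    have b1 := (norm_inner_le_norm (𝕜 := ℂ) ψ (B ψ - n ψ)).trans
      (mul_le_mul_of_nonneg_left a1 (norm_nonneg _))
    have b2 := (norm_inner_le_norm (𝕜 := ℂ) ψ' (B ψ' - n ψ')).trans
      (mul_le_mul_of_nonneg_left a2 (norm_nonneg _))
    have hp : 0 < ‖ψ‖ + ‖ψ'‖ + 1 := by positivity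
    have : δ / (‖ψ‖ + ‖ψ'‖ + 1) * (‖ψ‖ + ‖ψ'‖ + 1) = δ := div_mul_cancel₀ _ hp.ne'
    have : 0 ≤ δ / (‖ψ‖ + ‖ψ'‖ + 1) := by positivity
    nlinarith
  have hb1 : ‖((b⁻¹ : ℝ) : ℂ) • B‖ ≤ 1 := by
    rw [norm_smul, Complex.norm_real, Real.norm_of_nonneg (by positivity), inv_mul_le_iff₀ hb0]
    simpa using hb
  have h2 := h1 (((b⁻¹ : ℝ) : ℂ) • B) ((commutant (commutant N)).smul_mem hB _)
    (by rw [isSelfAdjoint_iff, star_smul, hs.star_eq]; simp) hb1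
  rw [smul_apply, smul_apply, inner_smul_right, inner_smul_right, ← mul_sub, norm_mul,
    Complex.norm_real, Real.norm_of_nonneg (by positivity), inv_mul_le_iff₀ hb0] at h2
  linarith

/-- Uhlmann's theorem relative to a ⋆-algebra `N`, with a Fuchs–van de Graaf bound: if the vector
states of `ψ` and `ψ'` agree on `N` up to `ε`, then a contraction in the commutant of `N` maps `ψ`
to a vector whose overlap with `ψ'` is at least `1 - 2 ε`.

Let `x₀` maximize `Re ⟪ψ', x ψ⟫` over the contractions of the commutant `M`, let `ψ₀` be the
projection of `ψ` to the closure of `M ψ'`, and `ψ₁ = x₀ ψ₀`. By maximality `x₀` is isometric on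
`ψ₀`, and `z ↦ ⟪ψ', z ψ₁⟫` is a positive functional on `M`. Hence `x (ψ' + ψ₁) ↦ x (ψ' - ψ₁)`
extends to a contraction `D` in the commutant of `M`, and the difference of the two states on
`D + D⋆` dominates `‖ψ' - ψ₁‖²`. -/
theorem uhlmann {N : StarSubalgebra ℂ (E →L[ℂ] E)}
    (hN : ∀ n ∈ N, IsSelfAdjoint n → ∃ m ∈ N, (1 + n * n) * m = 1) {ψ ψ' : E} {ε : ℝ} (hε : 0 ≤ ε)
    (hψ : ‖ψ‖ = 1) (hψ' : ‖ψ'‖ = 1)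
    (h : ∀ n ∈ N, ‖⟪ψ, n ψ⟫_ℂ - ⟪ψ', n ψ'⟫_ℂ‖ ≤ ε * ‖n‖) :
    ∃ x ∈ commutant N, ‖x‖ ≤ 1 ∧ 1 - 2 * ε ≤ (⟪ψ', x ψ⟫_ℂ).re := by
  obtain ⟨x₀, hx₀, hx₀1, hmax⟩ := exists_maximizer N ψ ψ'
  refine ⟨x₀, hx₀, hx₀1, ?_⟩
  let M := commutant N
  set F := (⟪ψ', x₀ ψ⟫_ℂ).re with hF
  have hbd : ∀ x ∈ M, ‖⟪ψ', x ψ⟫_ℂ‖ ≤ F * ‖x‖ := fun x hx => norm_inner_apply_le hmax hx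
  have hF0 : 0 ≤ F := by simpa using hmax 0 (zero_mem _) (by simp)
  have hκ1 : ⟪ψ', x₀ ψ⟫_ℂ = (F : ℂ) :=
    eq_ofReal_of_norm_le_re ((hbd x₀ hx₀).trans (mul_le_of_le_one_right hF0 hx₀1))
  have hκ : ∀ z ∈ M, ‖⟪ψ', z (x₀ ψ)⟫_ℂ‖ ≤ F * ‖z‖ := fun z hz => by
    refine (hbd (z * x₀) (mul_mem hz hx₀)).trans (mul_le_mul_of_nonneg_left ?_ hF0)
    exact (norm_mul_le _ _).trans (mul_le_of_le_one_right (norm_nonneg _) hx₀1)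
  -- the projection onto the closure of `M ψ'` lies in the double commutant
  let K := orbit M (StarAlgHom.id ℂ (E →L[ℂ] E)) ψ'
  let q : E →L[ℂ] E := K.starProjection
  have hq : q ∈ commutant M := mem_commutant.2 fun n hn =>
    starProjection_orbit_comm M (StarAlgHom.id ℂ _) ψ' hn
  have hqs : IsSelfAdjoint q := isSelfAdjoint_starProjection K
  have hqx : ∀ x ∈ M, ∀ v, q (x v) = x (q v) := fun x hx v =>
    (congrArg (fun Q : E →L[ℂ] E => Q v) (mem_commutant.1 hq x hx)).symm
  have hqψ' : q ψ' = ψ' :=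
    (Submodule.starProjection_eq_self_iff).2 (self_mem_orbit M (StarAlgHom.id ℂ _) ψ')
  have hqq : ∀ v, q (q v) = q v := fun v =>
    (Submodule.starProjection_eq_self_iff).2 (Submodule.starProjection_apply_mem K v)
  set ψ₀ := q ψ with hψ₀
  set ψ₁ := x₀ ψ₀ with hψ₁
  have hqψ₁ : q ψ₁ = ψ₁ := by rw [hψ₁, hqx x₀ hx₀, hψ₀, hqq]
  have hq_inner : ∀ x ∈ M, ∀ v, ⟪ψ', x v⟫_ℂ = ⟪ψ', x (q v)⟫_ℂ := fun x hx v => by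
    rw [← hqx x hx, ← inner_apply_of_selfAdjoint hqs, hqψ']
  -- `x₀` is isometric on `ψ₀`: otherwise `x₀ + δ x (1 - x₀⋆ x₀)` would do better
  have hperp : ∀ x ∈ M, ‖x‖ ≤ 1 → ⟪ψ', x (ψ - star x₀ (x₀ ψ))⟫_ℂ = 0 := by
    intro x hx hx1
    set d := ⟪ψ', x (ψ - star x₀ (x₀ ψ))⟫_ℂ with hd
    by_contra hne
    have hdp : 0 < ‖d‖ := norm_pos_iff.2 hne
    let c : ℂ := starRingEnd ℂ d
    have hc : ‖c‖ = ‖d‖ := RCLike.norm_conj _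
    let w : E →L[ℂ] E := x₀ + c • (x * (1 - star x₀ * x₀))
    have hw : w ∈ M := add_mem hx₀ (M.smul_mem
      (mul_mem hx (sub_mem (one_mem _) (mul_mem (star_mem hx₀) hx₀))) c)
    have hwn : ‖w‖ ≤ 1 + ‖d‖ ^ 2 / 2 := by
      refine w.opNorm_le_bound (by positivity) fun u => ?_
      have e1 : w u = x₀ u + c • x (u - star x₀ (x₀ u)) := by simp [w]
      have e2 : ‖u - star x₀ (x₀ u)‖ ^ 2 = _ := norm_sub_sq (𝕜 := ℂ) u _
      rw [inner_star_right, inner_self_eq_norm_sq] at e2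
      have e3 : ‖star x₀ (x₀ u)‖ ≤ ‖x₀ u‖ := by
        simpa using (star x₀).le_of_opNorm_le ((norm_star x₀).trans_le hx₀1) (x₀ u)
      have e4 : ‖w u‖ ≤ ‖x₀ u‖ + ‖d‖ * ‖u - star x₀ (x₀ u)‖ := by
        rw [e1]
        refine (norm_add_le _ _).trans ?_
        rw [norm_smul, hc]
        gcongr
        simpa using x.le_of_opNorm_le hx1 (u - star x₀ (x₀ u))
      refine e4.trans ?_
      refine (sq_le_sq₀ (by positivity) (by positivity)).1 ?_
      have e5 : ‖x₀ u‖ ^ 2 + ‖u - star x₀ (x₀ u)‖ ^ 2 ≤ ‖u‖ ^ 2 := by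
        nlinarith [norm_nonneg (star x₀ (x₀ u)), norm_nonneg (x₀ u)]
      have e6 : (‖x₀ u‖ + ‖d‖ * ‖u - star x₀ (x₀ u)‖) ^ 2 ≤ (1 + ‖d‖ ^ 2) * ‖u‖ ^ 2 := by
        nlinarith [sq_nonneg (‖d‖ * ‖x₀ u‖ - ‖u - star x₀ (x₀ u)‖),
          mul_le_mul_of_nonneg_left e5 (show 0 ≤ 1 + ‖d‖ ^ 2 by positivity)]
      nlinarith [mul_nonneg (sq_nonneg (‖d‖ ^ 2)) (sq_nonneg ‖u‖)]
    have h1 := hbd w hw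
    have h2 : ⟪ψ', w ψ⟫_ℂ = ((F + ‖d‖ ^ 2 : ℝ) : ℂ) := by
      have : w ψ = x₀ ψ + c • x (ψ - star x₀ (x₀ ψ)) := by simp [w]
      rw [this, inner_add_right, inner_smul_right, hκ1, ← hd, mul_comm, Complex.mul_conj,
        Complex.normSq_eq_norm_sq]
      push_cast
      rfl
    rw [h2, Complex.norm_real, Real.norm_of_nonneg (by positivity)] at h1
    have h3 : F ≤ 1 := by
      refine (Complex.re_le_norm _).trans ((norm_inner_le_norm _ _).trans ?_)
      rw [hψ', one_mul]
      simpa [hψ] using x₀.le_of_opNorm_le hx₀1 ψ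
    nlinarith [mul_le_mul_of_nonneg_left hwn hF0, mul_pos hdp hdp]
  have hp0 : star x₀ (x₀ ψ₀) = ψ₀ := by
    set ξ := ψ - star x₀ (x₀ ψ) with hξ
    have hz : ∀ x ∈ M, ⟪ψ', x ξ⟫_ℂ = 0 := fun x hx => by
      have := norm_inner_apply_le (F := 0) (fun y hy hy1 => by rw [hperp y hy hy1]; simp) hx
      rw [zero_mul] at this
      exact norm_le_zero_iff.1 this
    have hK : K ≤ (ℂ ∙ ξ)ᗮ := by
      refine Submodule.topologicalClosure_minimal _ ?_ (Submodule.isClosed_orthogonal _)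
      rintro _ ⟨x, hx, rfl⟩
      rw [Submodule.mem_orthogonal_singleton_iff_inner_left]
      change ⟪x ψ', ξ⟫_ℂ = 0
      rw [← hz (star x) (star_mem hx), inner_star_right]
    have hqξ : q ξ = 0 := by
      have h1 := Submodule.mem_orthogonal_singleton_iff_inner_left.1
        (hK (Submodule.starProjection_apply_mem K ξ))
      change ⟪q ξ, ξ⟫_ℂ = 0 at h1
      rw [← inner_self_eq_zero (𝕜 := ℂ), inner_apply_of_selfAdjoint hqs, hqq,
        ← inner_apply_of_selfAdjoint hqs, h1]
    rw [hξ, map_sub, hqx _ (star_mem hx₀), hqx _ hx₀, sub_eq_zero] at hqξ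
    exact hqξ.symm
  have hiso : ∀ s : E →L[ℂ] E, s ∈ commutant M → IsSelfAdjoint s → (∀ v, s v = s (q v)) →
      ⟪ψ₁, s ψ₁⟫_ℂ = ⟪ψ, s ψ⟫_ℂ := by
    intro s hs hsa hsq
    have e1 : s (x₀ ψ₀) = x₀ (s ψ₀) :=
      (congrArg (fun Q : E →L[ℂ] E => Q ψ₀) (mem_commutant.1 hs x₀ hx₀)).symm
    rw [hψ₁, e1, ← inner_star_left, hp0, hsq ψ, ← hψ₀, ← inner_apply_of_selfAdjoint hsa,
      ← inner_apply_of_selfAdjoint hsa, hsq ψ]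
  set φ := ψ' + ψ₁ with hφ
  set δ := ψ' - ψ₁ with hδ
  -- the functional `z ↦ ⟪ψ', z ψ₁⟫` attains its norm at `1`, so that it is positive
  have hκ₁ : ∀ z ∈ M, ⟪ψ', z ψ₁⟫_ℂ = ⟪ψ', z (x₀ ψ)⟫_ℂ := fun z hz =>
    (hq_inner (z * x₀) (mul_mem hz hx₀) ψ).symm
  have hF₁ : ⟪ψ', ψ₁⟫_ℂ = (F : ℂ) := (hκ₁ 1 (one_mem _)).trans hκ1
  have hdom : ∀ x ∈ M, ‖x δ‖ ≤ ‖x φ‖ := by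
    intro x hx
    refine (sq_le_sq₀ (norm_nonneg _) (norm_nonneg _)).1 ?_
    have h1 := re_nonneg_of_norm_attained hκ hκ1 hx
    rw [← hκ₁ _ (mul_mem (star_mem hx) hx), mul_apply_eq_comp, inner_star_right] at h1
    have e1 : ‖x ψ' - x ψ₁‖ ^ 2 = _ := norm_sub_sq (𝕜 := ℂ) _ _
    have e2 : ‖x ψ' + x ψ₁‖ ^ 2 = _ := norm_add_sq (𝕜 := ℂ) _ _
    rw [hδ, hφ, map_sub, map_add, e1, e2]
    have : 0 ≤ RCLike.re ⟪x ψ', x ψ₁⟫_ℂ := h1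
    linarith
  have hherm : ∀ x ∈ M, ⟪ψ₁, x ψ'⟫_ℂ = ⟪ψ', x ψ₁⟫_ℂ := by
    intro x hx
    have e0 : ⟪ψ₁, x ψ'⟫_ℂ = starRingEnd ℂ ⟪ψ', star x ψ₁⟫_ℂ := by
      rw [inner_conj_symm, inner_star_left]
    have h1 := im_eq_zero_of_norm_attained hκ hκ1 (add_mem hx (star_mem hx))
      (IsSelfAdjoint.add_star_self x)
    have h2 := im_eq_zero_of_norm_attained hκ hκ1
      (M.smul_mem (sub_mem hx (star_mem hx)) Complex.I) (by
        rw [isSelfAdjoint_iff, star_smul, star_sub, star_star, RCLike.star_def, Complex.conj_I]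
        module)
    rw [add_apply, inner_add_right, ← hκ₁ x hx, ← hκ₁ _ (star_mem hx)] at h1
    rw [smul_apply, sub_apply, inner_smul_right, inner_sub_right, ← hκ₁ x hx,
      ← hκ₁ _ (star_mem hx)] at h2
    simp at h1 h2
    rw [e0]
    apply Complex.ext
    · rw [Complex.conj_re]; linarith
    · rw [Complex.conj_im]; linarith
  obtain ⟨D, hD, hD1, hDx, hDP⟩ := exists_commutant_map hdom
  set L := orbit M (StarAlgHom.id ℂ (E →L[ℂ] E)) φ with hL
  have hDφ : D φ = δ := by simpa using hDx 1 (one_mem _)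
  have hLK : L ≤ K := by
    refine Submodule.topologicalClosure_minimal _ ?_ (Submodule.isClosed_topologicalClosure _)
    rintro _ ⟨x, hx, rfl⟩
    change x φ ∈ K
    refine (Submodule.starProjection_eq_self_iff).1 ?_
    change q (x φ) = x φ
    rw [hqx x hx, hφ, map_add q, hqψ', hqψ₁]
  have hqD : ∀ v, q (D v) = D v := by
    have hLD : L ≤ K.comap D.toLinearMap := by
      refine Submodule.topologicalClosure_minimal _ ?_
        ((Submodule.isClosed_topologicalClosure _).preimage D.continuous)
      rintro _ ⟨x, hx, rfl⟩
      change D (x φ) ∈ K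
      rw [hDx x hx]
      refine (Submodule.starProjection_eq_self_iff).1 ?_
      change q (x δ) = x δ
      rw [hqx x hx, hδ, map_sub q, hqψ', hqψ₁]
    intro v
    refine (Submodule.starProjection_eq_self_iff).2 ?_
    rw [hDP v]
    exact hLD (Submodule.starProjection_apply_mem L v)
  have hPs : IsSelfAdjoint L.starProjection := isSelfAdjoint_starProjection L
  have hPP : ∀ v, L.starProjection (L.starProjection v) = L.starProjection v := fun v =>
    (Submodule.starProjection_eq_self_iff).2 (Submodule.starProjection_apply_mem L v)
  have hDq : ∀ v, D (q v) = D v := by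
    intro v
    rw [hDP (q v), hDP v]
    congr 1
    refine ext_inner_left ℂ fun u => ?_
    have : q (L.starProjection u) = L.starProjection u :=
      (Submodule.starProjection_eq_self_iff).2 (hLK (Submodule.starProjection_apply_mem L u))
    rw [← inner_apply_of_selfAdjoint hPs, ← inner_apply_of_selfAdjoint hqs, this,
      inner_apply_of_selfAdjoint hPs]
  -- the test observable is `D + D⋆`
  set s := D + star D with hs
  have hsM : s ∈ commutant M := add_mem hD (star_mem hD)
  have hsa : IsSelfAdjoint s := IsSelfAdjoint.add_star_self D
  have hsn : ‖s‖ ≤ 2 := (norm_add_le _ _).trans (by rw [norm_star]; linarith)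
  have hsq : ∀ v, s v = s (q v) := by
    intro v
    rw [hs, add_apply, add_apply, hDq]
    congr 1
    refine ext_inner_left ℂ fun u => ?_
    rw [inner_star_right, inner_star_right, ← inner_apply_of_selfAdjoint hqs, hqD]
  have hφD : ∀ v ∈ L, ⟪φ, D v⟫_ℂ = ⟪δ, v⟫_ℂ := by
    have hLe : L ≤
        LinearMap.eqLocus ((innerSL ℂ φ) ∘L D).toLinearMap (innerSL ℂ δ).toLinearMap := by
      refine Submodule.topologicalClosure_minimal _ ?_
        (isClosed_eq ((innerSL ℂ φ) ∘L D).continuous (innerSL ℂ δ).continuous)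
      rintro _ ⟨x, hx, rfl⟩
      change ⟪φ, D (x φ)⟫_ℂ = ⟪δ, x φ⟫_ℂ
      rw [hDx x hx, hφ, hδ, map_sub, map_add, inner_add_left, inner_sub_left, inner_sub_right,
        inner_sub_right, inner_add_right, inner_add_right, hherm x hx]
      ring
    exact fun v hv => hLe hv
  have hpos : 0 ≤ (⟪φ, D δ⟫_ℂ).re := by
    rw [hDP, hφD _ (Submodule.starProjection_apply_mem L δ), ← hPP δ,
      ← inner_apply_of_selfAdjoint hPs]
    exact inner_self_nonneg (𝕜 := ℂ)
  have hcross : ‖δ‖ ^ 2 ≤ (⟪φ, s δ⟫_ℂ).re := by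
    rw [hs, add_apply, inner_add_right, inner_star_right, hDφ, Complex.add_re]
    have : (⟪δ, δ⟫_ℂ).re = ‖δ‖ ^ 2 := inner_self_eq_norm_sq (𝕜 := ℂ) δ
    linarith
  have hdiff : (⟪φ, s δ⟫_ℂ).re = (⟪ψ', s ψ'⟫_ℂ).re - (⟪ψ₁, s ψ₁⟫_ℂ).re := by
    have : (⟪ψ', s ψ₁⟫_ℂ).re = (⟪ψ₁, s ψ'⟫_ℂ).re := by
      rw [← inner_apply_of_selfAdjoint hsa, ← inner_conj_symm, Complex.conj_re]
    rw [hφ, hδ, map_sub, inner_add_left, inner_sub_right, inner_sub_right]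
    simp only [Complex.add_re, Complex.sub_re]
    linarith
  have hMM : commutant M = commutant (commutant N) := rfl
  have hδ2 : ‖δ‖ ^ 2 ≤ ε * 2 := by
    have h1 := norm_sub_le_of_bicommutant hN hε h hsM hsa hsn two_pos
    rw [hdiff, hiso s hsM hsa hsq] at hcross
    have h2 := (Complex.abs_re_le_norm _).trans h1
    rw [Complex.sub_re, abs_le] at h2
    linarith
  have hψ₁n : 1 - ε ≤ ‖ψ₁‖ ^ 2 := by
    have h1 := norm_sub_le_of_bicommutant hN hε h hq hqs (K.starProjection_norm_le) one_pos
    have h2 := hiso q hq hqs fun v => (hqq v).symm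
    rw [hqψ₁] at h2
    change ‖⟪ψ, q ψ⟫_ℂ - ⟪ψ', q ψ'⟫_ℂ‖ ≤ _ at h1
    rw [hqψ', ← h2] at h1
    have h3 := (Complex.abs_re_le_norm _).trans h1
    have h4 : (⟪ψ₁, ψ₁⟫_ℂ).re = ‖ψ₁‖ ^ 2 := inner_self_eq_norm_sq (𝕜 := ℂ) _
    have h5 : (⟪ψ', ψ'⟫_ℂ).re = ‖ψ'‖ ^ 2 := inner_self_eq_norm_sq (𝕜 := ℂ) _
    rw [Complex.sub_re, abs_le, h4, h5, hψ'] at h3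
    linarith
  have hδn : ‖δ‖ ^ 2 = ‖ψ'‖ ^ 2 - 2 * RCLike.re ⟪ψ', ψ₁⟫_ℂ + ‖ψ₁‖ ^ 2 :=
    norm_sub_sq (𝕜 := ℂ) _ _
  rw [hF₁, hψ'] at hδn
  have : RCLike.re (F : ℂ) = F := Complex.ofReal_re F
  erw [this] at hδn
  linarith

end Uhlmann

/-! ### Tensor products of vectors and slices of operators -/

section Tensor

variable {α β γ : Type*} (e : γ ≃ α × β)

/-- The vector `v ⊗ w` of `ℓ²(γ) ≅ ℓ²(α) ⊗ ℓ²(β)`. -/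
noncomputable def tens (v : L2 α) (w : L2 β) : L2 γ :=
  ⟨fun c => v (e c).1 * w (e c).2, L2.mem <| by
    have h := (L2.summable_sq v).mul_of_nonneg (L2.summable_sq w)
      (fun _ => by positivity) (fun _ => by positivity)
    simpa [mul_pow] using! h.comp_injective e.injective⟩

theorem tens_apply (v : L2 α) (w : L2 β) (c : γ) : tens e v w c = v (e c).1 * w (e c).2 := rfl

theorem slice_tens (v : L2 α) (w : L2 β) (b : β) : slice e b (tens e v w) = w b • v := by
  ext a; simp [slice_apply, tens_apply, mul_comm]

theorem inner_tens (v v' : L2 α) (w w' : L2 β) :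
    ⟪tens e v w, tens e v' w'⟫_ℂ = ⟪v, v'⟫_ℂ * ⟪w, w'⟫_ℂ := by
  rw [inner_eq_tsum_slice e, lp.inner_eq_tsum w w', ← tsum_mul_left]
  refine tsum_congr fun b => ?_
  rw [slice_tens, slice_tens, inner_smul_left, inner_smul_right, RCLike.inner_apply]
  ring

theorem norm_tens (v : L2 α) (w : L2 β) : ‖tens e v w‖ = ‖v‖ * ‖w‖ := by
  rw [← sq_eq_sq₀ (norm_nonneg _) (by positivity), mul_pow, ← inner_self_eq_norm_sq (𝕜 := ℂ),
    inner_tens, inner_self_eq_norm_sq_to_K, inner_self_eq_norm_sq_to_K]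
  norm_cast

/-- The map `w ↦ v ⊗ w`. -/
noncomputable def tensL (v : L2 α) : L2 β →L[ℂ] L2 γ :=
  LinearMap.mkContinuous
    { toFun := tens e v
      map_add' := fun w w' => by ext c; simp [tens_apply, mul_add]
      map_smul' := fun k w => by ext c; simp [tens_apply, mul_left_comm] }
    ‖v‖ (fun w => (norm_tens e v w).le)

theorem tensL_apply (v : L2 α) (w : L2 β) : tensL e v w = tens e v w := rfl

theorem amp_tens (A : L2 α →L[ℂ] L2 α) (v : L2 α) (w : L2 β) :
    amp e A (tens e v w) = tens e (A v) w := by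
  ext c
  rw [amp_apply, slice_tens, map_smul, tens_apply]
  simp [mul_comm]

theorem amp_swap_tens (B : L2 β →L[ℂ] L2 β) (v : L2 α) (w : L2 β) :
    amp (e.trans (Equiv.prodComm α β)) B (tens e v w) = tens e v (B w) := by
  have h : tens e v w = tens (e.trans (Equiv.prodComm α β)) w v := by
    ext c; simp [tens_apply, mul_comm]
  rw [h, amp_tens]
  ext c; simp [tens_apply, mul_comm]

theorem ext_tens {F : Type*} [NormedAddCommGroup F] [NormedSpace ℂ F] {S T : L2 γ →L[ℂ] F}
    (h : ∀ v w, S (tens e v w) = T (tens e v w)) : S = T := by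
  classical
  refine lp.ext_continuousLinearMap (by norm_num) fun c => ?_
  ext
  have : lp.single (E := fun _ : γ => ℂ) 2 c 1 =
      tens e (lp.single 2 (e c).1 1) (lp.single 2 (e c).2 1) := by
    ext c'
    rw [tens_apply]
    by_cases hc : c' = c
    · subst hc; simp
    · rw [lp.single_apply_ne _ _ _ hc]
      rcases (not_and_or.1 fun h' : (e c').1 = (e c).1 ∧ (e c').2 = (e c).2 =>
        hc (e.injective (Prod.ext h'.1 h'.2))) with h' | h'
      · rw [lp.single_apply_ne _ _ _ h', zero_mul]
      · rw [lp.single_apply_ne (E := fun _ : β => ℂ) 2 (e c).2 1 h', mul_zero]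
  simp [this, h]

theorem amp_commute (A : L2 α →L[ℂ] L2 α) (B : L2 β →L[ℂ] L2 β) :
    amp e A * amp (e.trans (Equiv.prodComm α β)) B =
      amp (e.trans (Equiv.prodComm α β)) B * amp e A := by
  refine ext_tens e fun v w => ?_
  simp [amp_tens, amp_swap_tens]

theorem adjoint_tensL_tens (u v : L2 α) (w : L2 β) :
    (tensL e u).adjoint (tens e v w) = ⟪u, v⟫_ℂ • w := by
  refine ext_inner_left ℂ fun z => ?_
  rw [ContinuousLinearMap.adjoint_inner_right, tensL_apply, inner_tens, inner_smul_right]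

theorem amp_rankOne (u v : L2 α) :
    amp e (InnerProductSpace.rankOne ℂ u v) = tensL e u ∘L (tensL e v).adjoint := by
  refine ext_tens e fun x y => ?_
  rw [amp_tens, ContinuousLinearMap.comp_apply, adjoint_tensL_tens, InnerProductSpace.rankOne_apply,
    map_smul, tensL_apply]
  ext c
  simp [tens_apply, mul_assoc]

/-- The operator `(⟨u| ⊗ 1) O (|v⟩ ⊗ 1)` on `ℓ²(β)`. -/
noncomputable def sliceOp (u v : L2 α) (O : L2 γ →L[ℂ] L2 γ) : L2 β →L[ℂ] L2 β :=
  (tensL e u).adjoint ∘L O ∘L tensL e v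

theorem inner_sliceOp (u v : L2 α) (O : L2 γ →L[ℂ] L2 γ) (w w' : L2 β) :
    ⟪w, sliceOp e u v O w'⟫_ℂ = ⟪tens e u w, O (tens e v w')⟫_ℂ := by
  simp [sliceOp, ContinuousLinearMap.adjoint_inner_right, tensL_apply]

/-- `(|x⟩⟨u| ⊗ 1) O (|v⟩⟨y| ⊗ 1) = (1 ⊗ O') (|x⟩⟨y| ⊗ 1)`, where `O'` is the slice of `O`. -/
theorem rankOne_mul_mul_rankOne (x u v y : L2 α) (O : L2 γ →L[ℂ] L2 γ) :
    amp e (InnerProductSpace.rankOne ℂ x u) * O * amp e (InnerProductSpace.rankOne ℂ v y) =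
      amp (e.trans (Equiv.prodComm α β)) (sliceOp e u v O) *
        amp e (InnerProductSpace.rankOne ℂ x y) := by
  have h : ∀ w, amp (e.trans (Equiv.prodComm α β)) (sliceOp e u v O) (tensL e x w) =
      tensL e x (sliceOp e u v O w) := fun w => amp_swap_tens e _ _ _
  ext1 z
  simp only [amp_rankOne, mul_apply_eq_comp, ContinuousLinearMap.comp_apply, h]
  rfl

end Tensor

/-- Tensoring with the identity of `β` amounts to tensoring with the identities of `β''` and `β'`,
when `β` is identified with `β'' × β'`. -/
theorem amp_amp {α β β' δ β'' γ : Type*} (e₁ : γ ≃ α × β) (e₂ : γ ≃ δ × β') (e₃ : δ ≃ α × β'')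
    (h1 : ∀ c, (e₁ c).1 = (e₃ (e₂ c).1).1)
    (h2 : ∀ c a, e₁.symm (a, (e₁ c).2) = e₂.symm (e₃.symm (a, (e₃ (e₂ c).1).2), (e₂ c).2))
    (A : L2 α →L[ℂ] L2 α) : amp e₁ A = amp e₂ (amp e₃ A) := by
  ext v c
  have hs : slice e₁ (e₁ c).2 v = slice e₃ (e₃ (e₂ c).1).2 (slice e₂ (e₂ c).2 v) := by
    ext a
    rw [slice_apply, slice_apply, slice_apply, h2]
  rw [amp_apply, amp_apply, amp_apply, h1, hs]

/-! ### Inclusions of the algebras of finite sets of sites -/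

section Inclusion

variable {ι : Type*}

/-- Split a configuration on `X ∪ Y` into its parts on the disjoint sets `X` and `Y`. -/
def pairEquiv (ι : Type*) {X Y : Finset Site} (h : Disjoint X Y) :
    ((X ∪ Y : Finset Site) → ι) ≃ (X → ι) × (Y → ι) where
  toFun := restrictPair X Y
  invFun p j := if hX : j.1 ∈ X then p.1 ⟨j, hX⟩ else
    p.2 ⟨j, (Finset.mem_union.1 j.2).resolve_left hX⟩
  left_inv s := by
    funext j
    by_cases hX : j.1 ∈ X <;> simp [hX, restrictPair]
  right_inv p := by
    refine Prod.ext ?_ ?_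
    · funext j; simp [restrictPair]
    · funext j
      have : j.1 ∉ X := Finset.disjoint_right.1 h j.2
      simp [restrictPair, this]

theorem tensorVec_eq_tens {X Y : Finset Site} (h : Disjoint X Y) (v : LocalSpace ι X)
    (w : LocalSpace ι Y) : tensorVec v w = tens (pairEquiv ι h) v w := rfl

theorem splitConfig_symm_apply (X : Finset Site) (p : (X → ι) × ({j : Site // j ∉ X} → ι))
    (j : Site) : (splitConfig ι X).symm p j =
      if h : j ∈ X then p.1 ⟨j, h⟩ else p.2 ⟨j, h⟩ := rfl

theorem pairEquiv_symm_apply {X Y : Finset Site} (h : Disjoint X Y) (p : (X → ι) × (Y → ι))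
    (j : (X ∪ Y : Finset Site)) : (pairEquiv ι h).symm p j = if hX : j.1 ∈ X then p.1 ⟨j, hX⟩ else
      p.2 ⟨j, (Finset.mem_union.1 j.2).resolve_left hX⟩ := rfl

theorem embed_left {X Y : Finset Site} (h : Disjoint X Y) (A : LocalOp ι X) :
    embed ι X A = embed ι (X ∪ Y) (amp (pairEquiv ι h) A) := by
  refine amp_amp (splitConfig ι X) (splitConfig ι (X ∪ Y)) (pairEquiv ι h) (fun c => rfl)
    (fun c a => ?_) A
  funext j
  rw [splitConfig_symm_apply, splitConfig_symm_apply]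
  by_cases hX : j ∈ X
  · have hXY : j ∈ X ∪ Y := Finset.mem_union_left _ hX
    simp [hX, hXY, pairEquiv_symm_apply]
  · by_cases hY : j ∈ Y
    · have hXY : j ∈ X ∪ Y := Finset.mem_union_right _ hY
      simp only [hX, hXY, dite_true, dite_false, pairEquiv_symm_apply]
      rfl
    · have hXY : j ∉ X ∪ Y := by simp [hX, hY]
      simp only [hX, hXY, dite_false]
      rfl

theorem embed_right {X Y : Finset Site} (h : Disjoint X Y) (B : LocalOp ι Y) :
    embed ι Y B =
      embed ι (X ∪ Y) (amp ((pairEquiv ι h).trans (Equiv.prodComm _ _)) B) := by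
  refine amp_amp (splitConfig ι Y) (splitConfig ι (X ∪ Y))
    ((pairEquiv ι h).trans (Equiv.prodComm _ _)) (fun c => rfl) (fun c a => ?_) B
  funext j
  rw [splitConfig_symm_apply, splitConfig_symm_apply]
  change _ = if hXY : j ∈ X ∪ Y then (pairEquiv ι h).symm (_, a) ⟨j, hXY⟩ else _
  by_cases hY : j ∈ Y
  · have hXY : j ∈ X ∪ Y := Finset.mem_union_right _ hY
    have hX : j ∉ X := Finset.disjoint_right.1 h hY
    simp [hX, hY, hXY, pairEquiv_symm_apply]
  · by_cases hX : j ∈ X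
    · have hXY : j ∈ X ∪ Y := Finset.mem_union_left _ hX
      simp only [hX, hY, hXY, dite_true, dite_false, pairEquiv_symm_apply]
      rfl
    · have hXY : j ∉ X ∪ Y := by simp [hX, hY]
      simp only [hY, hXY, dite_false]
      rfl

theorem incl_left {X Y : Finset Site} (h : Disjoint X Y) (A : LocalOp ι X) :
    incl X A = incl (X ∪ Y) (amp (pairEquiv ι h) A) := Subtype.ext (embed_left h A)

theorem incl_right {X Y : Finset Site} (h : Disjoint X Y) (B : LocalOp ι Y) :
    incl Y B = incl (X ∪ Y) (amp ((pairEquiv ι h).trans (Equiv.prodComm _ _)) B) :=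
  Subtype.ext (embed_right h B)

theorem exists_incl_eq {X Z : Finset Site} (h : X ⊆ Z) (A : LocalOp ι X) :
    ∃ B : LocalOp ι Z, incl X A = incl Z B := by
  obtain ⟨Y, hY, rfl⟩ : ∃ Y, Disjoint X Y ∧ Z = X ∪ Y :=
    ⟨Z \ X, Finset.disjoint_sdiff, (Finset.union_sdiff_of_subset h).symm⟩
  exact ⟨_, incl_left hY A⟩

/-- A norm-closed ⋆-subalgebra of bounded operators is a C⋆-algebra. -/
noncomputable scoped instance : CStarAlgebra (quasiLocal ι) :=
  haveI : IsClosed (quasiLocal ι : Set (BigOp ι)) :=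
    StarSubalgebra.isClosed_topologicalClosure _
  StarSubalgebra.cstarAlgebra _

theorem norm_incl_le (X : Finset Site) (A : LocalOp ι X) : ‖incl X A‖ ≤ ‖A‖ :=
  NonUnitalStarAlgHom.norm_apply_le (incl X) A

/-- The ⋆-algebra of local observables with support in `S`. -/
noncomputable def localOn (ι : Type*) (S : Set Site) : StarSubalgebra ℂ (quasiLocal ι) where
  carrier := {O | IsLocalOn S O}
  mul_mem' := by
    rintro _ _ ⟨X, hX, A, rfl⟩ ⟨Y, hY, B, rfl⟩
    obtain ⟨A', hA⟩ := exists_incl_eq (Finset.subset_union_left (s₁ := X) (s₂ := Y)) A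
    obtain ⟨B', hB⟩ := exists_incl_eq (Finset.subset_union_right (s₁ := X) (s₂ := Y)) B
    exact ⟨X ∪ Y, by simp [hX, hY], A' * B', by rw [hA, hB, map_mul]⟩
  add_mem' := by
    rintro _ _ ⟨X, hX, A, rfl⟩ ⟨Y, hY, B, rfl⟩
    obtain ⟨A', hA⟩ := exists_incl_eq (Finset.subset_union_left (s₁ := X) (s₂ := Y)) A
    obtain ⟨B', hB⟩ := exists_incl_eq (Finset.subset_union_right (s₁ := X) (s₂ := Y)) B
    exact ⟨X ∪ Y, by simp [hX, hY], A' + B', by rw [hA, hB, map_add]⟩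
  algebraMap_mem' c := ⟨∅, by simp, algebraMap ℂ _ c, (AlgHomClass.commutes (incl ∅) c).symm⟩
  star_mem' := by
    rintro _ ⟨X, hX, A, rfl⟩
    exact ⟨X, hX, star A, (map_star (incl X) A).symm⟩

theorem incl_mem_localOn {S : Set Site} {X : Finset Site} (h : (X : Set Site) ⊆ S)
    (A : LocalOp ι X) : incl X A ∈ localOn ι S := ⟨X, h, A, rfl⟩

theorem localOn_mono {S T : Set Site} (h : S ⊆ T) : localOn ι S ≤ localOn ι T := by
  rintro _ ⟨X, hX, A, rfl⟩
  exact ⟨X, hX.trans h, A, rfl⟩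

theorem mem_localOn_finset {X : Finset Site} {O : quasiLocal ι} :
    O ∈ localOn ι (X : Set Site) ↔ ∃ A : LocalOp ι X, O = incl X A := by
  constructor
  · rintro ⟨Y, hY, A, rfl⟩
    exact exists_incl_eq (Finset.coe_subset.1 hY) A
  · rintro ⟨A, rfl⟩
    exact incl_mem_localOn subset_rfl A

/-- A self-adjoint local observable comes from a self-adjoint operator. -/
theorem exists_selfAdjoint_incl {S : Set Site} {O : quasiLocal ι} (hO : O ∈ localOn ι S)
    (hs : IsSelfAdjoint O) : ∃ X : Finset Site, (X : Set Site) ⊆ S ∧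
      ∃ A : LocalOp ι X, IsSelfAdjoint A ∧ O = incl X A := by
  obtain ⟨X, hX, A, rfl⟩ := hO
  refine ⟨X, hX, (2⁻¹ : ℂ) • (A + star A), ?_, ?_⟩
  · rw [isSelfAdjoint_iff, star_smul, (IsSelfAdjoint.add_star_self A).star_eq]
    simp
  · rw [map_smul, map_add, map_star, hs.star_eq]
    module

/-- The resolvents of local observables are local with the same support. -/
theorem exists_local_resolvent {S : Set Site} {O : quasiLocal ι} (hO : O ∈ localOn ι S)
    (hs : IsSelfAdjoint O) : ∃ R ∈ localOn ι S, (1 + O * O) * R = 1 := by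
  obtain ⟨X, hX, A, hA, rfl⟩ := exists_selfAdjoint_incl hO hs
  obtain ⟨R, -, hR⟩ := exists_resolvent hA
  refine ⟨incl X R, incl_mem_localOn hX R, ?_⟩
  rw [← map_mul, ← map_one (incl X), ← map_add, ← map_mul, hR]

theorem dense_localOn_univ : Dense (localOn ι Set.univ : Set (quasiLocal ι)) := by
  have hle : localAlgebra ι ≤ (localOn ι Set.univ).map (quasiLocal ι).subtype := by
    refine iSup_le fun X => ?_
    rintro _ ⟨A, rfl⟩
    exact ⟨incl X A, incl_mem_localOn (Set.subset_univ _) A, rfl⟩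
  intro O
  rw [Metric.mem_closure_iff]
  intro ε hε
  have hO : (O : BigOp ι) ∈ closure (localAlgebra ι : Set (BigOp ι)) := by
    rw [← StarSubalgebra.topologicalClosure_coe]; exact O.2
  obtain ⟨b, hb, hd⟩ := Metric.mem_closure_iff.1 hO ε hε
  obtain ⟨b', hb', rfl⟩ := hle hb
  exact ⟨b', hb', hd⟩

end Inclusion

/-! ### Rank-one operators -/

section KetBra

variable {α : Type*}

/-- The operator `|u⟩⟨v|` on `ℓ²(α)`. -/
noncomputable def ketbra (u v : L2 α) : L2 α →L[ℂ] L2 α := InnerProductSpace.rankOne ℂ u v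

theorem ketbra_apply (u v w : L2 α) : ketbra u v w = ⟪v, w⟫_ℂ • u := rfl

theorem star_ketbra (u v : L2 α) : star (ketbra u v) = ketbra v u := by
  rw [ContinuousLinearMap.star_eq_adjoint, ketbra, InnerProductSpace.adjoint_rankOne, ketbra]

theorem ketbra_mul_ketbra (x u v y : L2 α) :
    ketbra x u * ketbra v y = ⟪u, v⟫_ℂ • ketbra x y := by
  ext1 w
  simp only [mul_apply_eq_comp, ketbra_apply, smul_apply, inner_smul_right, smul_smul, mul_comm]

theorem mul_ketbra (A : L2 α →L[ℂ] L2 α) (u v : L2 α) : A * ketbra u v = ketbra (A u) v := by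
  ext1 w
  simp only [mul_apply_eq_comp, ketbra_apply, map_smul]

theorem ketbra_mul (A : L2 α →L[ℂ] L2 α) (u v : L2 α) :
    ketbra u v * A = ketbra u (star A v) := by
  ext1 w
  simp only [mul_apply_eq_comp, ketbra_apply, inner_star_left]

open scoped Classical in
/-- The basis vector `e_s` of `ℓ²(α)`. -/
noncomputable def bv (s : α) : L2 α := lp.single 2 s 1

theorem inner_bv_bv_self (s : α) : ⟪bv s, bv s⟫_ℂ = 1 := by
  classical
  rw [inner_self_eq_norm_sq_to_K, bv, lp.norm_single (by norm_num)]
  simp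

theorem inner_bv (s : α) (v : L2 α) : ⟪bv s, v⟫_ℂ = v s := by
  classical
  rw [bv, lp.inner_single_left]
  simp

theorem ketbra_bv_apply (s : α) (v : L2 α) : ketbra (bv s) (bv s) v = v s • bv s := by
  rw [ketbra_apply, inner_bv]

/-- The projection onto the span of finitely many basis vectors. -/
noncomputable def finProj (F : Finset α) : L2 α →L[ℂ] L2 α := ∑ s ∈ F, ketbra (bv s) (bv s)

theorem finProj_apply (F : Finset α) (v : L2 α) : finProj F v = ∑ s ∈ F, v s • bv s := by
  rw [finProj, sum_apply]
  exact Finset.sum_congr rfl fun s _ => ketbra_bv_apply s v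

theorem tendsto_finProj (v : L2 α) : Tendsto (fun F => finProj F v) atTop (𝓝 v) := by
  classical
  have h := lp.hasSum_single (p := 2) (by norm_num) v
  refine Tendsto.congr (fun F => ?_) h
  rw [finProj_apply]
  refine Finset.sum_congr rfl fun s _ => ?_
  rw [bv, ← lp.single_smul, smul_eq_mul, mul_one]

theorem norm_finProj_le (F : Finset α) : ‖finProj F‖ ≤ 1 := by
  classical
  refine ContinuousLinearMap.opNorm_le_bound _ zero_le_one fun v => ?_
  rw [one_mul]
  refine (sq_le_sq₀ (norm_nonneg _) (norm_nonneg _)).1 ?_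
  have h1 := lp.norm_sum_single (E := fun _ : α => ℂ) (p := 2) (by norm_num) v F
  have h2 := lp.sum_rpow_le_norm_rpow (p := 2) (by norm_num) v F
  have h3 : finProj F v = ∑ s ∈ F, lp.single 2 s (v s) := by
    rw [finProj_apply]
    refine Finset.sum_congr rfl fun s _ => ?_
    rw [bv, ← lp.single_smul, smul_eq_mul, mul_one]
  rw [h3]
  rw [← h1] at h2
  simpa using h2

theorem amp_finProj_tendsto {β γ : Type*} (e : γ ≃ α × β) (u : L2 γ) :
    Tendsto (fun F => amp e (finProj F) u) atTop (𝓝 u) := by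
  rw [tendsto_iff_norm_sub_tendsto_zero]
  have h1 : Tendsto (fun F : Finset α => ∑' b, ‖slice e b (amp e (finProj F) u - u)‖ ^ 2) atTop
      (𝓝 (∑' _ : β, (0 : ℝ))) := by
    have hs : ∀ F b, slice e b (amp e (finProj F) u - u) =
        finProj F (slice e b u) - slice e b u := fun F b => by
      rw [← slice_amp]
      ext a; simp [slice_apply]
    refine tendsto_tsum_of_dominated_convergence (bound := fun b => (2 * ‖slice e b u‖) ^ 2) ?_
      (fun b => ?_) (Eventually.of_forall fun F b => ?_)
    · simp_rw [mul_pow]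
      exact (hasSum_slice e u).summable.mul_left _
    · simp_rw [hs]
      have := (tendsto_finProj (slice e b u)).sub_const (slice e b u)
      rw [sub_self] at this
      simpa using this.norm.pow 2
    · rw [hs, Real.norm_of_nonneg (by positivity)]
      refine pow_le_pow_left₀ (norm_nonneg _) ?_ 2
      refine (norm_sub_le _ _).trans ?_
      have := (finProj F).le_of_opNorm_le (norm_finProj_le F) (slice e b u)
      linarith
  rw [tsum_zero] at h1
  have h2 : ∀ F : Finset α, ∑' b, ‖slice e b (amp e (finProj F) u - u)‖ ^ 2 =
      ‖amp e (finProj F) u - u‖ ^ 2 := fun F => (hasSum_slice e _).tsum_eq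
  simp_rw [h2] at h1
  have h3 := h1.sqrt
  simpa using h3

end KetBra

/-! ### Extreme points and irreducibility -/

/-- If `ω` is an extreme point of a set containing `(ω ± φ / 2) / (1 ± t / 2)`, then `φ = t ω`. -/
theorem eq_mul_of_mem_extremePoints {V : Type*} [AddCommGroup V] [Module ℂ V]
    {S : Set (V →ₗ[ℂ] ℂ)} {ω φ : V →ₗ[ℂ] ℂ} (hω : ω ∈ Set.extremePoints ℝ S) {t : ℝ}
    (ht1 : |t| ≤ 1) (hstate : ∀ s : ℝ, |s| = 1 / 2 →
      ((1 + s * t : ℝ) : ℂ)⁻¹ • (ω + (s : ℂ) • φ) ∈ S) (a : V) :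
    φ a = (t : ℂ) * ω a := by
  have hp1 : 0 < 1 + 1 / 2 * t := by linarith [(abs_le.1 ht1).1]
  have hp2 : 0 < 1 + -(1 / 2) * t := by linarith [(abs_le.1 ht1).2]
  have hhalf : ∀ x : ℝ, 0 < x → ∀ z : ℂ, ((x / 2 : ℝ) : ℂ) * ((x : ℂ)⁻¹ * z) = z / 2 := by
    intro x hx z
    have : (x : ℂ) ≠ 0 := by exact_mod_cast hx.ne'
    push_cast
    field_simp
  have hmem : ω ∈ openSegment ℝ (((1 + 1 / 2 * t : ℝ) : ℂ)⁻¹ • (ω + ((1 / 2 : ℝ) : ℂ) • φ))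
      (((1 + -(1 / 2) * t : ℝ) : ℂ)⁻¹ • (ω + ((-(1 / 2) : ℝ) : ℂ) • φ)) := by
    refine ⟨(1 + 1 / 2 * t) / 2, (1 + -(1 / 2) * t) / 2, half_pos hp1, half_pos hp2, by ring, ?_⟩
    ext a
    rw [LinearMap.add_apply, LinearMap.smul_apply, LinearMap.smul_apply, LinearMap.smul_apply,
      LinearMap.smul_apply, Complex.real_smul, Complex.real_smul, smul_eq_mul, smul_eq_mul,
      hhalf _ hp1, hhalf _ hp2, LinearMap.add_apply, LinearMap.add_apply, LinearMap.smul_apply,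
      LinearMap.smul_apply, smul_eq_mul, smul_eq_mul]
    push_cast
    ring
  have heq := hω.2 (hstate (1 / 2) (by norm_num [abs_of_pos]))
    (hstate (-(1 / 2)) (by norm_num [abs_of_pos])) hmem
  have h1 := LinearMap.congr_fun heq a
  have n1 : ((1 + 1 / 2 * t : ℝ) : ℂ) ≠ 0 := by exact_mod_cast hp1.ne'
  rw [LinearMap.smul_apply, LinearMap.add_apply, LinearMap.smul_apply, smul_eq_mul, smul_eq_mul,
    inv_mul_eq_iff_eq_mul₀ n1] at h1
  push_cast at h1
  linear_combination 2 * h1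

/-- The GNS representation of an extreme point of the set of states has a trivial commutant: an
operator `T` of the commutant defines the functional `a ↦ ⟪ψ, π a T ψ⟫`, which is dominated by a
multiple of `ω`. -/
theorem commutant_trivial_of_extreme {A : Type*} [Ring A] [StarRing A] [Algebra ℂ A]
    {H : Type*} [NormedAddCommGroup H] [InnerProductSpace ℂ H] [CompleteSpace H]
    {π : A →⋆ₐ[ℂ] (H →L[ℂ] H)} {ω : A →ₗ[ℂ] ℂ} {ψ : H} (hd : Dense (Set.range fun a => π a ψ))
    (hr : ∀ a, ω a = ⟪ψ, π a ψ⟫_ℂ) (hψ : ‖ψ‖ = 1)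
    (hω : ω ∈ Set.extremePoints ℝ {φ : A →ₗ[ℂ] ℂ |
      φ 1 = 1 ∧ ∀ a, 0 ≤ (φ (star a * a)).re ∧ (φ (star a * a)).im = 0}) {T : H →L[ℂ] H}
    (hT : ∀ a, π a * T = T * π a) : ∃ c : ℂ, T = c • 1 := by
  have hst' := hω.1
  -- a positive operator in the commutant strictly between `0` and `1` is a scalar
  have hpos : ∀ T : H →L[ℂ] H, (∀ a, π a * T = T * π a) → IsSelfAdjoint T → ‖T‖ ≤ 1 →
      ∃ c : ℂ, T = c • 1 := by
    intro T hT hs hn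
    have hTv : ∀ a v, π a (T v) = T (π a v) := fun a v =>
      congrArg (fun Q : H →L[ℂ] H => Q v) (hT a)
    have hreal : ∀ v, (⟪v, T v⟫_ℂ).im = 0 := fun v => by
      have := inner_conj_symm (𝕜 := ℂ) v (T v)
      rw [inner_apply_of_selfAdjoint hs] at this
      exact Complex.conj_eq_iff_im.1 this
    have hTb : ∀ v, |(⟪v, T v⟫_ℂ).re| ≤ ‖v‖ ^ 2 := fun v => by
      refine (Complex.abs_re_le_norm _).trans ((norm_inner_le_norm _ _).trans ?_)
      rw [sq]
      exact mul_le_mul_of_nonneg_left (by simpa using T.le_of_opNorm_le hn v) (norm_nonneg _)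
    set t : ℝ := (⟪ψ, T ψ⟫_ℂ).re with ht
    have ht1 : |t| ≤ 1 := by simpa [hψ] using hTb ψ
    have htC : ⟪ψ, T ψ⟫_ℂ = (t : ℂ) := by
      apply Complex.ext
      · simp [ht]
      · simp [hreal]
    let ωT : A →ₗ[ℂ] ℂ :=
      { toFun := fun a => ⟪ψ, π a (T ψ)⟫_ℂ
        map_add' := fun a b => by rw [map_add, add_apply, inner_add_right]
        map_smul' := fun c a => by rw [map_smul, smul_apply, inner_smul_right]; rfl }
    have hωT : ∀ a, ωT a = ⟪ψ, π a (T ψ)⟫_ℂ := fun a => rfl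
    have hωsq : ∀ a, ω (star a * a) = (‖π a ψ‖ ^ 2 : ℝ) := fun a => by
      rw [hr, map_mul, mul_apply_eq_comp, map_star, inner_star_right, inner_self_eq_norm_sq_to_K]
      norm_cast
    have hωTsq : ∀ a, ωT (star a * a) = ((⟪π a ψ, T (π a ψ)⟫_ℂ).re : ℝ) := fun a => by
      rw [hωT, map_mul, mul_apply_eq_comp, map_star, inner_star_right, hTv]
      apply Complex.ext
      · simp
      · simp [hreal]
    -- the states `(ω ± ωT / 2) / (1 ± t / 2)`
    have hstate : ∀ s : ℝ, |s| = 1 / 2 →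
        ((1 + s * t : ℝ) : ℂ)⁻¹ • (ω + (s : ℂ) • ωT) ∈ {φ : A →ₗ[ℂ] ℂ |
          φ 1 = 1 ∧ ∀ a, 0 ≤ (φ (star a * a)).re ∧ (φ (star a * a)).im = 0} := by
      intro s hs
      have hp : 0 < 1 + s * t := by
        have : |s * t| ≤ 1 / 2 := by rw [abs_mul, hs]; linarith
        linarith [(abs_le.1 this).1]
      constructor
      · rw [LinearMap.smul_apply, LinearMap.add_apply, LinearMap.smul_apply, hst'.1, hωT, map_one,
          one_apply_eq_self, htC, smul_eq_mul, smul_eq_mul]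
        have : ((1 + s * t : ℝ) : ℂ) ≠ 0 := by exact_mod_cast hp.ne'
        push_cast at this ⊢
        exact inv_mul_cancel₀ this
      · intro a
        have e : (((1 + s * t : ℝ) : ℂ)⁻¹ • (ω + (s : ℂ) • ωT)) (star a * a) =
            (((1 + s * t)⁻¹ * (‖π a ψ‖ ^ 2 + s * (⟪π a ψ, T (π a ψ)⟫_ℂ).re) : ℝ) : ℂ) := by
          rw [LinearMap.smul_apply, LinearMap.add_apply, LinearMap.smul_apply, hωsq, hωTsq,
            smul_eq_mul, smul_eq_mul]
          push_cast
          ring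
        rw [e]
        refine ⟨?_, Complex.ofReal_im _⟩
        rw [Complex.ofReal_re]
        have h1 : |s * (⟪π a ψ, T (π a ψ)⟫_ℂ).re| ≤ ‖π a ψ‖ ^ 2 := by
          rw [abs_mul, hs]
          have := hTb (π a ψ)
          linarith [abs_nonneg (⟪π a ψ, T (π a ψ)⟫_ℂ).re]
        have h2 := (abs_le.1 h1).1
        exact mul_nonneg (inv_nonneg.2 hp.le) (by linarith)
    have hTω := eq_mul_of_mem_extremePoints hω ht1 hstate
    refine ⟨t, ?_⟩
    -- `T` and `t` have the same matrix elements between vectors of a dense set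
    have hz : ∀ a, T (π a ψ) = (t : ℂ) • π a ψ := by
      intro a
      rw [← sub_eq_zero]
      refine Dense.eq_zero_of_inner_right (𝕜 := ℂ) hd ?_
      rintro _ ⟨b, rfl⟩
      have := hTω (star b * a)
      rw [hωT, hr, map_mul, mul_apply_eq_comp, mul_apply_eq_comp, map_star, inner_star_right,
        inner_star_right, hTv] at this
      rw [inner_sub_right, inner_smul_right, this, sub_self]
    refine ContinuousLinearMap.ext fun v => ?_
    have hcl : IsClosed {v | T v = ((t : ℂ) • (1 : H →L[ℂ] H)) v} :=
      isClosed_eq T.continuous ((t : ℂ) • (1 : H →L[ℂ] H)).continuous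
    refine hcl.closure_subset_iff.2 ?_ (hd v)
    rintro _ ⟨a, rfl⟩
    exact hz a
  have hsa : ∀ T : H →L[ℂ] H, (∀ a, π a * T = T * π a) → IsSelfAdjoint T →
      ∃ c : ℂ, T = c • 1 := by
    intro T hT hs
    rcases eq_or_ne T 0 with rfl | h0
    · exact ⟨0, by simp⟩
    have hn : ‖T‖ ≠ 0 := norm_ne_zero_iff.2 h0
    obtain ⟨c, hc⟩ := hpos (((‖T‖⁻¹ : ℝ) : ℂ) • T)
      (fun a => by rw [mul_smul_comm, smul_mul_assoc, hT])
      (by rw [isSelfAdjoint_iff, star_smul, hs.star_eq]; simp)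
      (by rw [norm_smul, Complex.norm_real, norm_inv, norm_norm, inv_mul_cancel₀ hn])
    refine ⟨(‖T‖ : ℂ) * c, ?_⟩
    rw [← smul_smul, ← hc, smul_smul]
    push_cast
    rw [mul_inv_cancel₀ (by exact_mod_cast hn), one_smul]
  have hTs : ∀ a, π a * star T = star T * π a := fun a => by
    have := congrArg star (hT (star a))
    rw [star_mul, star_mul, ← map_star, star_star] at this
    exact this.symm
  obtain ⟨c₁, h1⟩ := hsa (T + star T) (fun a => by rw [mul_add, add_mul, hT, hTs])
    (IsSelfAdjoint.add_star_self T)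
  obtain ⟨c₂, h2⟩ := hsa (Complex.I • (T - star T))
    (fun a => by rw [mul_smul_comm, smul_mul_assoc, mul_sub, sub_mul, hT, hTs]) (by
      rw [isSelfAdjoint_iff, star_smul, star_sub, star_star, RCLike.star_def, Complex.conj_I]
      module)
  refine ⟨(2⁻¹ : ℂ) * (c₁ - Complex.I * c₂), ?_⟩
  have e : T = (2⁻¹ : ℂ) • ((T + star T) - Complex.I • (Complex.I • (T - star T))) := by
    rw [smul_smul, Complex.I_mul_I]
    module
  rw [e, h1, h2]
  module

/-! ### GNS representations of locally normal pure states -/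

section Rep

variable {ι : Type*} {H : Type*} [NormedAddCommGroup H] [InnerProductSpace ℂ H] [CompleteSpace H]
  {π : quasiLocal ι →⋆ₐ[ℂ] (H →L[ℂ] H)} {ω : quasiLocal ι →ₗ[ℂ] ℂ} {ψ : H}

theorem norm_rep_le (π : quasiLocal ι →⋆ₐ[ℂ] (H →L[ℂ] H)) (a : quasiLocal ι) : ‖π a‖ ≤ ‖a‖ :=
  NonUnitalStarAlgHom.norm_apply_le π a

theorem continuous_rep (π : quasiLocal ι →⋆ₐ[ℂ] (H →L[ℂ] H)) : Continuous π :=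
  AddMonoidHomClass.continuous_of_bound π 1 fun a => by simpa using norm_rep_le π a

theorem IsGNSTriple.norm_eq_one (h : IsGNSTriple π ψ ω) (hω : IsState ω) : ‖ψ‖ = 1 := by
  have h1 := h.2 1
  rw [hω.1, map_one, one_apply_eq_self, inner_self_eq_norm_sq_to_K] at h1
  have : ‖ψ‖ ^ 2 = 1 := Complex.ofReal_injective (by push_cast; exact h1.symm)
  nlinarith [norm_nonneg ψ]

/-- Local observables applied to the cyclic vector form a dense set. -/
theorem IsGNSTriple.exists_local_approx (h : IsGNSTriple π ψ ω) (ξ : H) {ε : ℝ} (hε : 0 < ε) :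
    ∃ a ∈ localOn ι Set.univ, ‖ξ - π a ψ‖ < ε := by
  obtain ⟨_, ⟨a, rfl⟩, ha⟩ := Metric.mem_closure_iff.1 (h.1 ξ) (ε / 2) (by positivity)
  obtain ⟨b, hb, hab⟩ := Metric.mem_closure_iff.1 (dense_localOn_univ a) (ε / (2 * (‖ψ‖ + 1)))
    (by positivity)
  refine ⟨b, hb, ?_⟩
  have e1 : ξ - π b ψ = (ξ - π a ψ) + π (a - b) ψ := by simp
  rw [e1]
  refine (norm_add_le _ _).trans_lt ?_
  rw [dist_eq_norm] at ha hab
  have h2 : ‖π (a - b) ψ‖ ≤ ‖a - b‖ * ‖ψ‖ := (π (a - b)).le_of_opNorm_le (norm_rep_le π _) ψ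
  have h3 : ‖a - b‖ * ‖ψ‖ ≤ ε / 2 := by
    have : ε / (2 * (‖ψ‖ + 1)) * (‖ψ‖ + 1) = ε / 2 := by field_simp
    nlinarith [norm_nonneg ψ, norm_nonneg (a - b)]
  linarith

/-- The representation of a pure state is irreducible: its commutant is trivial. -/
theorem IsGNSTriple.commutant_trivial (h : IsGNSTriple π ψ ω) (hω : IsPureState ω) {T : H →L[ℂ] H}
    (hT : ∀ a, π a * T = T * π a) : ∃ c : ℂ, T = c • 1 :=
  commutant_trivial_of_extreme h.1 h.2 (h.norm_eq_one hω.1) hω hT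

end Rep

/-! ### Locally normal irreducible representations -/

section LocalRep

variable {ι : Type*} {H : Type*} [NormedAddCommGroup H] [InnerProductSpace ℂ H] [CompleteSpace H]
  (π : quasiLocal ι →⋆ₐ[ℂ] (H →L[ℂ] H))

/-- The representation of the observables of the finite set `X` of sites. -/
noncomputable def localRep (X : Finset Site) : LocalOp ι X →⋆ₐ[ℂ] (H →L[ℂ] H) := π.comp (incl X)

theorem localRep_apply (X : Finset Site) (A : LocalOp ι X) : localRep π X A = π (incl X A) := rfl

theorem norm_localRep_le (X : Finset Site) (A : LocalOp ι X) : ‖localRep π X A‖ ≤ ‖A‖ :=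
  NonUnitalStarAlgHom.norm_apply_le (localRep π X) A

theorem localRep_left {X Y : Finset Site} (h : Disjoint X Y) (A : LocalOp ι X) :
    localRep π X A = localRep π (X ∪ Y) (amp (pairEquiv ι h) A) :=
  congrArg π (incl_left h A)

theorem localRep_right {X Y : Finset Site} (h : Disjoint X Y) (B : LocalOp ι Y) :
    localRep π Y B = localRep π (X ∪ Y) (amp ((pairEquiv ι h).trans (Equiv.prodComm _ _)) B) :=
  congrArg π (incl_right h B)

theorem localRep_commute {X Y : Finset Site} (h : Disjoint X Y) (A : LocalOp ι X)
    (B : LocalOp ι Y) : localRep π X A * localRep π Y B = localRep π Y B * localRep π X A := by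
  rw [localRep_left π h, localRep_right π h, ← map_mul, ← map_mul, amp_commute]

/-- A representation is locally normal if the projections onto the vectors of an orthonormal basis
of each local space sum to `1`. -/
def IsNormalRep : Prop :=
  ∀ (X : Finset Site) (ξ : H),
    HasSum (fun s : X → ι => localRep π X (ketbra (bv s) (bv s)) ξ) ξ

/-- A representation is irreducible if its commutant is trivial. -/
def IsIrred : Prop :=
  ∀ T : H →L[ℂ] H, (∀ a, π a * T = T * π a) → ∃ c : ℂ, T = c • 1

variable {π} {ω : quasiLocal ι →ₗ[ℂ] ℂ} {ψ : H}

theorem IsGNSTriple.isIrred (h : IsGNSTriple π ψ ω) (hω : IsPureState ω) : IsIrred π :=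
  fun _ hT => h.commutant_trivial hω hT

theorem IsGNSTriple.apply_incl (h : IsGNSTriple π ψ ω) (X : Finset Site) (A : LocalOp ι X) :
    ω (incl X A) = ⟪ψ, localRep π X A ψ⟫_ℂ := h.2 _

/-- For a state with density matrix `∑ₙ |vₙ⟩⟨vₙ|`, the norm of `A ψ` is the Hilbert-Schmidt norm of
`A √ρ`. -/
theorem IsGNSTriple.hasSum_norm_sq (h : IsGNSTriple π ψ ω) {X : Finset Site}
    {v : ℕ → LocalSpace ι X} (hv : HasDensity ω X v) (A : LocalOp ι X) :
    HasSum (fun n => ‖A (v n)‖ ^ 2) (‖localRep π X A ψ‖ ^ 2) := by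
  have h1 := hv (star A * A)
  rw [h.apply_incl, map_mul, mul_apply_eq_comp, map_star, inner_star_right] at h1
  have h2 := Complex.hasSum_re h1
  rw [← RCLike.re_eq_complex_re, inner_self_eq_norm_sq] at h2
  refine h2.congr_fun fun n => ?_
  rw [mul_apply_eq_comp, inner_star_right, inner_self_eq_norm_sq]

/-- A local observable is supported in the union of `X` and a disjoint finite set. -/
theorem exists_disjoint_union {X Y : Finset Site} (A : LocalOp ι Y) :
    ∃ Z, Disjoint X Z ∧ ∃ B : LocalOp ι (X ∪ Z), incl Y A = incl (X ∪ Z) B := by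
  refine ⟨Y \ X, Finset.disjoint_sdiff, exists_incl_eq ?_ A⟩
  rw [Finset.union_sdiff_self_eq_union]
  exact Finset.subset_union_right

/-- The GNS representation of a locally normal state is locally normal. -/
theorem IsGNSTriple.isNormalRep (h : IsGNSTriple π ψ ω) (hn : IsLocallyNormal ω) :
    IsNormalRep π := by
  intro X ξ
  have hP : ∀ (F : Finset (X → ι)) (η : H),
      ∑ s ∈ F, localRep π X (ketbra (bv s) (bv s)) η = localRep π X (finProj F) η := fun F η => by
    rw [finProj, map_sum, sum_apply]
  have hPle : ∀ (F : Finset (X → ι)) (η : H), ‖localRep π X (finProj F) η‖ ≤ ‖η‖ := fun F η => by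
    simpa using (localRep π X (finProj F)).le_of_opNorm_le
      ((norm_localRep_le π X _).trans (norm_finProj_le F)) η
  -- the convergence on the dense set of vectors `π a ψ`, `a` local, by dominated convergence in the
  -- density matrix
  have hloc : ∀ a ∈ localOn ι Set.univ,
      Tendsto (fun F => localRep π X (finProj F) (π a ψ)) atTop (𝓝 (π a ψ)) := by
    rintro _ ⟨Y, -, A', rfl⟩
    obtain ⟨Z, hZ, A, hA⟩ := exists_disjoint_union (X := X) A'
    rw [hA, ← localRep_apply]
    obtain ⟨v, hv⟩ := hn (X ∪ Z)
    have e1 : ∀ F, localRep π X (finProj F) (localRep π (X ∪ Z) A ψ) - localRep π (X ∪ Z) A ψ =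
        localRep π (X ∪ Z) ((amp (pairEquiv ι hZ) (finProj F)) * A - A) ψ := fun F => by
      rw [localRep_left π hZ, map_sub, map_mul, sub_apply, mul_apply_eq_comp]
    rw [tendsto_iff_norm_sub_tendsto_zero]
    simp_rw [e1]
    have h2 : ∀ F, ‖localRep π (X ∪ Z) ((amp (pairEquiv ι hZ) (finProj F)) * A - A) ψ‖ ^ 2 =
        ∑' n, ‖amp (pairEquiv ι hZ) (finProj F) (A (v n)) - A (v n)‖ ^ 2 := fun F =>
      (h.hasSum_norm_sq hv _).tsum_eq.symm
    have h3 : Tendsto (fun F => ∑' n, ‖amp (pairEquiv ι hZ) (finProj F) (A (v n)) - A (v n)‖ ^ 2)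
        atTop (𝓝 (∑' _ : ℕ, (0 : ℝ))) := by
      refine tendsto_tsum_of_dominated_convergence (bound := fun n => (2 * ‖A (v n)‖) ^ 2) ?_
        (fun n => ?_) (Eventually.of_forall fun F n => ?_)
      · simp_rw [mul_pow]
        exact (h.hasSum_norm_sq hv A).summable.mul_left _
      · have := (amp_finProj_tendsto (pairEquiv ι hZ) (A (v n))).sub_const (A (v n))
        rw [sub_self] at this
        simpa using this.norm.pow 2
      · rw [Real.norm_of_nonneg (by positivity)]
        refine pow_le_pow_left₀ (norm_nonneg _) ?_ 2
        refine (norm_sub_le _ _).trans ?_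
        have h4 := (norm_ampFun_le (pairEquiv ι hZ) (finProj F) (A (v n))).trans
          (mul_le_mul_of_nonneg_right (norm_finProj_le F) (norm_nonneg _))
        have h5 : ‖amp (pairEquiv ι hZ) (finProj F) (A (v n))‖ ≤ 1 * ‖A (v n)‖ := h4
        linarith
    simp_rw [← h2, tsum_zero] at h3
    simpa using h3.sqrt
  change Tendsto (fun F => ∑ s ∈ F, localRep π X (ketbra (bv s) (bv s)) ξ) atTop (𝓝 ξ)
  simp_rw [hP]
  rw [Metric.tendsto_nhds]
  intro ε hε
  obtain ⟨a, ha, hξ⟩ := h.exists_local_approx ξ (ε := ε / 3) (by positivity)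
  filter_upwards [Metric.tendsto_nhds.1 (hloc a ha) (ε / 3) (by positivity)] with F hF
  rw [dist_eq_norm] at hF ⊢
  have e2 : localRep π X (finProj F) ξ - ξ = localRep π X (finProj F) (ξ - π a ψ) +
      (localRep π X (finProj F) (π a ψ) - π a ψ) - (ξ - π a ψ) := by
    rw [map_sub]; abel
  rw [e2]
  have h3 := norm_sub_le (localRep π X (finProj F) (ξ - π a ψ) +
      (localRep π X (finProj F) (π a ψ) - π a ψ)) (ξ - π a ψ)
  have h4 := norm_add_le (localRep π X (finProj F) (ξ - π a ψ))
      (localRep π X (finProj F) (π a ψ) - π a ψ)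
  linarith [hPle F (ξ - π a ψ)]

/-- In an irreducible representation every operator is a strong limit of local observables. -/
theorem IsIrred.exists_local_approx (hi : IsIrred π) (B : H →L[ℂ] H) {τ : Type*} [Finite τ]
    (ξ : τ → H) {ε : ℝ} (hε : 0 < ε) :
    ∃ a ∈ localOn ι Set.univ, ∀ i, ‖B (ξ i) - π a (ξ i)‖ < ε := by
  have hB : B ∈ commutant (commutant ((localOn ι Set.univ).map π)) := by
    rw [mem_commutant]
    intro T hT
    rw [mem_commutant] at hT
    obtain ⟨c, rfl⟩ := hi T fun a => by
      have hcl : IsClosed {a | π a * T = T * π a} :=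
        isClosed_eq ((continuous_rep π).mul continuous_const)
          (continuous_const.mul (continuous_rep π))
      exact hcl.closure_subset_iff.2 (fun a ha => hT _ ⟨a, ha, rfl⟩) (dense_localOn_univ a)
    simp
  obtain ⟨_, ⟨a, ha, rfl⟩, h⟩ := exists_approx_of_mem_bicommutant hB ξ hε
  exact ⟨a, ha, h⟩

end LocalRep

/-! ### Haag duality for finite sets of sites -/

section Haag

variable {ι : Type*} {H : Type*} [NormedAddCommGroup H] [InnerProductSpace ℂ H] [CompleteSpace H]
  {π : quasiLocal ι →⋆ₐ[ℂ] (H →L[ℂ] H)}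

theorem add_ketbra {α : Type*} (u v w : L2 α) : ketbra (u + v) w = ketbra u w + ketbra v w := by
  simp [ketbra]

theorem smul_ketbra {α : Type*} (c : ℂ) (u w : L2 α) : ketbra (c • u) w = c • ketbra u w := by
  simp [ketbra]

theorem IsNormalRep.eq_zero (hn : IsNormalRep π) (X : Finset Site) {ξ : H}
    (h : ∀ s : X → ι, localRep π X (ketbra (bv s) (bv s)) ξ = 0) : ξ = 0 := by
  have h1 := hn X ξ
  simp_rw [h] at h1
  exact h1.unique hasSum_zero

theorem inner_localRep_ketbra (π : quasiLocal ι →⋆ₐ[ℂ] (H →L[ℂ] H)) (X : Finset Site)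
    (u w e : LocalSpace ι X) (ξ η : H) :
    ⟪localRep π X (ketbra u e) ξ, localRep π X (ketbra w e) η⟫_ℂ =
      ⟪u, w⟫_ℂ * ⟪ξ, localRep π X (ketbra e e) η⟫_ℂ := by
  rw [← inner_star_right, ← map_star, ← mul_apply_eq_comp, ← map_mul, star_ketbra,
    ketbra_mul_ketbra, map_smul, smul_apply, inner_smul_right]

/-- The vectors of a locally normal representation on which the observables of `X` act as in the
local space: an isometric copy of the local space. -/
theorem IsNormalRep.exists_isometry [Nontrivial H] (hn : IsNormalRep π) (X : Finset Site) :
    ∃ (s₀ : X → ι) (f : H) (J : LocalSpace ι X →ₗᵢ[ℂ] H), ‖f‖ = 1 ∧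
      localRep π X (ketbra (bv s₀) (bv s₀)) f = f ∧
      ∀ v, J v = localRep π X (ketbra v (bv s₀)) f := by
  obtain ⟨ξ, hξ⟩ := exists_ne (0 : H)
  obtain ⟨s₀, hs₀⟩ : ∃ s, localRep π X (ketbra (bv s) (bv s)) ξ ≠ 0 := by
    by_contra! h
    exact hξ (hn.eq_zero X h)
  set f₀ := localRep π X (ketbra (bv s₀) (bv s₀)) ξ with hf₀
  have hne : ‖f₀‖ ≠ 0 := norm_ne_zero_iff.2 hs₀
  set f : H := ((‖f₀‖⁻¹ : ℝ) : ℂ) • f₀ with hf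
  have hf1 : ‖f‖ = 1 := by
    rw [hf, norm_smul, Complex.norm_real, norm_inv, norm_norm, inv_mul_cancel₀ hne]
  have hff : localRep π X (ketbra (bv s₀) (bv s₀)) f = f := by
    rw [hf, map_smul, hf₀, ← mul_apply_eq_comp, ← map_mul, ketbra_mul_ketbra, inner_bv_bv_self,
      one_smul]
  clear_value f
  have hadd : ∀ v w, localRep π X (ketbra (v + w) (bv s₀)) f =
      localRep π X (ketbra v (bv s₀)) f + localRep π X (ketbra w (bv s₀)) f := fun v w => by
    rw [add_ketbra, map_add, add_apply]
  have hsmul : ∀ (c : ℂ) v, localRep π X (ketbra (c • v) (bv s₀)) f =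
      c • localRep π X (ketbra v (bv s₀)) f := fun c v => by
    rw [smul_ketbra, map_smul, smul_apply]
  have hnorm : ∀ v, ‖localRep π X (ketbra v (bv s₀)) f‖ = ‖v‖ := fun v => by
    have h1 := inner_localRep_ketbra π X v v (bv s₀) f f
    rw [hff, inner_self_eq_norm_sq_to_K, inner_self_eq_norm_sq_to_K, inner_self_eq_norm_sq_to_K,
      hf1] at h1
    have h2 : ‖localRep π X (ketbra v (bv s₀)) f‖ ^ 2 = ‖v‖ ^ 2 := by
      apply Complex.ofReal_injective
      push_cast
      simpa using h1
    exact (sq_eq_sq₀ (norm_nonneg _) (norm_nonneg _)).1 h2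
  exact ⟨s₀, f, ⟨⟨⟨_, hadd⟩, hsmul⟩, hnorm⟩, hf1, hff, fun v => rfl⟩

/-- A locally normal representation is isometric on local observables. -/
theorem IsNormalRep.norm_localRep [Nontrivial H] (hn : IsNormalRep π) (X : Finset Site)
    (A : LocalOp ι X) : ‖localRep π X A‖ = ‖A‖ := by
  refine le_antisymm (norm_localRep_le π X A) ?_
  obtain ⟨s₀, f, J, -, -, hJ⟩ := hn.exists_isometry X
  refine A.opNorm_le_bound (norm_nonneg _) fun v => ?_
  have h1 : J (A v) = localRep π X A (J v) := by
    rw [hJ, hJ, ← mul_ketbra, map_mul, mul_apply_eq_comp]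
  rw [← J.norm_map (A v), ← J.norm_map v, h1]
  exact ContinuousLinearMap.le_opNorm _ _

/-- The algebra of the observables of `X` is of type I: an operator that commutes with all
observables outside `X` is a scalar between rank-one projections of `X`. -/
theorem IsIrred.ketbra_mul_mul_ketbra [Nontrivial H] (hi : IsIrred π) {X : Finset Site}
    {u : LocalSpace ι X} {f : H} (hf : ‖f‖ = 1) (hff : localRep π X (ketbra u u) f = f)
    (hu : ⟪u, u⟫_ℂ = 1)
    {S : H →L[ℂ] H} (hS : ∀ (Y : Finset Site), Disjoint X Y → ∀ B : LocalOp ι Y,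
      localRep π Y B * S = S * localRep π Y B)
    (h1 : localRep π X (ketbra u u) * S = S) (h2 : S * localRep π X (ketbra u u) = S) :
    S = ⟪f, S f⟫_ℂ • localRep π X (ketbra u u) := by
  set E := localRep π X (ketbra u u) with hE
  have hEE : E * E = E := by
    rw [hE, ← map_mul, ketbra_mul_ketbra, hu, one_smul]
  -- `S` commutes with the compressions of local observables, hence with those of all operators
  have hloc : ∀ a ∈ localOn ι Set.univ, S * (E * π a * E) = (E * π a * E) * S := by
    rintro _ ⟨Y, -, A', rfl⟩
    obtain ⟨Z, hZ, A, hA⟩ := exists_disjoint_union (X := X) A'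
    have h3 : E * π (incl (X ∪ Z) A) * E =
        localRep π Z (sliceOp (pairEquiv ι hZ) u u A) * E := by
      rw [hE, localRep_left π hZ, ← localRep_apply, ← map_mul, ← map_mul, ketbra,
        rankOne_mul_mul_rankOne, map_mul, ← localRep_right π hZ]
    rw [hA, h3, ← mul_assoc, ← hS Z hZ, mul_assoc, h2, mul_assoc, h1]
  have hall : ∀ (B : H →L[ℂ] H) (ξ : H), S (E (B (E ξ))) = E (B (E (S ξ))) := by
    intro B ξ
    rw [← sub_eq_zero, ← norm_le_zero_iff]
    refine le_of_forall_pos_le_add fun ε hε => ?_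
    obtain ⟨a, ha, hB⟩ := hi.exists_local_approx B ![E ξ, E (S ξ)]
      (ε := ε / (‖S * E‖ + ‖E‖ + 1)) (by positivity)
    have hB0 := hB 0
    have hB1 := hB 1
    simp only [Matrix.cons_val_zero, Matrix.cons_val_one] at hB0 hB1
    have e1 : S (E (B (E ξ))) - E (B (E (S ξ))) =
        (S * E) (B (E ξ) - π a (E ξ)) - E (B (E (S ξ)) - π a (E (S ξ))) := by
      have := congrArg (fun Q : H →L[ℂ] H => Q ξ) (hloc a ha)
      simp only [mul_apply_eq_comp] at this
      rw [map_sub, map_sub, mul_apply_eq_comp, mul_apply_eq_comp, this]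
      abel
    rw [e1, zero_add]
    refine (norm_sub_le _ _).trans ?_
    have b0 := (S * E).le_of_opNorm_le le_rfl (B (E ξ) - π a (E ξ))
    have b1 := E.le_of_opNorm_le le_rfl (B (E (S ξ)) - π a (E (S ξ)))
    have b2 : (‖S * E‖ + ‖E‖ + 1) * (ε / (‖S * E‖ + ‖E‖ + 1)) = ε := by
      field_simp
    have b3 : 0 < ε / (‖S * E‖ + ‖E‖ + 1) := by positivity
    nlinarith [norm_nonneg (S * E), norm_nonneg E]
  have hSE : ∀ ξ, E (S ξ) = S ξ := fun ξ => congrArg (fun Q : H →L[ℂ] H => Q ξ) h1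
  have hES : ∀ ξ, S (E ξ) = S ξ := fun ξ => congrArg (fun Q : H →L[ℂ] H => Q ξ) h2
  have hEEv : ∀ ξ, E (E ξ) = E ξ := fun ξ => congrArg (fun Q : H →L[ℂ] H => Q ξ) hEE
  ext1 ξ
  -- the rank-one operator `|E ξ⟩⟨f|`
  have h4 := hall (InnerProductSpace.rankOne ℂ (E ξ) f) f
  rw [hff, hSE, InnerProductSpace.rankOne_apply, InnerProductSpace.rankOne_apply, map_smul,
    map_smul, map_smul, hEEv, hES, inner_self_eq_norm_sq_to_K, hf] at h4
  simpa using h4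

/-- Haag duality for finite sets of sites in an irreducible locally normal representation: an
operator that commutes with the observables outside `X` is an observable of `X`. Its matrix elements
between rank-one operators of `X` are scalars, which are the matrix elements of its compression `g`
to a copy of the local space. -/
theorem exists_localRep_eq_of_commute [Nontrivial H] (hi : IsIrred π) (hn : IsNormalRep π)
    {X : Finset Site} {T : H →L[ℂ] H}
    (hT : ∀ O ∈ localOn ι (X : Set Site)ᶜ, π O * T = T * π O) :
    ∃ g : LocalOp ι X, T = localRep π X g := by
  obtain ⟨s₀, f, J, hf, hff, hJ⟩ := hn.exists_isometry X
  have hTY : ∀ (Y : Finset Site), Disjoint X Y → ∀ B : LocalOp ι Y,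
      localRep π Y B * T = T * localRep π Y B := fun Y hY B =>
    hT _ (incl_mem_localOn (Set.subset_compl_iff_disjoint_left.2 (Finset.disjoint_coe.2 hY)) B)
  set g : LocalOp ι X := J.toContinuousLinearMap.adjoint ∘L T ∘L J.toContinuousLinearMap with hg
  have hgin : ∀ u v, ⟪u, g v⟫_ℂ = ⟪J u, T (J v)⟫_ℂ := fun u v => by
    simp [hg, ContinuousLinearMap.adjoint_inner_right]
  refine ⟨g, ?_⟩
  have key : ∀ u v : LocalSpace ι X,
      localRep π X (ketbra (bv s₀) u) * T * localRep π X (ketbra v (bv s₀)) =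
      localRep π X (ketbra (bv s₀) u) * localRep π X g * localRep π X (ketbra v (bv s₀)) := by
    intro u v
    have e1 := hi.ketbra_mul_mul_ketbra hf hff (inner_bv_bv_self s₀)
      (S := localRep π X (ketbra (bv s₀) u) * T * localRep π X (ketbra v (bv s₀)))
      (fun Y hY B => by
        rw [← mul_assoc, ← mul_assoc, ← localRep_commute π hY, mul_assoc _ _ T, hTY Y hY,
          mul_assoc, mul_assoc, mul_assoc _ _ (localRep π Y B), localRep_commute π hY]
        simp only [mul_assoc])
      (by rw [← mul_assoc, ← mul_assoc, ← map_mul, ketbra_mul_ketbra, inner_bv_bv_self, one_smul])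
      (by rw [mul_assoc, ← map_mul, ketbra_mul_ketbra, inner_bv_bv_self, one_smul])
    rw [e1, mul_apply_eq_comp, mul_apply_eq_comp, ← hJ, ← star_ketbra u, map_star, inner_star_right,
      ← hJ, ← hgin, ← map_star, star_ketbra, ← map_mul, ← map_mul, ketbra_mul, ketbra_mul_ketbra,
      map_smul, inner_star_left]
  -- all matrix blocks of `T - π g` vanish
  set D := T - localRep π X g with hD
  have hDst : ∀ s t (ξ : H),
      localRep π X (ketbra (bv s) (bv s)) (D (localRep π X (ketbra (bv t) (bv t)) ξ)) = 0 := by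
    intro s t ξ
    have e2 : ∀ r : X → ι, ketbra (bv r) (bv r) =
        ketbra (bv r) (bv s₀) * ketbra (bv s₀) (bv r) := fun r => by
      rw [ketbra_mul_ketbra, inner_bv_bv_self, one_smul]
    have e3 : localRep π X (ketbra (bv s₀) (bv s)) * D * localRep π X (ketbra (bv t) (bv s₀)) =
        0 := by
      rw [hD, mul_sub, sub_mul, key, sub_self]
    have e4 := congrArg (fun Q : H →L[ℂ] H => Q (localRep π X (ketbra (bv s₀) (bv t)) ξ)) e3
    simp only [mul_apply_eq_comp, zero_apply] at e4
    rw [e2 s, e2 t, map_mul, map_mul, mul_apply_eq_comp, mul_apply_eq_comp, e4, map_zero]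
  have hDt : ∀ t (ξ : H), D (localRep π X (ketbra (bv t) (bv t)) ξ) = 0 := fun t ξ =>
    hn.eq_zero X fun s => hDst s t ξ
  have hD0 : D = 0 := by
    ext1 ξ
    have := D.hasSum (hn X ξ)
    simp only [hDt] at this
    exact this.unique hasSum_zero
  exact sub_eq_zero.1 hD0

end Haag

/-! ### A local contraction that maps one vector close to the other -/

section Disk

theorem finite_disk (r : ℝ) : (disk r).Finite := by
  have h : disk r ⊆ (Set.Icc (-⌈r⌉) ⌈r⌉) ×ˢ (Set.Icc (-⌈r⌉) ⌈r⌉) := by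
    intro j hj
    have h0 : ‖(⟨j.1, j.2⟩ : ℂ)‖ ≤ r := hj
    have h1 : |(j.1 : ℝ)| ≤ (⌈r⌉ : ℝ) :=
      (Complex.abs_re_le_norm (⟨j.1, j.2⟩ : ℂ)).trans (h0.trans (Int.le_ceil r))
    have h2 : |(j.2 : ℝ)| ≤ (⌈r⌉ : ℝ) :=
      (Complex.abs_im_le_norm (⟨j.1, j.2⟩ : ℂ)).trans (h0.trans (Int.le_ceil r))
    have h3 : |j.1| ≤ ⌈r⌉ := by exact_mod_cast h1
    have h4 : |j.2| ≤ ⌈r⌉ := by exact_mod_cast h2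
    exact ⟨abs_le.1 h3, abs_le.1 h4⟩
  exact ((Set.finite_Icc _ _).prod (Set.finite_Icc _ _)).subset h

/-- The disk of radius `r` as a finite set of sites. -/
noncomputable def diskFinset (r : ℝ) : Finset Site := (finite_disk r).toFinset

theorem coe_diskFinset (r : ℝ) : (diskFinset r : Set Site) = disk r := (finite_disk r).coe_toFinset

theorem disk_mono {r R : ℝ} (h : r ≤ R) : disk r ⊆ disk R := fun _ hj => le_trans hj h

end Disk

/-- The algebras of local observables satisfy the hypothesis on resolvents of Uhlmann's theorem. -/
theorem exists_local_resolvent_map {ι B : Type*} [Ring B] [StarRing B] [Algebra ℂ B]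
    [StarModule ℂ B] (σ : quasiLocal ι →⋆ₐ[ℂ] B) {S : Set Site} :
    ∀ n ∈ (localOn ι S).map σ, IsSelfAdjoint n →
      ∃ m ∈ (localOn ι S).map σ, (1 + n * n) * m = 1 := by
  rintro _ ⟨O, hO, rfl⟩ hs
  change IsSelfAdjoint (σ O) at hs
  have hO' : (2⁻¹ : ℂ) • (O + star O) ∈ localOn ι S :=
    (localOn ι S).smul_mem (add_mem hO (star_mem hO)) _
  have hsa : IsSelfAdjoint ((2⁻¹ : ℂ) • (O + star O)) := by
    rw [isSelfAdjoint_iff, star_smul, (IsSelfAdjoint.add_star_self O).star_eq]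
    simp
  have e : σ ((2⁻¹ : ℂ) • (O + star O)) = σ O := by
    rw [map_smul, map_add, map_star, hs.star_eq]
    module
  obtain ⟨R, hR, h1⟩ := exists_local_resolvent hO' hsa
  refine ⟨σ R, ⟨R, hR, rfl⟩, ?_⟩
  change (1 + σ O * σ O) * σ R = 1
  rw [← e, ← map_mul, ← map_one σ, ← map_add, ← map_mul, h1]

section Transport

variable {ι : Type*} {H : Type*} [NormedAddCommGroup H] [InnerProductSpace ℂ H] [CompleteSpace H]
  {π : quasiLocal ι →⋆ₐ[ℂ] (H →L[ℂ] H)}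

theorem IsNormalRep.norm_le_norm_rep [Nontrivial H] (hn : IsNormalRep π) {S : Set Site}
    {O : quasiLocal ι} (hO : O ∈ localOn ι S) : ‖O‖ ≤ ‖π O‖ := by
  obtain ⟨X, -, A, rfl⟩ := hO
  rw [← localRep_apply, hn.norm_localRep]
  exact norm_incl_le X A

/-- Haag duality for disks. -/
theorem exists_rep_eq_of_commute_disk [Nontrivial H] (hi : IsIrred π) (hn : IsNormalRep π)
    {R : ℝ} {T : H →L[ℂ] H} (hT : T ∈ commutant ((localOn ι (disk R)ᶜ).map π)) :
    ∃ g ∈ localOn ι (disk R), ‖g‖ ≤ ‖T‖ ∧ π g = T := by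
  rw [mem_commutant] at hT
  obtain ⟨g, hg⟩ := exists_localRep_eq_of_commute hi hn (X := diskFinset R) (T := T) fun O hO => by
    rw [coe_diskFinset] at hO
    exact hT _ ⟨O, hO, rfl⟩
  have hmem : incl (diskFinset R) g ∈ localOn ι (disk R) :=
    incl_mem_localOn (coe_diskFinset R).subset g
  refine ⟨incl (diskFinset R) g, hmem, ?_, hg.symm⟩
  rw [hg, localRep_apply]
  exact hn.norm_le_norm_rep hmem

/-- The error `√(4 C exp (-α t))` of the approximations by operators obtained from Uhlmann's
theorem. -/
noncomputable def uhlmannError (C α t : ℝ) : ℝ := √(4 * (C * Real.exp (-(α * t))))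

theorem norm_sub_le_uhlmannError {E : Type*} [NormedAddCommGroup E] [InnerProductSpace ℂ E]
    {u v : E} (hu : ‖u‖ = 1) (hv : ‖v‖ ≤ 1) {C α t : ℝ}
    (h : 1 - 2 * (C * Real.exp (-(α * t))) ≤ (⟪u, v⟫_ℂ).re) : ‖v - u‖ ≤ uhlmannError C α t := by
  refine Real.le_sqrt_of_sq_le ?_
  rw [norm_sub_rev, @norm_sub_sq ℂ, hu, RCLike.re_eq_complex_re]
  nlinarith [norm_nonneg v]

/-- Two vector states that agree near infinity are related by a local contraction, up to a small
error. -/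
theorem exists_local_transport [Nontrivial H] (hi : IsIrred π) (hn : IsNormalRep π) {ψ ψ' : H}
    {ω ω' : quasiLocal ι →ₗ[ℂ] ℂ} (hψ : ‖ψ‖ = 1) (hψ' : ‖ψ'‖ = 1)
    (hω : ∀ a, ω a = ⟪ψ, π a ψ⟫_ℂ) (hω' : ∀ a, ω' a = ⟪ψ', π a ψ'⟫_ℂ) {C α : ℝ} (hC : 0 ≤ C)
    (h : AgreeAtInfinity C α ω ω') {r : ℝ} (hr : 0 < r) :
    ∃ u ∈ localOn ι (disk r), ‖u‖ ≤ 1 ∧ ‖π u ψ - ψ'‖ ≤ uhlmannError C α r := by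
  have hε : 0 ≤ C * Real.exp (-(α * r)) := by positivity
  obtain ⟨x, hx, hx1, hx2⟩ := uhlmann (exists_local_resolvent_map π (S := (disk r)ᶜ)) hε hψ hψ' (by
    rintro _ ⟨O, hO, rfl⟩
    change ‖⟪ψ, π O ψ⟫_ℂ - ⟪ψ', π O ψ'⟫_ℂ‖ ≤ C * Real.exp (-(α * r)) * ‖π O‖
    rw [← hω, ← hω']
    exact (h r hr O hO).trans (mul_le_mul_of_nonneg_left (hn.norm_le_norm_rep hO) hε))
  obtain ⟨u, hu, hu1, rfl⟩ := exists_rep_eq_of_commute_disk hi hn hx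
  refine ⟨u, hu, hu1.trans hx1, norm_sub_le_uhlmannError hψ' ?_ hx2⟩
  simpa [hψ] using (π u).le_of_opNorm_le hx1 ψ

end Transport

/-! ### Purification of the product of the restrictions of a state -/

section Purification

variable {ι : Type*} {H : Type*} [NormedAddCommGroup H] [InnerProductSpace ℂ H] [CompleteSpace H]
  {π : quasiLocal ι →⋆ₐ[ℂ] (H →L[ℂ] H)}

theorem norm_localRep_ketbra (π : quasiLocal ι →⋆ₐ[ℂ] (H →L[ℂ] H)) (X : Finset Site)
    (u e : LocalSpace ι X) (he : ⟪e, e⟫_ℂ = 1) (ξ : H) :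
    ‖localRep π X (ketbra u e) ξ‖ ^ 2 = ‖u‖ ^ 2 * ‖localRep π X (ketbra e e) ξ‖ ^ 2 := by
  have h1 := inner_localRep_ketbra π X u u e ξ ξ
  have h2 := inner_localRep_ketbra π X e e e ξ ξ
  rw [he, one_mul] at h2
  rw [← h2, inner_self_eq_norm_sq_to_K, inner_self_eq_norm_sq_to_K,
    inner_self_eq_norm_sq_to_K] at h1
  apply Complex.ofReal_injective
  push_cast
  exact h1

theorem IsNormalRep.hasSum_norm_sq (hn : IsNormalRep π) (X : Finset Site) (ξ : H) :
    HasSum (fun s : X → ι => ‖localRep π X (ketbra (bv s) (bv s)) ξ‖ ^ 2) (‖ξ‖ ^ 2) := by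
  have h1 := Complex.hasSum_re ((innerSL ℂ ξ).hasSum (hn X ξ))
  simp only [innerSL_apply_apply] at h1
  rw [← RCLike.re_eq_complex_re, inner_self_eq_norm_sq] at h1
  refine h1.congr_fun fun s => ?_
  have h2 := inner_localRep_ketbra π X (bv s) (bv s) (bv s) ξ ξ
  rw [inner_bv_bv_self, one_mul] at h2
  rw [← h2, inner_self_eq_norm_sq]

theorem IsNormalRep.hasSum_prod_norm_sq (hn : IsNormalRep π) {X : Finset Site}
    {v : ℕ → LocalSpace ι X} {c : ℝ} (hv : HasSum (fun n => ‖v n‖ ^ 2) c) (η : H) :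
    HasSum (fun p : ℕ × (X → ι) => ‖localRep π X (ketbra (v p.1) (bv p.2)) η‖ ^ 2)
      (c * ‖η‖ ^ 2) := by
  simp_rw [fun p : ℕ × (X → ι) => norm_localRep_ketbra π X (v p.1) (bv p.2)
    (inner_bv_bv_self p.2) η]
  exact hv.mul (hn.hasSum_norm_sq X η) (hv.summable.mul_of_nonneg (hn.hasSum_norm_sq X η).summable
    (fun _ => by positivity) fun _ => by positivity)

/-- The isometry `η ↦ (|vₙ⟩⟨e_s| η)_{n, s}`. Under the observables of `X`, it turns every vector of
norm one into a vector with density matrix `∑ₙ |vₙ⟩⟨vₙ|`, and under the observables outside `X` it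
does not change the density matrix. -/
noncomputable def purify (hn : IsNormalRep π) {X : Finset Site} {v : ℕ → LocalSpace ι X}
    (hv : HasSum (fun n => ‖v n‖ ^ 2) 1) : H →ₗᵢ[ℂ] HSum (ℕ × (X → ι)) H where
  toFun η := ⟨fun p => localRep π X (ketbra (v p.1) (bv p.2)) η,
    HSum.mem (hn.hasSum_prod_norm_sq hv η).summable⟩
  map_add' η ξ := by ext p; exact map_add _ η ξ
  map_smul' c η := by ext p; exact map_smul _ c η
  norm_map' η := by
    refine (sq_eq_sq₀ (norm_nonneg _) (norm_nonneg _)).1 ?_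
    have h := (hn.hasSum_prod_norm_sq hv η).tsum_eq
    rw [one_mul] at h
    rw [← h]
    exact HSum.norm_sq (E := H) _

variable (hn : IsNormalRep π) {X : Finset Site} {v : ℕ → LocalSpace ι X}
  (hv : HasSum (fun n => ‖v n‖ ^ 2) 1)

theorem purify_apply (η : H) (p : ℕ × (X → ι)) :
    purify hn hv η p = localRep π X (ketbra (v p.1) (bv p.2)) η := rfl

theorem diag_purify_apply (A : LocalOp ι X) (η : H) (p : ℕ × (X → ι)) :
    diag (ℕ × (X → ι)) (localRep π X A) (purify hn hv η) p =
      localRep π X (ketbra (A (v p.1)) (bv p.2)) η := by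
  rw [diag_apply, purify_apply, ← mul_apply_eq_comp, ← map_mul, mul_ketbra]

theorem norm_diag_purify (A : LocalOp ι X) {c : ℝ} (hc : HasSum (fun n => ‖A (v n)‖ ^ 2) c)
    (η : H) : ‖diag (ℕ × (X → ι)) (localRep π X A) (purify hn hv η)‖ ^ 2 = c * ‖η‖ ^ 2 := by
  rw [HSum.norm_sq]
  simp_rw [diag_purify_apply]
  exact (hn.hasSum_prod_norm_sq hc η).tsum_eq

theorem inner_diag_purify (A : LocalOp ι X) {c : ℂ} (hc : HasSum (fun n => ⟪v n, A (v n)⟫_ℂ) c)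
    (η ξ : H) :
    ⟪purify hn hv η, diag (ℕ × (X → ι)) (localRep π X A) (purify hn hv ξ)⟫_ℂ = c * ⟪η, ξ⟫_ℂ := by
  have hs := lp.summable_inner (𝕜 := ℂ) (purify hn hv η)
    (diag (ℕ × (X → ι)) (localRep π X A) (purify hn hv ξ))
  rw [lp.inner_eq_tsum]
  simp_rw [diag_purify_apply, purify_apply, inner_localRep_ketbra] at hs ⊢
  refine ((hc.mul ((innerSL ℂ η).hasSum (hn X ξ)) hs).tsum_eq)

/-- The purification intertwines the observables outside `X`. -/
theorem diag_purify_of_disjoint {Y : Finset Site} (h : Disjoint X Y) (B : LocalOp ι Y) (η : H) :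
    diag (ℕ × (X → ι)) (localRep π Y B) (purify hn hv η) = purify hn hv (localRep π Y B η) := by
  ext p
  rw [diag_apply, purify_apply, purify_apply, ← mul_apply_eq_comp, ← mul_apply_eq_comp,
    localRep_commute π h]

/-- The purification represents the product of the state of `X` with density matrix
`∑ₙ |vₙ⟩⟨vₙ|` and the restriction of the state of `ξ`. -/
theorem inner_diag_purify_union {ω : quasiLocal ι →ₗ[ℂ] ℂ} {ψ : H}
    (hω : ∀ a, ω a = ⟪ψ, π a ψ⟫_ℂ) {Y : Finset Site} (h : Disjoint X Y)
    {w : ℕ → LocalSpace ι Y} (hw : HasDensity ω Y w) (O : LocalOp ι (X ∪ Y)) :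
    ⟪purify hn hv ψ, diag (ℕ × (X → ι)) (localRep π (X ∪ Y) O) (purify hn hv ψ)⟫_ℂ =
      prodExpectation v w O := by
  have hs := lp.summable_inner (𝕜 := ℂ) (purify hn hv ψ)
    (diag (ℕ × (X → ι)) (localRep π (X ∪ Y) O) (purify hn hv ψ))
  -- the terms are the expectations of the slices of `O`
  have hterm : ∀ p : ℕ × (X → ι),
      ⟪purify hn hv ψ p, diag (ℕ × (X → ι)) (localRep π (X ∪ Y) O) (purify hn hv ψ) p⟫_ℂ =
      ⟪star (localRep π Y (sliceOp (pairEquiv ι h) (v p.1) (v p.1) O)) ψ,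
        localRep π X (ketbra (bv p.2) (bv p.2)) ψ⟫_ℂ := by
    intro p
    rw [diag_apply, purify_apply, ← inner_star_right, ← map_star, star_ketbra, inner_star_left,
      ← mul_apply_eq_comp, ← mul_apply_eq_comp, ← mul_apply_eq_comp, localRep_left π h,
      localRep_left π h, ← map_mul, ← map_mul, ketbra, ketbra,
      rankOne_mul_mul_rankOne, map_mul, ← localRep_right π h, ← localRep_left π h]
    rfl
  have hw1 : Summable fun m => ‖w m‖ ^ 2 := by
    have := (Complex.hasSum_re (hw 1)).summable
    refine this.congr fun m => ?_
    rw [one_apply_eq_self, ← RCLike.re_eq_complex_re, inner_self_eq_norm_sq]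
  have hs2 : Summable fun q : ℕ × ℕ =>
      ⟪tensorVec (v q.1) (w q.2), O (tensorVec (v q.1) (w q.2))⟫_ℂ := by
    refine Summable.of_norm_bounded (g := fun q : ℕ × ℕ => ‖O‖ * (‖v q.1‖ ^ 2 * ‖w q.2‖ ^ 2))
      ((hv.summable.mul_of_nonneg hw1 (fun _ => by positivity) fun _ => by positivity).mul_left _)
      fun q => ?_
    rw [tensorVec_eq_tens h, ← mul_pow, ← norm_tens (pairEquiv ι h)]
    refine (norm_inner_le_norm _ _).trans ?_
    nlinarith [O.le_opNorm (tens (pairEquiv ι h) (v q.1) (w q.2)),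
      norm_nonneg (tens (pairEquiv ι h) (v q.1) (w q.2))]
  rw [lp.inner_eq_tsum, prodExpectation, hs2.tsum_prod, hs.tsum_prod]
  refine tsum_congr fun n => ?_
  simp_rw [hterm]
  have h1 := ((innerSL ℂ (star (localRep π Y (sliceOp (pairEquiv ι h) (v n) (v n) O)) ψ)).hasSum
    (hn X ψ)).tsum_eq
  simp only [innerSL_apply_apply] at h1
  rw [h1, inner_star_left, localRep_apply, ← hω, ← (hw _).tsum_eq]
  refine tsum_congr fun m => ?_
  rw [inner_sliceOp, tensorVec_eq_tens h]

end Purification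

/-! ### Local operators that act as the projection onto the state vector -/

section Projector

variable {ι : Type*} {H : Type*} [NormedAddCommGroup H] [InnerProductSpace ℂ H] [CompleteSpace H]
  {π : quasiLocal ι →⋆ₐ[ℂ] (H →L[ℂ] H)}

theorem norm_diag_le {E : Type*} [NormedAddCommGroup E] [InnerProductSpace ℂ E] [CompleteSpace E]
    (τ : Type*) (b : E →L[ℂ] E) : ‖diag τ b‖ ≤ ‖b‖ := by
  rw [← diagHom_apply]
  exact NonUnitalStarAlgHom.norm_apply_le (diagHom τ) b

theorem star_diag {E : Type*} [NormedAddCommGroup E] [InnerProductSpace ℂ E] [CompleteSpace E]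
    (τ : Type*) (b : E →L[ℂ] E) : star (diag τ b) = diag τ (star b) := by
  rw [← diagHom_apply, ← diagHom_apply, map_star]

/-- Uhlmann's theorem for the observables of `S` in a multiple of the representation. -/
theorem exists_contraction_diag (π : quasiLocal ι →⋆ₐ[ℂ] (H →L[ℂ] H)) (τ : Type*) (S : Set Site)
    {Ψ Ψ' : HSum τ H} {ε : ℝ} (hε : 0 ≤ ε) (hΨ : ‖Ψ‖ = 1) (hΨ' : ‖Ψ'‖ = 1)
    (h : ∀ O ∈ localOn ι S,
      ‖⟪Ψ, diag τ (π O) Ψ⟫_ℂ - ⟪Ψ', diag τ (π O) Ψ'⟫_ℂ‖ ≤ ε * ‖diag τ (π O)‖) :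
    ∃ W : HSum τ H →L[ℂ] HSum τ H,
      (∀ O ∈ localOn ι S, ∀ Φ, diag τ (π O) (W Φ) = W (diag τ (π O) Φ)) ∧ ‖W‖ ≤ 1 ∧
      1 - 2 * ε ≤ (⟪Ψ', W Ψ⟫_ℂ).re := by
  obtain ⟨W, hW, hW1, hWre⟩ := uhlmann (exists_local_resolvent_map ((diagHom τ).comp π)
    (S := S)) hε hΨ hΨ' (by
      rintro _ ⟨O, hO, rfl⟩
      exact h O hO)
  rw [mem_commutant] at hW
  exact ⟨W, fun O hO Φ => congrArg (fun Q : HSum τ H →L[ℂ] HSum τ H => Q Φ) (hW _ ⟨O, hO, rfl⟩),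
    hW1, hWre⟩

/-- The decay of correlations across an annulus, as a bound on the difference between the state and
the vector state of its purification. -/
theorem norm_inner_purify_sub_le [Nontrivial H] (hn : IsNormalRep π)
    {ω : quasiLocal ι →ₗ[ℂ] ℂ} {ψ : H} (hgns : IsGNSTriple π ψ ω)
    (hln : IsLocallyNormal ω) {C α : ℝ} (hC : 0 ≤ C) (hdec : DecayAcrossAnnuli C α ω) {r R : ℝ}
    (hr : 0 < r) (hrR : r < R) {X : Finset Site} (hX : (X : Set Site) = disk r)
    {v : ℕ → LocalSpace ι X} (hvd : HasDensity ω X v) (hv : HasSum (fun n => ‖v n‖ ^ 2) 1)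
    (i : ℕ × (X → ι)) {O : quasiLocal ι} (hO : O ∈ localOn ι (disk r ∪ (disk R)ᶜ)) :
    ‖⟪purify hn hv ψ, diag (ℕ × (X → ι)) (π O) (purify hn hv ψ)⟫_ℂ - ω O‖ ≤
      C * Real.exp (-(α * (R - r))) * ‖diag (ℕ × (X → ι)) (π O)‖ := by
  obtain ⟨Z, hZ, A', rfl⟩ := hO
  have hsub : Z ⊆ X ∪ (Z \ X) := by
    rw [Finset.union_sdiff_self_eq_union]; exact Finset.subset_union_right
  obtain ⟨A, hA⟩ := exists_incl_eq hsub A'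
  have hXY : Disjoint X (Z \ X) := Finset.disjoint_sdiff
  have hY : ((Z \ X : Finset Site) : Set Site) ⊆ (disk R)ᶜ := fun j hj => by
    rw [Finset.coe_sdiff, hX] at hj
    exact (hZ hj.1).resolve_left hj.2
  obtain ⟨w, hw⟩ := hln (Z \ X)
  rw [hA, ← localRep_apply, inner_diag_purify_union hn hv hgns.2 hXY hw, norm_sub_rev]
  refine (hdec r R hr hrR X (Z \ X) hX.subset hY v w hvd hw A).trans ?_
  refine mul_le_mul_of_nonneg_left ?_ (by positivity)
  rw [← hn.norm_localRep]
  exact norm_le_norm_diag _ i _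

set_option maxHeartbeats 2000000 in
/-- The decay of correlations across an annulus gives an observable `g` of the larger disk which,
up to a small error, behaves as the rank-one projection `|ψ⟩⟨ψ|` in products with the observables of
the smaller disk. -/
theorem exists_local_projector [Nontrivial H] (hi : IsIrred π) (hn : IsNormalRep π)
    {ω : quasiLocal ι →ₗ[ℂ] ℂ} {ψ : H} (hψ : ‖ψ‖ = 1) (hgns : IsGNSTriple π ψ ω)
    (hln : IsLocallyNormal ω) {C α : ℝ} (hC : 0 ≤ C) (hdec : DecayAcrossAnnuli C α ω) {r R : ℝ}
    (hr : 0 < r) (hrR : r < R) :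
    ∃ g ∈ localOn ι (disk R), ‖g‖ ≤ 1 ∧ ‖π g ψ - ψ‖ ≤ uhlmannError C α (R - r) ∧
      (∀ a ∈ localOn ι (disk r), ‖a * g‖ ≤ ‖π a ψ‖) ∧
      ∀ a ∈ localOn ι (disk r),
        ‖π (star g * a) ψ - ω a • ψ‖ ≤ uhlmannError C α (R - r) * ‖a‖ := by
  classical
  have hω := hgns.2
  set X := diskFinset r with hX
  have hXr : (X : Set Site) = disk r := coe_diskFinset r
  obtain ⟨v, hvd⟩ := hln X
  have hv : HasSum (fun n => ‖v n‖ ^ 2) 1 := by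
    simpa [hψ] using hgns.hasSum_norm_sq hvd 1
  obtain ⟨s₀, -, -⟩ := hn.exists_isometry X
  let τ := ℕ × (X → ι)
  let i₀ : τ := (0, s₀)
  set J := purify hn hv with hJ
  -- the product state and the state itself as vector states of the same representation
  set Ψ₁ : HSum τ H := lp.single 2 i₀ ψ with hΨ₁
  have hΨ₁n : ‖Ψ₁‖ = 1 := by rw [hΨ₁, lp.norm_single (by norm_num), hψ]
  have hΨ₂n : ‖J ψ‖ = 1 := by rw [J.norm_map, hψ]
  have hin : ∀ Φ : HSum τ H, ⟪Ψ₁, Φ⟫_ℂ = ⟪ψ, Φ i₀⟫_ℂ := fun Φ => by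
    rw [hΨ₁, lp.inner_single_left]
  set ε := C * Real.exp (-(α * (R - r))) with hε
  have hε0 : 0 ≤ ε := by positivity
  obtain ⟨W, hWd, hW1, hWre⟩ := exists_contraction_diag π τ (disk r ∪ (disk R)ᶜ) hε0 hΨ₂n hΨ₁n (by
    intro O hO
    rw [hin, diag_apply, hΨ₁, lp.single_apply_self, ← hω]
    exact norm_inner_purify_sub_le hn hgns hln hC hdec hr hrR hXr hvd hv i₀ hO)
  -- the operator to be localized
  let G : H →L[ℂ] H :=
    (lp.evalCLM ℂ (fun _ : τ => H) 2 i₀) ∘L W ∘L J.toContinuousLinearMap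
  have hG : ∀ η, G η = W (J η) i₀ := fun η => rfl
  have hWn : ∀ Φ, ‖W Φ‖ ≤ ‖Φ‖ := fun Φ => by simpa using W.le_of_opNorm_le hW1 Φ
  have hev : ∀ Φ : HSum τ H, ‖Φ i₀‖ ≤ ‖Φ‖ := fun Φ => lp.norm_apply_le_norm (by norm_num) Φ i₀
  have hG1 : ‖G‖ ≤ 1 := G.opNorm_le_bound zero_le_one fun η => by
    rw [one_mul, hG]
    exact (hev _).trans ((hWn _).trans (J.norm_map η).le)
  have hGcomm : G ∈ commutant ((localOn ι (disk R)ᶜ).map π) := by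
    rw [mem_commutant]
    rintro _ ⟨_, ⟨Y, hY, B, rfl⟩, rfl⟩
    have hXY : Disjoint X Y := by
      rw [← Finset.disjoint_coe, hXr]
      exact (disjoint_compl_right.mono_right hY).mono_left (disk_mono hrR.le)
    ext1 η
    change π (incl Y B) (W (J η) i₀) = W (J (π (incl Y B) η)) i₀
    rw [← localRep_apply, hJ, ← diag_purify_of_disjoint hn hv hXY, localRep_apply,
      ← hWd _ (incl_mem_localOn (hY.trans Set.subset_union_right) B), diag_apply]
  obtain ⟨g, hg, hg1, hgG⟩ := exists_rep_eq_of_commute_disk hi hn hGcomm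
  have hGa : ∀ a ∈ localOn ι (disk r), ∀ η, π a (G η) = W (diag τ (π a) (J η)) i₀ := by
    intro a ha η
    rw [hG, ← hWd a (localOn_mono Set.subset_union_left ha), diag_apply]
  refine ⟨g, hg, hg1.trans hG1, ?_, ?_, ?_⟩
  · rw [hgG]
    refine norm_sub_le_uhlmannError hψ ?_ ?_
    · simpa [hψ] using G.le_of_opNorm_le hG1 ψ
    · rw [hG, ← hin]; exact hWre
  · intro a ha
    refine (hn.norm_le_norm_rep (S := disk R)
      (mul_mem (localOn_mono (disk_mono hrR.le) ha) hg)).trans ?_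
    rw [map_mul, hgG]
    refine ContinuousLinearMap.opNorm_le_bound _ (norm_nonneg _) fun η => ?_
    rw [mul_apply_eq_comp, hGa a ha]
    refine (hev _).trans ((hWn _).trans ?_)
    rw [← hXr] at ha
    obtain ⟨A, rfl⟩ := mem_localOn_finset.1 ha
    rw [← localRep_apply, ← sq_le_sq₀ (norm_nonneg _) (by positivity), mul_pow]
    exact (norm_diag_purify hn hv A (hgns.hasSum_norm_sq hvd A) η).le
  · intro a ha
    -- `W⋆` maps the vector of the state close to the vector of the product state
    have hWs : ‖star W Ψ₁ - J ψ‖ ≤ uhlmannError C α (R - r) := by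
      refine norm_sub_le_uhlmannError hΨ₂n ?_ ?_
      · have := (star W).le_of_opNorm_le ((norm_star W).trans_le hW1) Ψ₁
        rwa [hΨ₁n, mul_one] at this
      · rw [inner_star_right, ← inner_conj_symm, Complex.conj_re]
        exact hWre
    have hδ : 0 ≤ uhlmannError C α (R - r) := Real.sqrt_nonneg _
    have hbound : ∀ η, ‖⟪η, π (star g * a) ψ - ω a • ψ⟫_ℂ‖ ≤
        uhlmannError C α (R - r) * ‖a‖ * ‖η‖ := by
      intro η
      have e1 : ⟪η, π (star g * a) ψ⟫_ℂ = ⟪diag τ (π (star a)) (J η), star W Ψ₁⟫_ℂ := by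
        rw [map_mul, mul_apply_eq_comp, map_star, inner_star_right, hgG, inner_star_right,
          ← inner_conj_symm _ Ψ₁, hin, inner_conj_symm, ← hGa _ (star_mem ha), map_star,
          inner_star_left]
      have e2 : ω a * ⟪η, ψ⟫_ℂ = ⟪diag τ (π (star a)) (J η), J ψ⟫_ℂ := by
        rw [← hXr] at ha
        obtain ⟨A, rfl⟩ := mem_localOn_finset.1 ha
        rw [map_star, ← star_diag, inner_star_left, ← localRep_apply]
        exact (inner_diag_purify hn hv A (hvd A) η ψ).symm
      rw [inner_sub_right, inner_smul_right, e1, e2, ← inner_sub_right]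
      refine (norm_inner_le_norm _ _).trans ?_
      have h1 : ‖diag τ (π (star a)) (J η)‖ ≤ ‖a‖ * ‖η‖ := by
        rw [← J.norm_map η]
        refine ContinuousLinearMap.le_of_opNorm_le _ ((norm_diag_le τ _).trans ?_) _
        exact (norm_rep_le π _).trans (norm_star a).le
      calc _ ≤ ‖a‖ * ‖η‖ * uhlmannError C α (R - r) :=
            mul_le_mul h1 hWs (norm_nonneg _) (by positivity)
        _ = _ := by ring
    have h2 := hbound (π (star g * a) ψ - ω a • ψ)
    rw [inner_self_eq_norm_sq_to_K, norm_pow] at h2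
    rcases eq_or_lt_of_le (norm_nonneg (π (star g * a) ψ - ω a • ψ)) with h0 | h0
    · rw [← h0]; positivity
    · refine le_of_mul_le_mul_right ?_ h0
      simpa [sq] using h2

end Projector

/-! ### The correction of an approximate solution -/

section Correction

variable {𝔄 : Type*} [CStarAlgebra 𝔄] {H : Type*} [NormedAddCommGroup H] [InnerProductSpace ℂ H]
  [CompleteSpace H] {π : 𝔄 →⋆ₐ[ℂ] (H →L[ℂ] H)}

theorem norm_rep_apply_le (π : 𝔄 →⋆ₐ[ℂ] (H →L[ℂ] H)) {a : 𝔄} {L : ℝ} (ha : ‖a‖ ≤ L) (v : H) :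
    ‖π a v‖ ≤ L * ‖v‖ :=
  (π a).le_of_opNorm_le ((NonUnitalStarAlgHom.norm_apply_le π a).trans ha) v

/-- If `g` behaves as the projection onto `ψ` and `T ψ`, `a ψ`, `b ψ` are close to `θ`, `x`, `y`,
then `a g g⋆ b⋆` maps `θ` close to `⟪y, θ⟫ x`. -/
theorem norm_rep_mul_projector_sub_le {ψ θ x y : H} {g T a b : 𝔄} {d La Lb : ℝ} (hψ : ‖ψ‖ = 1)
    (hθ : ‖θ‖ ≤ 1) (hg : ‖g‖ ≤ 1) (hgψ : ‖π g ψ - ψ‖ ≤ d) (hT : ‖T‖ ≤ 1)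
    (hTθ : ‖π T ψ - θ‖ ≤ d) (hLa : 0 ≤ La) (hLb : 0 ≤ Lb) (ha : ‖a‖ ≤ La)
    (hx : ‖π a ψ - x‖ ≤ La * d) (hb : ‖b‖ ≤ Lb) (hy : ‖π b ψ - y‖ ≤ Lb * d) (hyn : ‖y‖ ≤ Lb)
    (hgb : ‖π (star g * (star b * T)) ψ - ⟪ψ, π (star b * T) ψ⟫_ℂ • ψ‖ ≤ d * ‖star b * T‖) :
    ‖π (a * g * (star g * star b)) θ - ⟪y, θ⟫_ℂ • x‖ ≤ 6 * (La * Lb * d) := by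
  have hd : 0 ≤ d := (norm_nonneg _).trans hgψ
  have hgs : ‖star g‖ ≤ 1 := (norm_star g).trans_le hg
  have hbs : ‖star b‖ ≤ Lb := (norm_star b).trans_le hb
  have hgbn : ‖star g * star b‖ ≤ Lb :=
    (norm_mul_le _ _).trans ((mul_le_mul hgs hbs (norm_nonneg _) zero_le_one).trans (one_mul Lb).le)
  have hag : ‖a * g‖ ≤ La :=
    (norm_mul_le _ _).trans ((mul_le_mul ha hg (norm_nonneg _) hLa).trans (mul_one La).le)
  have hbT : ‖star b * T‖ ≤ Lb :=
    (norm_mul_le _ _).trans ((mul_le_mul hbs hT (norm_nonneg _) hLb).trans (mul_one Lb).le)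
  have hTψ : ‖π T ψ‖ ≤ 1 := by simpa [hψ] using norm_rep_apply_le π hT ψ
  have hin : ⟪ψ, π (star b * T) ψ⟫_ℂ = ⟪π b ψ, π T ψ⟫_ℂ := by
    rw [map_mul, mul_apply_eq_comp, map_star, inner_star_right]
  -- the action of `g⋆ b⋆` on `θ`
  have h1 : ‖π (star g * star b) θ - ⟪y, θ⟫_ℂ • ψ‖ ≤ 4 * (Lb * d) := by
    have e1 : π (star g * star b) θ - ⟪y, θ⟫_ℂ • ψ = -π (star g * star b) (π T ψ - θ) +
        (π (star g * (star b * T)) ψ - ⟪ψ, π (star b * T) ψ⟫_ℂ • ψ) +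
        (⟪π b ψ - y, π T ψ⟫_ℂ + ⟪y, π T ψ - θ⟫_ℂ) • ψ := by
      rw [hin, inner_sub_left, inner_sub_right, map_sub, ← mul_assoc, map_mul π _ T,
        mul_apply_eq_comp]
      module
    have b1 := norm_rep_apply_le π hgbn (π T ψ - θ)
    have b2 : ‖⟪π b ψ - y, π T ψ⟫_ℂ‖ ≤ Lb * d * 1 :=
      (norm_inner_le_norm _ _).trans (mul_le_mul hy hTψ (norm_nonneg _) (by positivity))
    have b3 : ‖⟪y, π T ψ - θ⟫_ℂ‖ ≤ Lb * d :=
      (norm_inner_le_norm _ _).trans (mul_le_mul hyn hTθ (norm_nonneg _) hLb)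
    have b4 : ‖(⟪π b ψ - y, π T ψ⟫_ℂ + ⟪y, π T ψ - θ⟫_ℂ) • ψ‖ ≤ Lb * d * 1 + Lb * d := by
      rw [norm_smul, hψ, mul_one]
      exact (norm_add_le _ _).trans (add_le_add b2 b3)
    rw [e1]
    refine (norm_add₃_le).trans ?_
    rw [norm_neg]
    have b5 : Lb * ‖π T ψ - θ‖ ≤ Lb * d := mul_le_mul_of_nonneg_left hTθ hLb
    have b6 : d * ‖star b * T‖ ≤ d * Lb := mul_le_mul_of_nonneg_left hbT hd
    linarith
  have e2 : π (a * g * (star g * star b)) θ - ⟪y, θ⟫_ℂ • x =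
      π (a * g) (π (star g * star b) θ - ⟪y, θ⟫_ℂ • ψ) + ⟪y, θ⟫_ℂ • π a (π g ψ - ψ) +
      ⟪y, θ⟫_ℂ • (π a ψ - x) := by
    rw [map_mul π (a * g), mul_apply_eq_comp, map_sub, map_sub, map_smul, map_mul π a g,
      mul_apply_eq_comp, mul_apply_eq_comp]
    module
  have hyθ : ‖⟪y, θ⟫_ℂ‖ ≤ Lb :=
    (norm_inner_le_norm _ _).trans ((mul_le_mul hyn hθ (norm_nonneg _) hLb).trans (mul_one Lb).le)
  have c1 : ‖π (a * g) (π (star g * star b) θ - ⟪y, θ⟫_ℂ • ψ)‖ ≤ La * (4 * (Lb * d)) :=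
    (norm_rep_apply_le π hag _).trans (mul_le_mul_of_nonneg_left h1 hLa)
  have c2 : ‖⟪y, θ⟫_ℂ • π a (π g ψ - ψ)‖ ≤ Lb * (La * d) := by
    rw [norm_smul]
    exact mul_le_mul hyθ ((norm_rep_apply_le π ha _).trans (mul_le_mul_of_nonneg_left hgψ hLa))
      (norm_nonneg _) hLb
  have c3 : ‖⟪y, θ⟫_ℂ • (π a ψ - x)‖ ≤ Lb * (La * d) := by
    rw [norm_smul]
    exact mul_le_mul hyθ hx (norm_nonneg _) hLb
  rw [e2]
  refine (norm_add₃_le).trans ?_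
  linarith

/-- The correction `b` of a self-adjoint operator `s` with error vector `e = η - s θ`: if
`a ψ ≈ e`, `T ψ ≈ θ`, and `g ≈ |ψ⟩⟨ψ|`, then the self-adjoint operator
`b = (a g g⋆ T⋆ + T g g⋆ a⋆) / m - (ρ / m²) T g g⋆ T⋆` with `m = ‖θ‖²` and `ρ = ⟪e, θ⟫` approximates
`(|e⟩⟨θ| + |θ⟩⟨e|) / m - (ρ / m²) |θ⟩⟨θ|`, which maps `θ` to `e`. -/
theorem exists_correction {ψ θ e : H} {g T a : 𝔄} {d L : ℝ} (N : StarSubalgebra ℂ 𝔄)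
    (hgN : g ∈ N) (hTN : T ∈ N) (haN : a ∈ N) (hψ : ‖ψ‖ = 1)
    (hθ : ‖θ‖ ≤ 1) (hθ2 : 1 / 2 ≤ ‖θ‖ ^ 2) (hg : ‖g‖ ≤ 1) (hgψ : ‖π g ψ - ψ‖ ≤ d) (hT : ‖T‖ ≤ 1)
    (hTθ : ‖π T ψ - θ‖ ≤ d) (hL : 0 ≤ L) (ha : ‖a‖ ≤ L) (hae : ‖π a ψ - e‖ ≤ L * d)
    (he : ‖e‖ ≤ L) (hreal : (⟪e, θ⟫_ℂ).im = 0) (hagn : ‖a * g‖ ≤ ‖π a ψ‖)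
    (hgT : ‖π (star g * (star T * T)) ψ - ⟪ψ, π (star T * T) ψ⟫_ℂ • ψ‖ ≤ d * ‖star T * T‖)
    (hga : ‖π (star g * (star a * T)) ψ - ⟪ψ, π (star a * T) ψ⟫_ℂ • ψ‖ ≤ d * ‖star a * T‖) :
    ∃ b ∈ N, IsSelfAdjoint b ∧ ‖b‖ ≤ 8 * ‖e‖ + 4 * (L * d) ∧ ‖e - π b θ‖ ≤ 48 * (L * d) := by
  have hd : 0 ≤ d := (norm_nonneg _).trans hgψ
  set m : ℝ := ‖θ‖ ^ 2 with hm
  set ρ : ℝ := (⟪e, θ⟫_ℂ).re with hρ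
  have hρC : ⟪e, θ⟫_ℂ = (ρ : ℂ) := Complex.ext rfl hreal
  have hmC : ⟪θ, θ⟫_ℂ = (m : ℂ) := by rw [inner_self_eq_norm_sq_to_K, hm]; norm_cast
  have hm0 : 0 < m := by linarith
  have hρe : |ρ| ≤ ‖e‖ := by
    rw [← Real.norm_eq_abs, ← Complex.norm_real, ← hρC]
    exact (norm_inner_le_norm _ _).trans (mul_le_of_le_one_right (norm_nonneg _) hθ)
  have hT' : ‖π T ψ - θ‖ ≤ 1 * d := by rwa [one_mul]
  have h1 := norm_rep_mul_projector_sub_le (x := e) (y := θ) hψ hθ hg hgψ hT hTθ hL zero_le_one ha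
    hae hT hT' hθ hgT
  have h2 := norm_rep_mul_projector_sub_le (x := θ) (y := e) hψ hθ hg hgψ hT hTθ zero_le_one hL hT
    hT' ha hae he hga
  have h3 := norm_rep_mul_projector_sub_le (x := θ) (y := θ) hψ hθ hg hgψ hT hTθ zero_le_one
    zero_le_one hT hT' hT hT' hθ hgT
  rw [hmC] at h1 h3
  rw [hρC] at h2
  set A₁ := a * g * (star g * star T) with hA₁
  set A₂ := T * g * (star g * star a) with hA₂
  set A₃ := T * g * (star g * star T) with hA₃
  have hs12 : star A₁ = A₂ := by simp [hA₁, hA₂, mul_assoc]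
  have hs21 : star A₂ = A₁ := by rw [← hs12, star_star]
  have hs3 : star A₃ = A₃ := by simp [hA₃, mul_assoc]
  have hmi : m⁻¹ ≤ 2 := by
    rw [inv_le_comm₀ hm0 two_pos]; linarith
  have hmi0 : 0 ≤ m⁻¹ := inv_nonneg.2 hm0.le
  have hmi2 : |ρ| * (m⁻¹ * m⁻¹) ≤ 4 * |ρ| := by
    have : m⁻¹ * m⁻¹ ≤ 2 * 2 := mul_le_mul hmi hmi hmi0 zero_le_two
    nlinarith [abs_nonneg ρ]
  have hn1 : ‖((m⁻¹ : ℝ) : ℂ)‖ = m⁻¹ := by rw [Complex.norm_real, Real.norm_of_nonneg hmi0]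
  have hn2 : ‖((ρ * (m⁻¹ * m⁻¹) : ℝ) : ℂ)‖ = |ρ| * (m⁻¹ * m⁻¹) := by
    rw [Complex.norm_real, Real.norm_eq_abs, abs_mul, abs_of_nonneg (mul_nonneg hmi0 hmi0)]
  refine ⟨((m⁻¹ : ℝ) : ℂ) • (A₁ + A₂) - ((ρ * (m⁻¹ * m⁻¹) : ℝ) : ℂ) • A₃, ?_, ?_, ?_, ?_⟩
  · have hA₁N : A₁ ∈ N := mul_mem (mul_mem haN hgN) (mul_mem (star_mem hgN) (star_mem hTN))
    have hA₃N : A₃ ∈ N := mul_mem (mul_mem hTN hgN) (mul_mem (star_mem hgN) (star_mem hTN))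
    exact sub_mem (N.smul_mem (add_mem hA₁N (hs12 ▸ star_mem hA₁N)) _) (N.smul_mem hA₃N _)
  · rw [isSelfAdjoint_iff, star_sub, star_smul, star_smul, star_add, hs12, hs21, hs3,
      RCLike.star_def, Complex.conj_ofReal, Complex.conj_ofReal, add_comm A₂]
  · have hTg : ‖T * g‖ ≤ 1 := (norm_mul_le _ _).trans (mul_le_one₀ hT (norm_nonneg _) hg)
    have hgT' : ‖star g * star T‖ ≤ 1 := by rw [← star_mul, norm_star]; exact hTg
    have hag : ‖a * g‖ ≤ ‖e‖ + L * d := by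
      have := norm_sub_norm_le (π a ψ) e
      linarith
    have n1 : ‖A₁‖ ≤ ‖e‖ + L * d := (norm_mul_le _ _).trans
      ((mul_le_mul hag hgT' (norm_nonneg _) (by positivity)).trans (mul_one _).le)
    have n2 : ‖A₂‖ ≤ ‖e‖ + L * d := by rw [← hs12, norm_star]; exact n1
    have n3 : ‖A₃‖ ≤ 1 := (norm_mul_le _ _).trans (mul_le_one₀ hTg (norm_nonneg _) hgT')
    refine (norm_sub_le _ _).trans ?_
    rw [norm_smul, norm_smul, hn1, hn2]
    have n4 := norm_add_le A₁ A₂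
    have n5 : m⁻¹ * ‖A₁ + A₂‖ ≤ 2 * (2 * (‖e‖ + L * d)) :=
      mul_le_mul hmi (by linarith) (norm_nonneg _) zero_le_two
    have n6 : |ρ| * (m⁻¹ * m⁻¹) * ‖A₃‖ ≤ |ρ| * (m⁻¹ * m⁻¹) :=
      mul_le_of_le_one_right (by positivity) n3
    linarith
  · have e1 : e - π (((m⁻¹ : ℝ) : ℂ) • (A₁ + A₂) - ((ρ * (m⁻¹ * m⁻¹) : ℝ) : ℂ) • A₃) θ =
        ((ρ * (m⁻¹ * m⁻¹) : ℝ) : ℂ) • (π A₃ θ - (m : ℂ) • θ) -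
        ((m⁻¹ : ℝ) : ℂ) • ((π A₁ θ - (m : ℂ) • e) + (π A₂ θ - (ρ : ℂ) • θ)) := by
      have hmc : (m : ℂ) ≠ 0 := by exact_mod_cast hm0.ne'
      rw [map_sub, map_smul, map_smul, map_add, sub_apply, smul_apply, smul_apply, add_apply]
      push_cast
      match_scalars <;> field_simp
      ring
    rw [e1]
    refine (norm_sub_le _ _).trans ?_
    rw [norm_smul, norm_smul, hn1, hn2]
    have n4 := norm_add_le (π A₁ θ - (m : ℂ) • e) (π A₂ θ - (ρ : ℂ) • θ)
    have n5 : m⁻¹ * ‖(π A₁ θ - (m : ℂ) • e) + (π A₂ θ - (ρ : ℂ) • θ)‖ ≤ 2 * (12 * (L * d)) :=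
      mul_le_mul hmi (by linarith) (norm_nonneg _) zero_le_two
    have n6 : |ρ| * (m⁻¹ * m⁻¹) * ‖π A₃ θ - (m : ℂ) • θ‖ ≤ (4 * L) * (6 * d) :=
      mul_le_mul (by linarith) (by linarith) (norm_nonneg _) (by positivity)
    linarith

end Correction

/-! ### Superpolynomially decaying errors -/

section Errors

theorem uhlmannError_nonneg (C α t : ℝ) : 0 ≤ uhlmannError C α t := Real.sqrt_nonneg _

theorem uhlmannError_eq {C : ℝ} (hC : 0 ≤ C) (α t : ℝ) :
    uhlmannError C α t = √(4 * C) * Real.exp (-(α / 2 * t)) := by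
  have h : 4 * (C * Real.exp (-(α * t))) = 4 * C * Real.exp (-(α / 2 * t)) ^ 2 := by
    rw [← Real.exp_nat_mul]
    push_cast
    ring_nf
  rw [uhlmannError, h, Real.sqrt_mul (by positivity), Real.sqrt_sq (Real.exp_pos _).le]

theorem uhlmannError_le {C : ℝ} (hC : 0 ≤ C) {α t : ℝ} (hα : 0 ≤ α) (ht : 0 ≤ t) :
    uhlmannError C α t ≤ √(4 * C) := by
  rw [uhlmannError_eq hC]
  refine mul_le_of_le_one_right (Real.sqrt_nonneg _) (Real.exp_le_one_iff.2 ?_)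
  have : 0 ≤ α / 2 * t := by positivity
  linarith

/-- A bound on the growth rate of the norms of the approximations in the iteration. -/
noncomputable def growthRate (C : ℝ) : ℝ := 17 + 8 * √(4 * C)

theorem one_le_growthRate (C : ℝ) : 1 ≤ growthRate C := by
  have := Real.sqrt_nonneg (4 * C)
  rw [growthRate]; linarith

/-- The bound on the norm of the `n`-th correction in the iteration. -/
noncomputable def stepBound (C α : ℝ) (n : ℕ) : ℝ :=
  (776 * √(4 * C) + 16) * Real.exp (α / 4) *
    (growthRate C ^ n * Real.exp (-(α / 4 * 2 ^ n)))

theorem stepBound_pos (C α : ℝ) (n : ℕ) : 0 < stepBound C α n := by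
  have := one_le_growthRate C
  unfold stepBound
  positivity

theorem summable_pow_mul_stepBound (C : ℝ) {α : ℝ} (hα : 0 < α) {B : ℝ} (hB : 0 < B) :
    Summable fun n => B ^ n * stepBound C α n := by
  refine summable_of_ratio_test_tendsto_lt_one zero_lt_one
    (Eventually.of_forall fun n => (mul_pos (pow_pos hB n) (stepBound_pos C α n)).ne') ?_
  have h1 : ∀ n, ‖B ^ (n + 1) * stepBound C α (n + 1)‖ / ‖B ^ n * stepBound C α n‖ =
      B * growthRate C * Real.exp (-(α / 4 * 2 ^ n)) := by
    intro n
    have hM := one_le_growthRate C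
    rw [Real.norm_of_nonneg (mul_pos (pow_pos hB _) (stepBound_pos C α _)).le,
      Real.norm_of_nonneg (mul_pos (pow_pos hB _) (stepBound_pos C α _)).le,
      div_eq_iff (mul_pos (pow_pos hB _) (stepBound_pos C α _)).ne', stepBound, stepBound]
    have h2 : Real.exp (-(α / 4 * 2 ^ (n + 1))) =
        Real.exp (-(α / 4 * 2 ^ n)) * Real.exp (-(α / 4 * 2 ^ n)) := by
      rw [← Real.exp_add]; ring_nf
    rw [h2]
    ring
  simp_rw [h1]
  have h3 : Tendsto (fun n : ℕ => α / 4 * 2 ^ n) atTop atTop :=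
    (tendsto_pow_atTop_atTop_of_one_lt one_lt_two).const_mul_atTop (by positivity)
  simpa using (Real.tendsto_exp_neg_atTop_nhds_zero.comp h3).const_mul (B * growthRate C)

theorem summable_stepBound (C : ℝ) {α : ℝ} (hα : 0 < α) : Summable (stepBound C α) := by
  simpa using summable_pow_mul_stepBound C hα one_pos

/-- The bound on the sum of all corrections from the `n`-th on. -/
noncomputable def tailBound (C α : ℝ) (n : ℕ) : ℝ := ∑' k, stepBound C α (n + k)

theorem tailBound_nonneg (C α : ℝ) (n : ℕ) : 0 ≤ tailBound C α n :=
  tsum_nonneg fun _ => (stepBound_pos C α _).le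

theorem tendsto_pow_mul_tailBound (C : ℝ) {α : ℝ} (hα : 0 < α) {B : ℝ} (hB : 1 ≤ B) :
    Tendsto (fun n => B ^ n * tailBound C α n) atTop (𝓝 0) := by
  have hs := summable_pow_mul_stepBound C hα (zero_lt_one.trans_le hB)
  refine squeeze_zero (fun n => mul_nonneg (by positivity) (tailBound_nonneg C α n)) (fun n => ?_)
    (tendsto_sum_nat_add fun n => B ^ n * stepBound C α n)
  rw [tailBound, ← tsum_mul_left]
  refine Summable.tsum_le_tsum (fun k => ?_) ?_ ((summable_nat_add_iff n).2 hs)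
  · rw [add_comm n k]
    exact mul_le_mul_of_nonneg_right (pow_le_pow_right₀ hB (Nat.le_add_left n k))
      (stepBound_pos C α _).le
  · refine Summable.mul_left _ ?_
    simp_rw [add_comm n]
    exact (summable_nat_add_iff n).2 (summable_stepBound C hα)

/-- The error in the approximation by observables of the disk of radius `r`. The approximations
live on disks of radius `2 ^ n`, so the largest such disk inside the given one is used. -/
noncomputable def localizationError (C α r : ℝ) : ℝ := 2 * tailBound C α (Nat.log 2 ⌊r⌋₊)

theorem superpolynomialDecay_localizationError (C : ℝ) {α : ℝ} (hα : 0 < α) :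
    Asymptotics.SuperpolynomialDecay atTop (fun r : ℝ => r) (localizationError C α) := by
  intro N
  have h1 : Tendsto (fun r : ℝ => Nat.log 2 ⌊r⌋₊) atTop atTop :=
    (tendsto_atTop_atTop.2 fun b =>
      ⟨2 ^ b, fun a ha => Nat.le_log_of_pow_le one_lt_two ha⟩).comp tendsto_nat_floor_atTop
  have h2 := ((tendsto_pow_mul_tailBound C hα (B := 2 ^ N) (one_le_pow₀ one_le_two)).comp
    h1).const_mul (2 ^ N * 2)
  rw [mul_zero] at h2
  refine squeeze_zero' ?_ ?_ h2
  · filter_upwards [eventually_ge_atTop 0] with r hr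
    exact mul_nonneg (pow_nonneg hr N) (mul_nonneg zero_le_two (tailBound_nonneg C α _))
  · filter_upwards [eventually_ge_atTop 0] with r hr
    set n := Nat.log 2 ⌊r⌋₊ with hn
    have h3 : r ≤ 2 * 2 ^ n := by
      have h4 : ⌊r⌋₊ + 1 ≤ 2 ^ (n + 1) := Nat.lt_pow_succ_log_self one_lt_two _
      have h5 : ((⌊r⌋₊ + 1 : ℕ) : ℝ) ≤ ((2 ^ (n + 1) : ℕ) : ℝ) := by exact_mod_cast h4
      push_cast at h5
      rw [pow_succ'] at h5
      exact (Nat.lt_floor_add_one r).le.trans h5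
    have h6 : r ^ N ≤ 2 ^ N * (2 ^ N) ^ n := by
      refine (pow_le_pow_left₀ hr h3 N).trans ?_
      rw [mul_pow, ← pow_mul, ← pow_mul, mul_comm n N]
    calc r ^ N * localizationError C α r
        ≤ 2 ^ N * (2 ^ N) ^ n * (2 * tailBound C α n) :=
          mul_le_mul_of_nonneg_right h6 (mul_nonneg zero_le_two (tailBound_nonneg C α _))
      _ = _ := by simp only [Function.comp_apply, ← hn]; ring

/-- An observable with good approximations on the disks of radius `2 ^ n` is localized. -/
theorem isLocalizedWith_of_approx {ι : Type*} {C α : ℝ} {A : quasiLocal ι} (B : ℕ → quasiLocal ι)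
    (h0 : ∀ S, B 0 ∈ localOn ι S) (hB : ∀ n, B n ∈ localOn ι (disk (2 ^ n)))
    (h : ∀ n, ‖A - B n‖ ≤ 2 * tailBound C α n) : IsLocalizedWith (localizationError C α) A := by
  intro r hr
  refine ⟨B (Nat.log 2 ⌊r⌋₊), ?_, h _⟩
  rcases lt_or_ge r 1 with h1 | h1
  · rw [Nat.floor_eq_zero.2 h1, Nat.log_zero_right]
    exact h0 _
  · refine localOn_mono (disk_mono ?_) (hB _)
    have h2 : 2 ^ Nat.log 2 ⌊r⌋₊ ≤ ⌊r⌋₊ := Nat.pow_log_le_self 2 (Nat.floor_pos.2 h1).ne'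
    calc (2 : ℝ) ^ Nat.log 2 ⌊r⌋₊ = ((2 ^ Nat.log 2 ⌊r⌋₊ : ℕ) : ℝ) := by push_cast; rfl
      _ ≤ (⌊r⌋₊ : ℝ) := by exact_mod_cast h2
      _ ≤ r := Nat.floor_le hr.le

end Errors

/-! ### A localized self-adjoint operator with a prescribed value on a vector -/

section Iteration

variable {ι : Type*} {H : Type*} [NormedAddCommGroup H] [InnerProductSpace ℂ H] [CompleteSpace H]
  {π : quasiLocal ι →⋆ₐ[ℂ] (H →L[ℂ] H)}

set_option maxHeartbeats 1000000 in
/-- One step of the iteration: a self-adjoint observable `s` of the disk of radius `2 ^ n` is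
corrected by an observable `b` of the disk of radius `2 ^ (n + 1)`. -/
theorem exists_next_approx [Nontrivial H] (hi : IsIrred π) (hn : IsNormalRep π)
    {ω : quasiLocal ι →ₗ[ℂ] ℂ} {ψ θ η : H} (hψ : ‖ψ‖ = 1) (hgns : IsGNSTriple π ψ ω)
    (hln : IsLocallyNormal ω) {C α : ℝ} (hC : 0 ≤ C) (hdec : DecayAcrossAnnuli C α ω)
    (hθ : ‖θ‖ ≤ 1) (hθ2 : 1 / 2 ≤ ‖θ‖ ^ 2) (hη : ‖η‖ ≤ 2) (hreal : (⟪η, θ⟫_ℂ).im = 0)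
    (n : ℕ) {S T s : quasiLocal ι} (hSN : S ∈ localOn ι (disk (2 ^ n))) (hS : ‖S‖ ≤ 2)
    (hSη : ‖π S ψ - η‖ ≤ uhlmannError C α (2 ^ n)) (hTN : T ∈ localOn ι (disk (2 ^ n)))
    (hT : ‖T‖ ≤ 1) (hTθ : ‖π T ψ - θ‖ ≤ uhlmannError C α (2 ^ n))
    (hs : s ∈ localOn ι (disk (2 ^ n))) (hsa : IsSelfAdjoint s) :
    ∃ b ∈ localOn ι (disk (2 ^ (n + 1))), IsSelfAdjoint b ∧
      ‖b‖ ≤ 8 * ‖η - π s θ‖ + 8 * ((1 + ‖s‖) * uhlmannError C α (2 ^ n)) ∧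
      ‖η - π s θ - π b θ‖ ≤ 96 * ((1 + ‖s‖) * uhlmannError C α (2 ^ n)) := by
  have hr : (0 : ℝ) < 2 ^ n := by positivity
  have hR : (2 : ℝ) ^ (n + 1) - 2 ^ n = 2 ^ n := by ring
  have hrR : (2 : ℝ) ^ n < 2 ^ (n + 1) := by linarith
  obtain ⟨g, hgN, hg, hgψ, hg1, hg2⟩ := exists_local_projector hi hn hψ hgns hln hC hdec hr hrR
  rw [hR] at hgψ hg2
  set d := uhlmannError C α (2 ^ n) with hd
  have hmono := localOn_mono (ι := ι) (disk_mono hrR.le)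
  have haN : S - s * T ∈ localOn ι (disk (2 ^ n)) := sub_mem hSN (mul_mem hs hTN)
  have hsT : ‖s * T‖ ≤ ‖s‖ := (norm_mul_le _ _).trans (mul_le_of_le_one_right (norm_nonneg _) hT)
  have hae : ‖π (S - s * T) ψ - (η - π s θ)‖ ≤ 2 * (1 + ‖s‖) * d := by
    have e1 : π (S - s * T) ψ - (η - π s θ) = (π S ψ - η) - π s (π T ψ - θ) := by
      rw [map_sub, map_mul, map_sub, sub_apply, mul_apply_eq_comp]; abel
    rw [e1]
    refine (norm_sub_le _ _).trans ?_
    have h1 := norm_rep_apply_le π (le_refl ‖s‖) (π T ψ - θ)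
    have h2 := mul_le_mul_of_nonneg_left hTθ (norm_nonneg s)
    nlinarith [norm_nonneg s, uhlmannError_nonneg C α (2 ^ n)]
  have hsθ : ‖π s θ‖ ≤ ‖s‖ :=
    (norm_rep_apply_le π (le_refl ‖s‖) θ).trans (mul_le_of_le_one_right (norm_nonneg _) hθ)
  have hreal' : (⟪η - π s θ, θ⟫_ℂ).im = 0 := by
    have h1 : ⟪π s θ, θ⟫_ℂ = ⟪θ, π s θ⟫_ℂ := by
      rw [← inner_star_left, ← map_star, hsa.star_eq]
    have h2 : (⟪π s θ, θ⟫_ℂ).im = 0 := by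
      rw [← Complex.conj_eq_iff_im, inner_conj_symm, h1]
    rw [inner_sub_left, Complex.sub_im, hreal, h2, sub_zero]
  have hstate : ∀ a ∈ localOn ι (disk (2 ^ n)),
      ‖π (star g * a) ψ - ⟪ψ, π a ψ⟫_ℂ • ψ‖ ≤ d * ‖a‖ := fun a ha => by
    rw [← hgns.2]; exact hg2 a ha
  obtain ⟨b, hb, hbs, hbn, hbe⟩ := exists_correction (localOn ι (disk (2 ^ (n + 1)))) hgN
    (hmono hTN) (hmono haN) hψ hθ hθ2 hg hgψ hT hTθ (L := 2 * (1 + ‖s‖))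
    (by positivity) ((norm_sub_le _ _).trans (by linarith [norm_nonneg s])) hae
    ((norm_sub_le _ _).trans (by linarith [norm_nonneg s])) hreal' (hg1 _ haN)
    (hstate _ (mul_mem (star_mem hTN) hTN)) (hstate _ (mul_mem (star_mem haN) hTN))
  exact ⟨b, hb, hbs, by linarith, by linarith⟩

/-- If `T ψ ≈ θ` and `S ψ ≈ η` for observables `T`, `S` of disks, then a localized self-adjoint
observable maps `θ` to `η`, provided that `⟪η, θ⟫` is real. -/
theorem exists_selfAdjoint_apply_eq [Nontrivial H] (hi : IsIrred π) (hn : IsNormalRep π)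
    {ω : quasiLocal ι →ₗ[ℂ] ℂ} {ψ θ η : H} (hψ : ‖ψ‖ = 1) (hgns : IsGNSTriple π ψ ω)
    (hln : IsLocallyNormal ω) {C α : ℝ} (hC : 0 ≤ C) (hα : 0 < α) (hdec : DecayAcrossAnnuli C α ω)
    (hθ : ‖θ‖ ≤ 1) (hθ2 : 1 / 2 ≤ ‖θ‖ ^ 2) (hη : ‖η‖ ≤ 2) (hreal : (⟪η, θ⟫_ℂ).im = 0)
    {S T : ℕ → quasiLocal ι} (hSN : ∀ n, S n ∈ localOn ι (disk (2 ^ n))) (hS : ∀ n, ‖S n‖ ≤ 2)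
    (hSη : ∀ n, ‖π (S n) ψ - η‖ ≤ uhlmannError C α (2 ^ n))
    (hTN : ∀ n, T n ∈ localOn ι (disk (2 ^ n))) (hT : ∀ n, ‖T n‖ ≤ 1)
    (hTθ : ∀ n, ‖π (T n) ψ - θ‖ ≤ uhlmannError C α (2 ^ n)) :
    ∃ (K : quasiLocal ι) (B : ℕ → quasiLocal ι), IsSelfAdjoint K ∧ π K θ = η ∧ B 0 = 0 ∧
      (∀ n, B n ∈ localOn ι (disk (2 ^ n))) ∧ (∀ n, IsSelfAdjoint (B n)) ∧
      ∀ n, ‖K - B n‖ ≤ tailBound C α n := by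
  have hstep : ∀ (n : ℕ) (s : {s : quasiLocal ι // s ∈ localOn ι (disk (2 ^ n)) ∧
      IsSelfAdjoint s}), ∃ s' : {s : quasiLocal ι // s ∈ localOn ι (disk (2 ^ (n + 1))) ∧
      IsSelfAdjoint s},
      ‖s'.1 - s.1‖ ≤ 8 * ‖η - π s.1 θ‖ + 8 * ((1 + ‖s.1‖) * uhlmannError C α (2 ^ n)) ∧
      ‖η - π s'.1 θ‖ ≤ 96 * ((1 + ‖s.1‖) * uhlmannError C α (2 ^ n)) := by
    rintro n ⟨s, hs, hsa⟩
    obtain ⟨b, hb, hbs, hbn, hbe⟩ := exists_next_approx hi hn hψ hgns hln hC hdec hθ hθ2 hη hreal n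
      (hSN n) (hS n) (hSη n) (hTN n) (hT n) (hTθ n) hs hsa
    refine ⟨⟨s + b, add_mem (localOn_mono (disk_mono ?_) hs) hb, hsa.add hbs⟩, ?_, ?_⟩
    · exact pow_le_pow_right₀ one_le_two n.le_succ
    · simpa using hbn
    · simpa [sub_sub] using hbe
  choose next hnext1 hnext2 using hstep
  let s : (n : ℕ) → {s : quasiLocal ι // s ∈ localOn ι (disk (2 ^ n)) ∧ IsSelfAdjoint s} :=
    fun n => Nat.rec ⟨0, zero_mem _, IsSelfAdjoint.zero _⟩ next n
  have hd : ∀ n, uhlmannError C α (2 ^ n) ≤ √(4 * C) := fun n =>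
    uhlmannError_le hC hα.le (by positivity)
  have hd0 : ∀ n, 0 ≤ uhlmannError C α (2 ^ n) := fun n => uhlmannError_nonneg _ _ _
  have hB0 : (s 0).1 = 0 := rfl
  have h1 : ∀ n, ‖(s (n + 1)).1 - (s n).1‖ ≤
      8 * ‖η - π (s n).1 θ‖ + 8 * ((1 + ‖(s n).1‖) * uhlmannError C α (2 ^ n)) := fun n =>
    hnext1 n (s n)
  have h2 : ∀ n, ‖η - π (s (n + 1)).1 θ‖ ≤
      96 * ((1 + ‖(s n).1‖) * uhlmannError C α (2 ^ n)) := fun n => hnext2 n (s n)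
  -- the norms grow at most exponentially in `n`
  have hM := one_le_growthRate C
  have hgrow : ∀ n, 1 + ‖(s n).1‖ ≤ growthRate C ^ n := by
    intro n
    induction n with
    | zero => simp [hB0]
    | succ n ih =>
      have h3 : ‖η - π (s n).1 θ‖ ≤ 2 * (1 + ‖(s n).1‖) := by
        have := (norm_rep_apply_le π (le_refl ‖(s n).1‖) θ).trans
          (mul_le_of_le_one_right (norm_nonneg _) hθ)
        have := norm_sub_le η (π (s n).1 θ)
        linarith [norm_nonneg (s n).1]
      have h4 := norm_le_norm_add_norm_sub' (s (n + 1)).1 (s n).1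
      have h5 : (1 + ‖(s n).1‖) * uhlmannError C α (2 ^ n) ≤ (1 + ‖(s n).1‖) * √(4 * C) :=
        mul_le_mul_of_nonneg_left (hd n) (by positivity)
      have h6 := h1 n
      rw [pow_succ' (growthRate C)]
      refine le_trans ?_ (mul_le_mul_of_nonneg_left ih (zero_le_one.trans hM))
      rw [growthRate]
      nlinarith
  -- the corrections decay superexponentially in `n`
  have hsum : ∀ n, ‖(s (n + 1)).1 - (s n).1‖ ≤ stepBound C α n := by
    intro n
    refine (h1 n).trans ?_
    have hD := Real.sqrt_nonneg (4 * C)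
    rcases n with _ | n
    · have h3 : ‖η - π (s 0).1 θ‖ ≤ 2 := by rw [hB0]; simpa using hη
      have h4 : (1 + ‖(s 0).1‖) * uhlmannError C α (2 ^ 0) ≤ √(4 * C) := by
        rw [hB0, norm_zero, add_zero, one_mul]; exact hd 0
      have h5 : stepBound C α 0 = 776 * √(4 * C) + 16 := by
        rw [stepBound, pow_zero, pow_zero, mul_one, one_mul, mul_assoc, ← Real.exp_add,
          add_neg_cancel, Real.exp_zero, mul_one]
      rw [h5]
      linarith
    · have h6 : uhlmannError C α (2 ^ (n + 1)) ≤ uhlmannError C α (2 ^ n) := by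
        refine Real.sqrt_le_sqrt ?_
        have : (2 : ℝ) ^ n ≤ 2 ^ (n + 1) := pow_le_pow_right₀ one_le_two n.le_succ
        gcongr
      have h7 : uhlmannError C α (2 ^ n) = √(4 * C) * Real.exp (-(α / 4 * 2 ^ (n + 1))) := by
        rw [uhlmannError_eq hC, pow_succ]; ring_nf
      have h8 : (1 + ‖(s n).1‖) * uhlmannError C α (2 ^ n) ≤
          growthRate C ^ (n + 1) * uhlmannError C α (2 ^ n) :=
        mul_le_mul_of_nonneg_right
          ((hgrow n).trans (pow_le_pow_right₀ hM n.le_succ)) (hd0 n)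
      have h9 : (1 + ‖(s (n + 1)).1‖) * uhlmannError C α (2 ^ (n + 1)) ≤
          growthRate C ^ (n + 1) * uhlmannError C α (2 ^ n) :=
        mul_le_mul (hgrow (n + 1)) h6 (hd0 _) (by positivity)
      have h10 : 776 * (growthRate C ^ (n + 1) * uhlmannError C α (2 ^ n)) ≤
          stepBound C α (n + 1) := by
        have hE : 1 ≤ Real.exp (α / 4) := Real.one_le_exp (by positivity)
        have hP : 0 ≤ growthRate C ^ (n + 1) * Real.exp (-(α / 4 * 2 ^ (n + 1))) := by positivity
        have hQ : 776 * √(4 * C) ≤ (776 * √(4 * C) + 16) * Real.exp (α / 4) := by nlinarith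
        rw [h7, stepBound]
        calc _ = 776 * √(4 * C) *
              (growthRate C ^ (n + 1) * Real.exp (-(α / 4 * 2 ^ (n + 1)))) := by ring
          _ ≤ _ := mul_le_mul_of_nonneg_right hQ hP
      have := h2 n
      linarith
  have hdist : ∀ n, dist (s n).1 (s (n + 1)).1 ≤ stepBound C α n := fun n => by
    rw [dist_comm, dist_eq_norm]; exact hsum n
  have hSum := summable_stepBound C hα
  obtain ⟨K, hK⟩ := cauchySeq_tendsto_of_complete (cauchySeq_of_dist_le_of_summable _ hdist hSum)
  refine ⟨K, fun n => (s n).1, ?_, ?_, hB0, fun n => (s n).2.1, fun n => (s n).2.2, fun n => ?_⟩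
  · have h3 := hK.star
    refine tendsto_nhds_unique (h3.congr fun n => ?_) hK
    exact (s n).2.2.star_eq
  · -- the error vectors tend to zero, since the corrections do
    have h3 : Tendsto (fun n => η - π (s (n + 1)).1 θ) atTop (𝓝 0) := by
      have h4 : ∀ n, ‖η - π (s (n + 1)).1 θ‖ ≤
          96 * √(4 * C) * (growthRate C ^ n * Real.exp (-(α / 4 * 2 ^ n))) := by
        intro n
        refine (h2 n).trans ?_
        have h5 : uhlmannError C α (2 ^ n) ≤ √(4 * C) * Real.exp (-(α / 4 * 2 ^ n)) := by
          rw [uhlmannError_eq hC]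
          gcongr
          linarith
        calc _ ≤ 96 * (growthRate C ^ n * (√(4 * C) * Real.exp (-(α / 4 * 2 ^ n)))) :=
              mul_le_mul_of_nonneg_left (mul_le_mul (hgrow n) h5 (hd0 n) (by positivity))
                (by norm_num)
          _ = _ := by ring
      have h6 : Summable fun n : ℕ => growthRate C ^ n * Real.exp (-(α / 4 * 2 ^ n)) := by
        have hq : (776 * √(4 * C) + 16) * Real.exp (α / 4) ≠ 0 := by positivity
        exact (summable_mul_left_iff hq).1 hSum
      refine squeeze_zero_norm h4 ?_
      simpa using h6.tendsto_atTop_zero.const_mul (96 * √(4 * C))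
    have h7 : Tendsto (fun n => η - π (s (n + 1)).1 θ) atTop (𝓝 (η - π K θ)) := by
      have hc : Continuous fun a : quasiLocal ι => η - π a θ :=
        continuous_const.sub ((continuous_rep π).clm_apply continuous_const)
      exact (hc.tendsto K).comp (hK.comp (tendsto_add_atTop_nat 1))
    exact (sub_eq_zero.1 (tendsto_nhds_unique h7 h3)).symm
  · rw [norm_sub_rev, ← dist_eq_norm]
    exact dist_le_tsum_of_dist_le_of_tendsto _ hdist hSum hK n

end Iteration

/-! ### Cayley transforms -/

section Cayley

variable {𝔄 : Type*} [CStarAlgebra 𝔄]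

theorem norm_one_le_one (𝔄 : Type*) [CStarAlgebra 𝔄] : ‖(1 : 𝔄)‖ ≤ 1 := by
  rcases subsingleton_or_nontrivial 𝔄 with h | h
  · simp [Subsingleton.elim (1 : 𝔄) 0]
  · exact CStarRing.norm_one.le

/-- The Cayley transform `(1 + i a) (1 - i a)⁻¹` of a self-adjoint element `a`, where `R` stands for
the inverse of `1 + a²`, so that `(1 - i a)⁻¹ = (1 + i a) R`. -/
noncomputable def cayley (a R : 𝔄) : 𝔄 := (2 : ℂ) • ((1 + Complex.I • a) * R) - 1

theorem one_sub_mul_one_add (a : 𝔄) : (1 - Complex.I • a) * (1 + Complex.I • a) = 1 + a * a := by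
  rw [sub_mul, one_mul, mul_add, mul_one, smul_mul_assoc, mul_smul_comm, smul_smul,
    Complex.I_mul_I]
  module

theorem one_add_mul_one_sub (a : 𝔄) : (1 + Complex.I • a) * (1 - Complex.I • a) = 1 + a * a := by
  rw [add_mul, mul_sub, mul_one, one_mul, mul_sub, mul_one, smul_mul_assoc, mul_smul_comm,
    smul_smul, Complex.I_mul_I]
  module

theorem one_sub_mul_resolvent {a R : 𝔄} (h : (1 + a * a) * R = 1) :
    (1 - Complex.I • a) * ((1 + Complex.I • a) * R) = 1 := by
  rw [← mul_assoc, one_sub_mul_one_add, h]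

/-- `(1 + i a) R` is also a left inverse of `1 - i a`, since `R` commutes with `a`. -/
theorem resolvent_mul_one_sub {a R : 𝔄} (ha : IsSelfAdjoint a) (h : (1 + a * a) * R = 1) :
    (1 + Complex.I • a) * R * (1 - Complex.I • a) = 1 := by
  have hpos : IsSelfAdjoint (1 + a * a) := by simp [isSelfAdjoint_iff, ha.star_eq]
  have hR' : star R * (1 + a * a) = 1 := by
    have := congrArg star h
    rwa [star_mul, hpos.star_eq, star_one] at this
  have hRR : star R = R := left_inv_eq_right_inv hR' h
  rw [hRR] at hR'
  have hc : a * R = R * a := by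
    calc a * R = R * (1 + a * a) * (a * R) := by rw [hR', one_mul]
      _ = R * a * ((1 + a * a) * R) := by noncomm_ring
      _ = R * a := by rw [h, mul_one]
  have hc' : (1 + Complex.I • a) * R = R * (1 + Complex.I • a) := by
    rw [add_mul, mul_add, smul_mul_assoc, hc, mul_smul_comm, one_mul, mul_one]
  rw [hc', mul_assoc, one_add_mul_one_sub, hR']

theorem cayley_mul {a R : 𝔄} (ha : IsSelfAdjoint a) (h : (1 + a * a) * R = 1) :
    cayley a R * (1 - Complex.I • a) = 1 + Complex.I • a := by
  rw [cayley, sub_mul, smul_mul_assoc, resolvent_mul_one_sub ha h, one_mul]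
  module

theorem mul_cayley {a R : 𝔄} (h : (1 + a * a) * R = 1) :
    (1 - Complex.I • a) * cayley a R = 1 + Complex.I • a := by
  rw [cayley, mul_sub, mul_smul_comm, one_sub_mul_resolvent h, mul_one]
  module

theorem cayley_mem_unitary {a R : 𝔄} (ha : IsSelfAdjoint a) (h : (1 + a * a) * R = 1) :
    cayley a R ∈ unitary 𝔄 := by
  set P := (1 + Complex.I • a) * R
  have h1 : (1 - Complex.I • a) * P = 1 := one_sub_mul_resolvent h
  have h2 : P * (1 - Complex.I • a) = 1 := resolvent_mul_one_sub ha h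
  have hst : star (1 - Complex.I • a) = 1 + Complex.I • a := by
    simp [ha.star_eq, sub_eq_add_neg]
  have hst' : star (1 + Complex.I • a) = 1 - Complex.I • a := by rw [← hst, star_star]
  have h3 : star P * (1 + Complex.I • a) = 1 := by rw [← hst, ← star_mul, h1, star_one]
  have h4 : (1 + Complex.I • a) * star P = 1 := by rw [← hst, ← star_mul, h2, star_one]
  have hcomm : (1 - Complex.I • a) * (1 + Complex.I • a) =
      (1 + Complex.I • a) * (1 - Complex.I • a) := by
    rw [one_sub_mul_one_add, one_add_mul_one_sub]
  have hV1 : cayley a R = (1 + Complex.I • a) * P := by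
    rw [← cayley_mul ha h, mul_assoc, h1, mul_one]
  have hV2 : cayley a R = P * (1 + Complex.I • a) := by
    rw [← mul_cayley h, ← mul_assoc, h2, one_mul]
  rw [Unitary.mem_iff]
  constructor
  · calc star (cayley a R) * cayley a R
        = star P * ((1 - Complex.I • a) * (1 + Complex.I • a)) * P := by
          rw [hV1, star_mul, hst']; simp only [mul_assoc]
      _ = (star P * (1 + Complex.I • a)) * ((1 - Complex.I • a) * P) := by
          rw [hcomm]; simp only [mul_assoc]
      _ = 1 := by rw [h3, h1, one_mul]
  · calc cayley a R * star (cayley a R)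
        = P * ((1 + Complex.I • a) * (1 - Complex.I • a)) * star P := by
          rw [hV2, star_mul, hst']; simp only [mul_assoc]
      _ = (P * (1 - Complex.I • a)) * ((1 + Complex.I • a) * star P) := by
          rw [← hcomm]; simp only [mul_assoc]
      _ = 1 := by rw [h2, h4, one_mul]

theorem norm_resolvent_le_one {a R : 𝔄} (ha : IsSelfAdjoint a) (h : (1 + a * a) * R = 1) :
    ‖(1 + Complex.I • a) * R‖ ≤ 1 := by
  have hV : ‖cayley a R‖ ≤ 1 := by
    rcases subsingleton_or_nontrivial 𝔄 with hs | hs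
    · simp [Subsingleton.elim (cayley a R) 0]
    · exact (CStarRing.norm_of_mem_unitary (cayley_mem_unitary ha h)).le
  have e : (1 + Complex.I • a) * R = (2⁻¹ : ℂ) • (cayley a R + 1) := by
    rw [cayley]; module
  rw [e, norm_smul]
  have h1 := norm_add_le (cayley a R) 1
  have h2 := norm_one_le_one 𝔄
  have h3 : ‖(2⁻¹ : ℂ)‖ = 2⁻¹ := by simp
  rw [h3]
  linarith

/-- The Cayley transform is Lipschitz continuous. -/
theorem norm_cayley_sub_le {a b R Q : 𝔄} (ha : IsSelfAdjoint a) (hb : IsSelfAdjoint b)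
    (hR : (1 + a * a) * R = 1) (hQ : (1 + b * b) * Q = 1) :
    ‖cayley a R - cayley b Q‖ ≤ 2 * ‖a - b‖ := by
  have h1 := resolvent_mul_one_sub ha hR
  have h2 := one_sub_mul_resolvent hQ
  have n1 := norm_resolvent_le_one ha hR
  have n2 := norm_resolvent_le_one hb hQ
  rw [cayley, cayley]
  set P := (1 + Complex.I • a) * R
  set P' := (1 + Complex.I • b) * Q
  have e : (2 : ℂ) • P - 1 - ((2 : ℂ) • P' - 1) =
      (2 : ℂ) • (P * (Complex.I • (a - b)) * P') := by
    have e1 : Complex.I • (a - b) = (1 - Complex.I • b) - (1 - Complex.I • a) := by module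
    rw [e1, mul_sub, sub_mul, mul_assoc, h2, h1, mul_one, one_mul]
    module
  rw [e, norm_smul]
  have n3 : ‖P * (Complex.I • (a - b)) * P'‖ ≤ 1 * ‖a - b‖ * 1 := by
    refine (norm_mul_le _ _).trans (mul_le_mul ?_ n2 (norm_nonneg _) (by positivity))
    refine (norm_mul_le _ _).trans (mul_le_mul n1 ?_ (norm_nonneg _) zero_le_one)
    rw [norm_smul, Complex.norm_I, one_mul]
  have n4 : ‖(2 : ℂ)‖ = 2 := by simp
  rw [n4]
  linarith

theorem cayley_mem {N : StarSubalgebra ℂ 𝔄} {a R : 𝔄} (ha : a ∈ N) (hR : R ∈ N) :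
    cayley a R ∈ N :=
  sub_mem (N.smul_mem (mul_mem (add_mem (one_mem N) (N.smul_mem ha _)) hR) _) (one_mem N)

end Cayley

/-! ### The observables relating the two vectors -/

section Final

variable {ι : Type*} {H : Type*} [NormedAddCommGroup H] [InnerProductSpace ℂ H] [CompleteSpace H]
  {π : quasiLocal ι →⋆ₐ[ℂ] (H →L[ℂ] H)} {ω ω' : quasiLocal ι →ₗ[ℂ] ℂ} {ψ ψ' : H} {C α : ℝ}

/-- The self-adjoint observable, which maps `ψ` to the component of `ψ'` orthogonal to `ψ`. -/
theorem exists_localized_selfAdjoint [Nontrivial H] (hi : IsIrred π) (hn : IsNormalRep π)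
    (hψ : ‖ψ‖ = 1) (hψ' : ‖ψ'‖ = 1) (hgns : IsGNSTriple π ψ ω) (hgns' : IsGNSTriple π ψ' ω')
    (hln : IsLocallyNormal ω) (hC : 0 ≤ C) (hα : 0 < α) (hdec : DecayAcrossAnnuli C α ω)
    (hag : AgreeAtInfinity C α ω ω') :
    ∃ K : quasiLocal ι, IsSelfAdjoint K ∧ IsLocalizedWith (localizationError C α) K ∧
      ∃ c : ℂ, ψ' - π K ψ = c • ψ := by
  choose u hu hu1 huψ using fun n : ℕ => exists_local_transport hi hn hψ hψ' hgns.2 hgns'.2 hC hag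
    (r := 2 ^ n) (by positivity)
  set z := ⟪ψ, ψ'⟫_ℂ with hz
  have hz1 : ‖z‖ ≤ 1 := by simpa [hψ, hψ'] using norm_inner_le_norm (𝕜 := ℂ) ψ ψ'
  have h1 := norm_one_le_one (quasiLocal ι)
  have hreal : (⟪ψ' - z • ψ, ψ⟫_ℂ).im = 0 := by
    rw [inner_sub_left, inner_smul_left, hz, inner_conj_symm, inner_self_eq_norm_sq_to_K, hψ]
    simp
  obtain ⟨K, B, hK, hKψ, hB0, hBN, -, hKB⟩ := exists_selfAdjoint_apply_eq hi hn (θ := ψ)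
    (η := ψ' - z • ψ) hψ hgns hln hC hα hdec hψ.le (by rw [hψ]; norm_num)
    ((norm_sub_le _ _).trans (by rw [norm_smul, hψ, hψ']; linarith)) hreal
    (S := fun n => u n - z • 1) (T := fun _ => 1)
    (fun n => sub_mem (hu n) ((localOn ι _).smul_mem (one_mem _) z))
    (fun n => (norm_sub_le _ _).trans (by
      have h2 := hu1 n
      have h3 := mul_le_one₀ hz1 (norm_nonneg _) h1
      rw [norm_smul]; linarith))
    (fun n => by
      have e : π (u n - z • 1) ψ - (ψ' - z • ψ) = π (u n) ψ - ψ' := by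
        rw [map_sub, map_smul, map_one, sub_apply, smul_apply, one_apply_eq_self]; abel
      rw [e]; exact huψ n)
    (fun n => one_mem _) (fun _ => h1) (fun n => by
      rw [map_one, one_apply_eq_self, sub_self, norm_zero]; exact uhlmannError_nonneg _ _ _)
  refine ⟨K, hK, isLocalizedWith_of_approx B (fun S => ?_) hBN fun n => ?_, z, ?_⟩
  · rw [hB0]; exact zero_mem _
  · have := tailBound_nonneg C α n
    linarith [hKB n]
  · rw [hKψ]; abel

set_option maxHeartbeats 2000000 in
/-- The unitary observable. After a change of phase, `⟪ψ, ψ'⟫ ≥ 0`, and a self-adjoint observable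
`K` that maps `(ψ + ψ') / 2` to `(ψ' - ψ) / (2 i)` has the property that
`(1 - i K) (ψ + ψ') / 2 = ψ` and `(1 + i K) (ψ + ψ') / 2 = ψ'`: its Cayley transform maps `ψ` to
`ψ'`. -/
theorem exists_localized_unitary [Nontrivial H] (hi : IsIrred π) (hn : IsNormalRep π)
    (hψ : ‖ψ‖ = 1) (hψ' : ‖ψ'‖ = 1) (hgns : IsGNSTriple π ψ ω) (hgns' : IsGNSTriple π ψ' ω')
    (hln : IsLocallyNormal ω) (hC : 0 ≤ C) (hα : 0 < α) (hdec : DecayAcrossAnnuli C α ω)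
    (hag : AgreeAtInfinity C α ω ω') :
    ∃ U : quasiLocal ι, U ∈ unitary (quasiLocal ι) ∧
      IsLocalizedWith (localizationError C α) U ∧ ψ' = π U ψ := by
  choose u hu hu1 huψ using fun n : ℕ => exists_local_transport hi hn hψ hψ' hgns.2 hgns'.2 hC hag
    (r := 2 ^ n) (by positivity)
  obtain ⟨ζ, hζ1, hζ⟩ := RCLike.exists_norm_eq_mul_self ⟪ψ, ψ'⟫_ℂ
  have hζζ : (starRingEnd ℂ) ζ * ζ = 1 := by
    rw [mul_comm, Complex.mul_conj, Complex.normSq_eq_norm_sq, hζ1]; simp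
  set t : ℝ := ‖⟪ψ, ψ'⟫_ℂ‖ with ht
  have hin : ⟪ψ, ζ • ψ'⟫_ℂ = (t : ℂ) := by rw [inner_smul_right]; exact hζ.symm
  have hin' : ⟪ζ • ψ', ψ⟫_ℂ = (t : ℂ) := by
    rw [← inner_conj_symm, hin, Complex.conj_ofReal]
  have hψ'' : ‖ζ • ψ'‖ = 1 := by rw [norm_smul, hζ1, hψ', one_mul]
  have h1 := norm_one_le_one (quasiLocal ι)
  have hζu : ∀ n, ‖ζ • u n‖ ≤ 1 := fun n => by rw [norm_smul, hζ1, one_mul]; exact hu1 n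
  have hhalf : ‖(2⁻¹ : ℂ)‖ = 2⁻¹ := by simp
  have hhalfI : ‖-(Complex.I * 2⁻¹)‖ = 2⁻¹ := by simp
  set θ : H := (2⁻¹ : ℂ) • (ψ + ζ • ψ') with hθ
  set η : H := (-(Complex.I * 2⁻¹)) • (ζ • ψ' - ψ) with hη
  have hθ1 : ‖θ‖ ≤ 1 := by
    have := norm_add_le ψ (ζ • ψ')
    rw [hθ, norm_smul, hhalf]; linarith
  have hθ2 : 1 / 2 ≤ ‖θ‖ ^ 2 := by
    rw [hθ, norm_smul, hhalf, mul_pow, @norm_add_sq ℂ, hψ, hψ'', hin, RCLike.re_eq_complex_re,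
      Complex.ofReal_re]
    have : 0 ≤ t := norm_nonneg _
    linarith
  have hη2 : ‖η‖ ≤ 2 := by
    have := norm_sub_le (ζ • ψ') ψ
    rw [hη, norm_smul, hhalfI]; linarith
  have hreal : (⟪η, θ⟫_ℂ).im = 0 := by
    have e : ⟪η, θ⟫_ℂ = 0 := by
      rw [hη, hθ, inner_smul_left, inner_smul_right, inner_sub_left, inner_add_right,
        inner_add_right, hin, hin', inner_self_eq_norm_sq_to_K, inner_self_eq_norm_sq_to_K, hψ,
        hψ'']
      ring
    rw [e, Complex.zero_im]
  have hd : ∀ n : ℕ, (2⁻¹ : ℝ) * ‖π (u n) ψ - ψ'‖ ≤ uhlmannError C α (2 ^ n) := fun n => by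
    linarith [huψ n, norm_nonneg (π (u n) ψ - ψ')]
  obtain ⟨K, B, hK, hKθ, hB0, hBN, hBsa, hKB⟩ := exists_selfAdjoint_apply_eq hi hn
    hψ hgns hln hC hα hdec hθ1 hθ2 hη2 hreal
    (S := fun n => (-(Complex.I * 2⁻¹)) • (ζ • u n - 1))
    (T := fun n => (2⁻¹ : ℂ) • (1 + ζ • u n))
    (fun n => (localOn ι _).smul_mem (sub_mem ((localOn ι _).smul_mem (hu n) ζ) (one_mem _)) _)
    (fun n => by
      have := norm_sub_le (ζ • u n) 1
      rw [norm_smul, hhalfI]; linarith [hζu n])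
    (fun n => by
      have e : π ((-(Complex.I * 2⁻¹)) • (ζ • u n - 1)) ψ - η =
          (-(Complex.I * 2⁻¹)) • ζ • (π (u n) ψ - ψ') := by
        rw [hη, map_smul, map_sub, map_smul, map_one, smul_apply, sub_apply, smul_apply,
          one_apply_eq_self]
        module
      rw [e, norm_smul, norm_smul, hhalfI, hζ1, one_mul]
      exact hd n)
    (fun n => (localOn ι _).smul_mem (add_mem (one_mem _) ((localOn ι _).smul_mem (hu n) ζ)) _)
    (fun n => by
      have := norm_add_le 1 (ζ • u n)
      rw [norm_smul, hhalf]; linarith [hζu n])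
    (fun n => by
      have e : π ((2⁻¹ : ℂ) • (1 + ζ • u n)) ψ - θ = (2⁻¹ : ℂ) • ζ • (π (u n) ψ - ψ') := by
        rw [hθ, map_smul, map_add, map_smul, map_one, smul_apply, add_apply, smul_apply,
          one_apply_eq_self]
        module
      rw [e, norm_smul, norm_smul, hhalf, hζ1, one_mul]
      exact hd n)
  obtain ⟨R, -, hR⟩ := exists_resolvent hK
  choose Q hQN hQ using fun n => exists_local_resolvent (hBN n) (hBsa n)
  have hζn : ‖(starRingEnd ℂ) ζ‖ = 1 := by rw [RCLike.norm_conj, hζ1]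
  refine ⟨(starRingEnd ℂ) ζ • cayley K R, ?_, isLocalizedWith_of_approx
    (fun n => (starRingEnd ℂ) ζ • cayley (B n) (Q n)) (fun S => ?_) (fun n => ?_) (fun n => ?_), ?_⟩
  · have hV := cayley_mem_unitary hK hR
    rw [Unitary.mem_iff] at hV ⊢
    rw [star_smul, smul_mul_smul_comm, smul_mul_smul_comm, hV.1, hV.2, RCLike.star_def,
      Complex.conj_conj, hζζ, mul_comm, hζζ, one_smul]
    exact ⟨rfl, rfl⟩
  · have hQ0 : Q 0 = 1 := by
      have := hQ 0
      rwa [hB0, mul_zero, add_zero, one_mul] at this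
    have h0 : cayley (B 0) (Q 0) ∈ localOn ι S :=
      cayley_mem (hB0 ▸ zero_mem _) (hQ0 ▸ one_mem _)
    exact (localOn ι S).smul_mem h0 _
  · exact (localOn ι _).smul_mem (cayley_mem (hBN n) (hQN n)) _
  · rw [← smul_sub, norm_smul, hζn, one_mul]
    exact (norm_cayley_sub_le hK (hBsa n) hR (hQ n)).trans
      (mul_le_mul_of_nonneg_left (hKB n) zero_le_two)
  · have e1 : π (1 - Complex.I • K) θ = ψ := by
      rw [map_sub, map_smul π Complex.I K, map_one, sub_apply, smul_apply, one_apply_eq_self, hKθ,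
        hθ, hη,
        smul_smul, mul_neg, ← mul_assoc, Complex.I_mul_I]
      module
    have e2 : π (1 + Complex.I • K) θ = ζ • ψ' := by
      rw [map_add, map_smul π Complex.I K, map_one, add_apply, smul_apply, one_apply_eq_self, hKθ,
        hθ, hη,
        smul_smul, mul_neg, ← mul_assoc, Complex.I_mul_I]
      module
    have e3 : π (cayley K R) ψ = ζ • ψ' := by
      rw [← e1, ← mul_apply_eq_comp, ← map_mul, cayley_mul hK hR, e2]
    rw [map_smul, smul_apply, e3, smul_smul, hζζ, one_smul]

end Final

end SpinLattice

theorem mainTheorem3 (C α : ℝ) (hC : 1 ≤ C) (hα : 0 < α) :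
    ∃ f : ℝ → ℝ, Asymptotics.SuperpolynomialDecay Filter.atTop (fun r : ℝ => r) f ∧
      ∀ (ι : Type*) (H : Type*) [NormedAddCommGroup H] [InnerProductSpace ℂ H] [CompleteSpace H]
        (π : SpinLattice.quasiLocal ι →⋆ₐ[ℂ] (H →L[ℂ] H))
        (ω ω' : SpinLattice.quasiLocal ι →ₗ[ℂ] ℂ) (ψ ψ' : H),
        SpinLattice.IsPureState ω → SpinLattice.IsPureState ω' →
        SpinLattice.IsLocallyNormal ω → SpinLattice.IsLocallyNormal ω' →
        SpinLattice.IsGNSTriple π ψ ω → SpinLattice.IsGNSTriple π ψ' ω' →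
        SpinLattice.DecayAcrossAnnuli C α ω → SpinLattice.DecayAcrossAnnuli C α ω' →
        SpinLattice.AgreeAtInfinity C α ω ω' →
          (∃ U : SpinLattice.quasiLocal ι, U ∈ unitary (SpinLattice.quasiLocal ι) ∧
            SpinLattice.IsLocalizedWith f U ∧ ψ' = π U ψ) ∧
          (∃ K : SpinLattice.quasiLocal ι, IsSelfAdjoint K ∧
            SpinLattice.IsLocalizedWith f K ∧ ∃ c : ℂ, ψ' - π K ψ = c • ψ) := by
  have hC0 : 0 ≤ C := zero_le_one.trans hC
  refine ⟨SpinLattice.localizationError C α,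
    SpinLattice.superpolynomialDecay_localizationError C hα, ?_⟩
  intro ι H _ _ _ π ω ω' ψ ψ' hω hω' hln _ hgns hgns' hdec _ hag
  have hψ := hgns.norm_eq_one hω.1
  have hψ' := hgns'.norm_eq_one hω'.1
  have : Nontrivial H := ⟨ψ, 0, fun h => by simp [h] at hψ⟩
  have hi := hgns.isIrred hω
  have hn := hgns.isNormalRep hln
  exact ⟨SpinLattice.exists_localized_unitary hi hn hψ hψ' hgns hgns' hln hC0 hα hdec hag,
    SpinLattice.exists_localized_selfAdjoint hi hn hψ hψ' hgns hgns' hln hC0 hα hdec hag⟩
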